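/- Let $\Sigma$ be a fixed finite alphabet. A pattern with one gap is $P=P_1\{\alpha,\beta\}P_2$ with nonempty strings $P_1,P_2$ over $\Sigma$ (its first and second subpattern) and integers $0\le\alpha\le\beta$. An occurrence of $P$ ending at the last character of a string $T$ is a gap length $g$ with $\alpha\le g\le\beta$ such that $P_1\,y\,P_2$ is a suffix of $T$ for some string $y$ of length $g$. For a nonempty dictionary $D$ of $d$ such patterns, where the gap bounds $\alpha,\beta$ may differ from pattern to pattern, let $|D|$ be the total length of its subpatterns, $\alpha^*$ the minimum of the left gap bounds, $\beta^*$ the maximum of the right gap bounds, $M$ the maximum length of a second subpattern, and $lsc$ the length of a longest sequence of (first or second) subpatterns in which each is a proper suffix of the next. In the online dictionary matching with one gap problem (DMOG), $D$ is preprocessed; then a text over $\Sigma$ arrives one character at a time, and after each character all occurrences of patterns of $D$ that end at this character have to be reported, each exactly once (as the index of the pattern and the gap length), before the next character arrives. Let $op$ be the number of these occurrences. Write $\tilde O(f)$ for $O(f\cdot\log^{O(1)}(f+2))$. Theorem. On a word RAM with words of at least $C\log_2(|D|+\beta^*)$ bits, for a suitable constant $C$, the online DMOG problem with non-uniform gap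 bounds can be solved by a deterministic algorithm with $O(|D|+d(\beta^*-\alpha^*))$ preprocessing time, worst-case time $\tilde O\big(lsc+\sqrt{lsc\cdot d}\,(\beta^*-\alpha^*+M)+op\big)$ per text character, and $\tilde O\big(|D|+d(\beta^*-\alpha^*)+\sqrt{lsc\cdot d}\,(\beta^*-\alpha^*+M)+\alpha^*\big)$ words of space. The algorithm and the constants in the bounds depend on $\Sigma$ only; the text may be arbitrarily long. -/

import Mathlib

/-! ## Dictionaries of patterns with one gap -/

namespace DMOG

/-- A pattern `fst {lo, hi} snd` with exactly one gap over the alphabet `Fin σ`: two nonempty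
subpatterns separated by a gap whose length is at least `lo` and at most `hi`. -/
structure GappedPattern (σ : ℕ) where
  fst : List (Fin σ)
  snd : List (Fin σ)
  lo : ℕ
  hi : ℕ
  fst_ne : fst ≠ []
  snd_ne : snd ≠ []
  lo_le_hi : lo ≤ hi

/-- A dictionary `P_0, …, P_{d-1}`; the number of patterns is `d = D.length`. -/
abbrev Dictionary (σ : ℕ) := List (GappedPattern σ)

variable {σ : ℕ}

/-- `|D|`: the total length of all subpatterns. -/
def size (D : Dictionary σ) : ℕ := (D.map fun P => P.fst.length + P.snd.length).sum

/-- `α*`: the least left gap border. -/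
noncomputable def alphaStar (D : Dictionary σ) : ℕ := sInf {a | ∃ P ∈ D, P.lo = a}

/-- `β*`: the greatest right gap border. -/
noncomputable def betaStar (D : Dictionary σ) : ℕ := sSup {b | ∃ P ∈ D, P.hi = b}

/-- `M`: the greatest length of a second subpattern. -/
noncomputable def maxSnd (D : Dictionary σ) : ℕ := sSup {m | ∃ P ∈ D, P.snd.length = m}

/-- `u` is a (first or second) subpattern of the dictionary. -/
def IsSubpattern (D : Dictionary σ) (u : List (Fin σ)) : Prop := ∃ P ∈ D, u = P.fst ∨ u = P.snd

/-- `lsc`: the length of a longest sequence of subpatterns of the dictionary in which each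
is a proper suffix of the next. -/
noncomputable def lsc (D : Dictionary σ) : ℕ :=
  sSup {n | ∃ c : List (List (Fin σ)), c.length = n ∧ (∀ u ∈ c, IsSubpattern D u) ∧
    c.IsChain fun u v => u <:+ v ∧ u ≠ v}

/-- The occurrences of patterns that end at the last character of the text `T`. The pair `(i, g)`
stands for the occurrence of the `i`-th pattern whose gap has length `g`; as its end is fixed,
`g` determines its position. -/
def occurrences (D : Dictionary σ) (T : List (Fin σ)) : Set (ℕ × ℕ) :=
  {p | ∃ P, D[p.1]? = some P ∧ P.lo ≤ p.2 ∧ p.2 ≤ P.hi ∧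
    ∃ y : List (Fin σ), y.length = p.2 ∧ P.fst ++ y ++ P.snd <:+ T}

/-! ## The word RAM

Programs are structured programs over `w`-bit words with a fixed number of registers (those the
program mentions) and a memory that is addressed by words. Every elementary instruction and every
evaluation of a test costs one unit of time. -/

inductive BinOp
  | add | sub | mul | div | mod

/-- The operations on `w`-bit words: addition and multiplication modulo `2 ^ w`, truncated
subtraction, quotient and remainder. -/
def BinOp.eval (w : ℕ) : BinOp → ℕ → ℕ → ℕ
  | .add, x, y => (x + y) % 2 ^ w
  | .sub, x, y => x - y
  | .mul, x, y => (x * y) % 2 ^ w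
  | .div, x, y => x / y
  | .mod, x, y => x % y

inductive Test
  | lt | eq

def Test.Holds : Test → ℕ → ℕ → Prop
  | .lt, x, y => x < y
  | .eq, x, y => x = y

inductive Cmd
  /-- register `r` := the constant `n` -/
  | const (r n : ℕ)
  /-- register `r` := `o` applied to registers `a` and `b` -/
  | op (o : BinOp) (r a b : ℕ)
  /-- register `r` := the memory cell whose address is in register `a` -/
  | load (r a : ℕ)
  /-- the memory cell whose address is in register `a` := register `b` -/
  | store (a b : ℕ)
  /-- report the pair of registers `a` and `b` -/
  | emit (a b : ℕ)
  | skip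
  | seq (c₁ c₂ : Cmd)
  /-- branch on a test of registers `a` and `b` -/
  | cond (t : Test) (a b : ℕ) (c₁ c₂ : Cmd)
  /-- repeat `c` as long as a test of registers `a` and `b` succeeds -/
  | loop (t : Test) (a b : ℕ) (c : Cmd)

/-- A configuration: the contents of registers and memory, together with three records of the
computation that no program can read. -/
structure Config where
  reg : ℕ → ℕ
  mem : ℕ → ℕ
  /-- time units spent -/
  time : ℕ
  /-- number of memory words in use: all addresses touched so far are below `space` -/
  space : ℕ
  /-- pairs reported -/
  out : List (ℕ × ℕ)

def Config.tick (s : Config) : Config := { s with time := s.time + 1 }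

def Config.setReg (s : Config) (r x : ℕ) : Config := { s with reg := Function.update s.reg r x }

def Config.setMem (s : Config) (a x : ℕ) : Config := { s with mem := Function.update s.mem a x }

/-- Record that the memory cell with address `a` is accessed. -/
def Config.touch (s : Config) (a : ℕ) : Config := { s with space := max s.space (a + 1) }

def Config.report (s : Config) (p : ℕ × ℕ) : Config := { s with out := s.out ++ [p] }

/-- `Exec w c s s'`: on the machine with `w`-bit words, the program `c`, started in `s`,
terminates in `s'`. -/
inductive Exec (w : ℕ) : Cmd → Config → Config → Prop
  | const (r n : ℕ) (s : Config) : Exec w (.const r n) s (s.tick.setReg r (n % 2 ^ w))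
  | op (o : BinOp) (r a b : ℕ) (s : Config) :
      Exec w (.op o r a b) s (s.tick.setReg r (o.eval w (s.reg a) (s.reg b)))
  | load (r a : ℕ) (s : Config) :
      Exec w (.load r a) s ((s.tick.touch (s.reg a)).setReg r (s.mem (s.reg a)))
  | store (a b : ℕ) (s : Config) :
      Exec w (.store a b) s ((s.tick.touch (s.reg a)).setMem (s.reg a) (s.reg b))
  | emit (a b : ℕ) (s : Config) : Exec w (.emit a b) s (s.tick.report (s.reg a, s.reg b))
  | skip (s : Config) : Exec w .skip s s.tick
  | seq {c₁ c₂ : Cmd} {s s' s'' : Config} :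
      Exec w c₁ s s' → Exec w c₂ s' s'' → Exec w (.seq c₁ c₂) s s''
  | cond_true {t : Test} {a b : ℕ} {c₁ c₂ : Cmd} {s s' : Config} :
      t.Holds (s.reg a) (s.reg b) → Exec w c₁ s.tick s' → Exec w (.cond t a b c₁ c₂) s s'
  | cond_false {t : Test} {a b : ℕ} {c₁ c₂ : Cmd} {s s' : Config} :
      ¬ t.Holds (s.reg a) (s.reg b) → Exec w c₂ s.tick s' → Exec w (.cond t a b c₁ c₂) s s'
  | loop_true {t : Test} {a b : ℕ} {c : Cmd} {s s' s'' : Config} :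
      t.Holds (s.reg a) (s.reg b) → Exec w c s.tick s' → Exec w (.loop t a b c) s' s'' →
      Exec w (.loop t a b c) s s''
  | loop_false {t : Test} {a b : ℕ} {c : Cmd} {s : Config} :
      ¬ t.Holds (s.reg a) (s.reg b) → Exec w (.loop t a b c) s s.tick

/-! ## Online algorithms -/

/-- The dictionary as a sequence of words: `d`, and then for each pattern its gap borders, the
lengths of its subpatterns, and its subpatterns, one word per character. -/
def encode (D : Dictionary σ) : List ℕ :=
  D.length :: D.flatMap fun P =>
    [P.lo, P.hi, P.fst.length, P.snd.length] ++ P.fst.map Fin.val ++ P.snd.map Fin.val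

/-- The initial configuration: the dictionary is in the memory, everything else is `0`. The words
that hold the dictionary count as used. -/
def initial (D : Dictionary σ) : Config where
  reg := fun _ => 0
  mem := fun a => (encode D).getD a 0
  time := 0
  space := (encode D).length
  out := []

/-- The arrival of a character: it is put into register `0`. The clock and the list of reported
pairs are restarted, so that they refer to this character alone. Memory and the other registers
persist, and so does the record of the space used. -/
def Config.feed (s : Config) (x : Fin σ) : Config :=
  { s with reg := Function.update s.reg 0 x, time := 0, out := [] }

/-- The first `n` characters of a stream. -/
def prefixOf (T : ℕ → Fin σ) (n : ℕ) : List (Fin σ) := (List.range n).map T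

/-- `x` is within `C · f · (log (f + 2)) ^ k`: for fixed `C` and `k` this is `x = Õ(f)`. -/
def SoftLE (C k : ℕ) (x f : ℝ) : Prop := x ≤ C * f * Real.log (f + 2) ^ k

end DMOG

set_option linter.constructorNameAsVariable false

namespace DMOG

/-! ## A small imperative language

Programs over named variables and named arrays, with arithmetic expressions over unbounded
naturals. They are compiled to the word RAM below. -/

inductive Var
  | ch | d | pos | i | k | h | x | c | y | z | nl | nw | nn | al | be | mm | q | cur | rr | ds
  | g | lo | hi | mid | hd | b | vid | tau
  deriving DecidableEq

inductive Arr
  | inp | LO | HI | LN | PS | CU | LV | G | F | DL | ID | VI | WT | RK | SZ | ST | NX | OI | CN | BB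
  | HD | FI | LK | ET | EH | RG
  deriving DecidableEq

def Var.idx (x : Var) : ℕ := x.ctorIdx
def Arr.idx (x : Arr) : ℕ := x.ctorIdx

/-- The number of variables, and the register that holds the base address of the arrays. -/
abbrev baseReg : ℕ := 28

/-- The number of arrays. -/
abbrev numArr : ℕ := 26

theorem Var.idx_lt (x : Var) : x.idx < baseReg := by cases x <;> decide

theorem Arr.idx_lt (x : Arr) : x.idx < numArr := by cases x <;> decide

theorem Var.idx_inj {x y : Var} (h : x.idx = y.idx) : x = y := by
  cases x <;> cases y <;> first | rfl | exact absurd h (by decide)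

theorem Arr.idx_inj {x y : Arr} (h : x.idx = y.idx) : x = y := by
  cases x <;> cases y <;> first | rfl | exact absurd h (by decide)

/-- States: variables, arrays, number of steps, reported pairs. -/
structure St where
  v : Var → ℕ
  a : Arr → ℕ → ℕ
  t : ℕ
  out : List (ℕ × ℕ)

namespace St

def tick (s : St) : St := { s with t := s.t + 1 }
def setV (s : St) (x : Var) (n : ℕ) : St := { s with v := Function.update s.v x n }
def setA (s : St) (j : Arr) (i n : ℕ) : St :=
  { s with a := Function.update s.a j (Function.update (s.a j) i n) }
def put (s : St) (p : ℕ × ℕ) : St := { s with out := s.out ++ [p] }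

variable (s : St) (x y : Var) (j l : Arr) (i n : ℕ) (p : ℕ × ℕ)

@[simp] theorem tick_v : s.tick.v = s.v := rfl
@[simp] theorem tick_a : s.tick.a = s.a := rfl
@[simp] theorem tick_t : s.tick.t = s.t + 1 := rfl
@[simp] theorem tick_out : s.tick.out = s.out := rfl
@[simp] theorem setV_v_self : (s.setV x n).v x = n := by simp [setV]
@[simp] theorem setV_v_ne {x y : Var} (h : y ≠ x) : (s.setV x n).v y = s.v y := by simp [setV, h]
@[simp] theorem setV_a : (s.setV x n).a = s.a := rfl
@[simp] theorem setV_t : (s.setV x n).t = s.t := rfl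
@[simp] theorem setV_out : (s.setV x n).out = s.out := rfl
@[simp] theorem setA_v : (s.setA j i n).v = s.v := rfl
@[simp] theorem setA_a_self : (s.setA j i n).a j = Function.update (s.a j) i n := by simp [setA]
@[simp] theorem setA_a_ne {j l : Arr} (h : l ≠ j) : (s.setA j i n).a l = s.a l := by simp [setA, h]
@[simp] theorem setA_t : (s.setA j i n).t = s.t := rfl
@[simp] theorem setA_out : (s.setA j i n).out = s.out := rfl
@[simp] theorem put_v : (s.put p).v = s.v := rfl
@[simp] theorem put_a : (s.put p).a = s.a := rfl
@[simp] theorem put_t : (s.put p).t = s.t := rfl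
@[simp] theorem put_out : (s.put p).out = s.out ++ [p] := rfl

end St

inductive E
  | num (c : ℕ)
  | var (r : Var)
  | op (o : BinOp) (e f : E)
  | rd (j : Arr) (e : E)

namespace E

instance : Coe Var E := ⟨E.var⟩
instance (m : ℕ) : OfNat E m := ⟨E.num m⟩
instance : Add E := ⟨E.op .add⟩
instance : Sub E := ⟨E.op .sub⟩
instance : Mul E := ⟨E.op .mul⟩
instance : Div E := ⟨E.op .div⟩
instance : Mod E := ⟨E.op .mod⟩

/-- The operations on unbounded naturals. -/
def opEval : BinOp → ℕ → ℕ → ℕ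
  | .add, x, y => x + y
  | .sub, x, y => x - y
  | .mul, x, y => x * y
  | .div, x, y => x / y
  | .mod, x, y => x % y

def eval (s : St) : E → ℕ
  | .num c => c
  | .var r => s.v r
  | .op o e f => opEval o (e.eval s) (f.eval s)
  | .rd j e => s.a j (e.eval s)

/-- All array accesses in the expression are below the bound `S`. -/
def ok (S : ℕ) (s : St) : E → Prop
  | .num _ => True
  | .var _ => True
  | .op _ e f => e.ok S s ∧ f.ok S s
  | .rd _ e => e.ok S s ∧ e.eval s < S

variable (S : ℕ) (s : St) (e f : E)

@[simp] theorem eval_num (c : ℕ) : (E.num c).eval s = c := rfl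
@[simp] theorem eval_var (r : Var) : (E.var r).eval s = s.v r := rfl
@[simp] theorem eval_rd (j : Arr) : (E.rd j e).eval s = s.a j (e.eval s) := rfl
@[simp] theorem eval_zero : (0 : E).eval s = 0 := rfl
@[simp] theorem eval_one : (1 : E).eval s = 1 := rfl
@[simp] theorem eval_two : (2 : E).eval s = 2 := rfl
@[simp] theorem eval_three : (3 : E).eval s = 3 := rfl
@[simp] theorem eval_four : (4 : E).eval s = 4 := rfl
@[simp] theorem eval_add : (e + f).eval s = e.eval s + f.eval s := rfl
@[simp] theorem eval_sub : (e - f).eval s = e.eval s - f.eval s := rfl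
@[simp] theorem eval_mul : (e * f).eval s = e.eval s * f.eval s := rfl
@[simp] theorem eval_div : (e / f).eval s = e.eval s / f.eval s := rfl
@[simp] theorem eval_mod : (e % f).eval s = e.eval s % f.eval s := rfl
@[simp] theorem ok_num (c : ℕ) : (E.num c).ok S s ↔ True := Iff.rfl
@[simp] theorem ok_var (r : Var) : (E.var r).ok S s ↔ True := Iff.rfl
@[simp] theorem ok_rd (j : Arr) : (E.rd j e).ok S s ↔ e.ok S s ∧ e.eval s < S := Iff.rfl
@[simp] theorem ok_zero : (0 : E).ok S s ↔ True := Iff.rfl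
@[simp] theorem ok_one : (1 : E).ok S s ↔ True := Iff.rfl
@[simp] theorem ok_two : (2 : E).ok S s ↔ True := Iff.rfl
@[simp] theorem ok_three : (3 : E).ok S s ↔ True := Iff.rfl
@[simp] theorem ok_four : (4 : E).ok S s ↔ True := Iff.rfl
@[simp] theorem ok_add : (e + f).ok S s ↔ e.ok S s ∧ f.ok S s := Iff.rfl
@[simp] theorem ok_sub : (e - f).ok S s ↔ e.ok S s ∧ f.ok S s := Iff.rfl
@[simp] theorem ok_mul : (e * f).ok S s ↔ e.ok S s ∧ f.ok S s := Iff.rfl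
@[simp] theorem ok_div : (e / f).ok S s ↔ e.ok S s ∧ f.ok S s := Iff.rfl
@[simp] theorem ok_mod : (e % f).ok S s ↔ e.ok S s ∧ f.ok S s := Iff.rfl

end E

inductive Prog
  | asg (x : Var) (e : E)
  | wr (j : Arr) (i e : E)
  | emit (e f : E)
  | skip
  | seq (p q : Prog)
  | ite (t : Test) (e f : E) (p q : Prog)
  | whl (t : Test) (e f : E) (p : Prog)

notation:60 p:61 ";;" q:60 => Prog.seq p q

/-- `wp S p Q s`: started in `s`, the program `p` terminates in a state that satisfies `Q`; all
array indices stay below `S`, and all values that are stored are at most `S`. -/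
def wp (S : ℕ) : Prog → (St → Prop) → St → Prop
  | .asg x e, Q, s => e.ok S s ∧ e.eval s ≤ S ∧ Q (s.tick.setV x (e.eval s))
  | .wr j i e, Q, s => i.ok S s ∧ e.ok S s ∧ i.eval s < S ∧ e.eval s ≤ S ∧
      Q (s.tick.setA j (i.eval s) (e.eval s))
  | .emit e f, Q, s => e.ok S s ∧ f.ok S s ∧ Q (s.tick.put (e.eval s, f.eval s))
  | .skip, Q, s => Q s.tick
  | .seq p q, Q, s => wp S p (wp S q Q) s
  | .ite t e f p q, Q, s => e.ok S s ∧ f.ok S s ∧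
      (t.Holds (e.eval s) (f.eval s) → wp S p Q s.tick) ∧
      (¬ t.Holds (e.eval s) (f.eval s) → wp S q Q s.tick)
  | .whl t e f p, Q, s => ∃ (I : St → Prop) (μ : St → ℕ), I s ∧ ∀ s, I s →
      e.ok S s ∧ f.ok S s ∧
      (t.Holds (e.eval s) (f.eval s) → wp S p (fun s' => I s' ∧ μ s' < μ s) s.tick) ∧
      (¬ t.Holds (e.eval s) (f.eval s) → Q s.tick)

/-! ### Rules for weakest preconditions: monotonicity, framing, counting loops. -/

theorem wp_mono {S : ℕ} {p : Prog} {Q Q' : St → Prop} {s : St} (h : wp S p Q s)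
    (hQ : ∀ s', Q s' → Q' s') : wp S p Q' s := by
  induction p generalizing Q Q' s with
  | asg x e => exact ⟨h.1, h.2.1, hQ _ h.2.2⟩
  | wr j i e => exact ⟨h.1, h.2.1, h.2.2.1, h.2.2.2.1, hQ _ h.2.2.2.2⟩
  | emit e f => exact ⟨h.1, h.2.1, hQ _ h.2.2⟩
  | skip => exact hQ _ h
  | seq p q ihp ihq => exact ihp h fun s' h' => ihq h' hQ
  | ite t e f p q ihp ihq =>
    exact ⟨h.1, h.2.1, fun c => ihp (h.2.2.1 c) hQ, fun c => ihq (h.2.2.2 c) hQ⟩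
  | whl t e f p ih =>
    obtain ⟨I, μ, h0, h⟩ := h
    exact ⟨I, μ, h0, fun s hs => ⟨(h s hs).1, (h s hs).2.1, (h s hs).2.2.1,
      fun c => hQ _ ((h s hs).2.2.2 c)⟩⟩

namespace Prog

/-- The variables that a program may modify. -/
def mv : Prog → Var → Bool
  | asg x _, y => decide (x = y)
  | seq p q, y => p.mv y || q.mv y
  | ite _ _ _ p q, y => p.mv y || q.mv y
  | whl _ _ _ p, y => p.mv y
  | _, _ => false

/-- The arrays that a program may modify. -/
def ma : Prog → Arr → Bool
  | wr j _ _, l => decide (j = l)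
  | seq p q, l => p.ma l || q.ma l
  | ite _ _ _ p q, l => p.ma l || q.ma l
  | whl _ _ _ p, l => p.ma l
  | _, _ => false

/-- Whether a program contains a report. -/
def em : Prog → Bool
  | emit _ _ => true
  | seq p q => p.em || q.em
  | ite _ _ _ p q => p.em || q.em
  | whl _ _ _ p => p.em
  | _ => false

end Prog

/-- `s'` agrees with `s` on everything that `p` does not modify. -/
structure Frame (p : Prog) (s s' : St) : Prop where
  v : ∀ y, p.mv y = false → s'.v y = s.v y
  a : ∀ j, p.ma j = false → s'.a j = s.a j
  out : p.em = false → s'.out = s.out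

theorem Frame.refl (p : Prog) (s : St) : Frame p s s := ⟨fun _ _ => rfl, fun _ _ => rfl, fun _ => rfl⟩

theorem Frame.trans {p q r : Prog} {s s' s'' : St} (h : Frame p s s') (h' : Frame q s' s'')
    (hv : ∀ y, r.mv y = false → p.mv y = false ∧ q.mv y = false)
    (ha : ∀ y, r.ma y = false → p.ma y = false ∧ q.ma y = false)
    (ho : r.em = false → p.em = false ∧ q.em = false) : Frame r s s'' :=
  ⟨fun y hy => (h'.v y (hv y hy).2).trans (h.v y (hv y hy).1),
   fun y hy => (h'.a y (ha y hy).2).trans (h.a y (ha y hy).1),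
   fun hy => (h'.out (ho hy).2).trans (h.out (ho hy).1)⟩

/-- What a program modifies is computed from its syntax, so later proofs obtain unchanged variables
and arrays by `rfl`, and loop invariants mention only what changes. -/
theorem wp_frame {S : ℕ} {p : Prog} {Q : St → Prop} {s : St} (h : wp S p Q s) :
    wp S p (fun s' => Q s' ∧ Frame p s s') s := by
  induction p generalizing Q s with
  | asg x e =>
    refine ⟨h.1, h.2.1, h.2.2, ⟨fun y hy => ?_, fun _ _ => rfl, fun _ => rfl⟩⟩
    have : y ≠ x := fun h => by simp [Prog.mv, h] at hy
    simp [this]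
  | wr j i e =>
    refine ⟨h.1, h.2.1, h.2.2.1, h.2.2.2.1, h.2.2.2.2, ⟨fun _ _ => rfl, fun y hy => ?_, fun _ => rfl⟩⟩
    have : y ≠ j := fun h => by simp [Prog.ma, h] at hy
    simp [this]
  | emit e f =>
    exact ⟨h.1, h.2.1, h.2.2, ⟨fun _ _ => rfl, fun _ _ => rfl, fun h => by simp [Prog.em] at h⟩⟩
  | skip => exact ⟨h, ⟨fun _ _ => rfl, fun _ _ => rfl, fun _ => rfl⟩⟩
  | seq p q ihp ihq =>
    refine wp_mono (p := p) (ihp h) fun s' h' => wp_mono (ihq h'.1) fun s'' h'' => ⟨h''.1, ?_⟩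
    exact h'.2.trans h''.2 (by simp [Prog.mv]) (by simp [Prog.ma]) (by simp [Prog.em])
  | ite t e f p q ihp ihq =>
    refine ⟨h.1, h.2.1, fun c => wp_mono (ihp (h.2.2.1 c)) fun s' h' => ⟨h'.1, ?_⟩,
      fun c => wp_mono (ihq (h.2.2.2 c)) fun s' h' => ⟨h'.1, ?_⟩⟩
    · exact ⟨fun y hy => h'.2.v y (by simp_all [Prog.mv]),
        fun y hy => h'.2.a y (by simp_all [Prog.ma]), fun hy => h'.2.out (by simp_all [Prog.em])⟩
    · exact ⟨fun y hy => h'.2.v y (by simp_all [Prog.mv]),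
        fun y hy => h'.2.a y (by simp_all [Prog.ma]), fun hy => h'.2.out (by simp_all [Prog.em])⟩
  | whl t e f p ih =>
    obtain ⟨I, μ, h0, h⟩ := h
    refine ⟨fun s' => I s' ∧ Frame p s s', μ, ⟨h0, Frame.refl _ _⟩, fun s' hs => ?_⟩
    refine ⟨(h s' hs.1).1, (h s' hs.1).2.1, fun c => ?_, fun c => ⟨(h s' hs.1).2.2.2 c, ?_⟩⟩
    · refine wp_mono (ih ((h s' hs.1).2.2.1 c)) fun s'' h'' => ⟨⟨h''.1.1, ?_⟩, h''.1.2⟩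
      exact hs.2.trans (q := p) (r := p) ⟨h''.2.v, h''.2.a, h''.2.out⟩
        (by simp) (by simp) (by simp)
    · exact ⟨hs.2.v, hs.2.a, hs.2.out⟩

/-- Sequential composition: the second program may use the frame of the first. -/
theorem wp_seq {S : ℕ} {p q : Prog} {Q R : St → Prop} {s : St} (h : wp S p R s)
    (hq : ∀ s', R s' → Frame p s s' → wp S q Q s') : wp S (p;;q) Q s :=
  wp_mono (p := p) (wp_frame (p := p) h) fun s' h' => hq s' h'.1 h'.2

/-- The counting loop: `p` is run for `x = 0, 1, …` as long as `x < e`. -/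
def Prog.for (x : Var) (e : E) (p : Prog) : Prog :=
  .asg x 0;;.whl .lt x e (p;;.asg x (x + 1))

/-- The bound of the loop must keep the value `n` throughout, which is what `he` asks; in return,
termination and the bookkeeping of the counter are settled once. In `f i + 2` the `2` pays for the
test and the increment. -/
theorem wp_for {S : ℕ} {x : Var} {e : E} {p : Prog} {Q : St → Prop} {s : St} (n : ℕ)
    (I : ℕ → St → Prop) (f : ℕ → ℕ) (hn : n ≤ S) (h0 : I 0 (s.tick.setV x 0))
    (he : ∀ i s', I i s' → Frame (.for x e p) s s' → e.ok S s' ∧ e.eval s' = n)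
    (hstep : ∀ i s', i < n → I i s' → s'.v x = i → Frame (.for x e p) s s' →
      wp S p (fun s'' => s''.v x = i ∧ I (i + 1) (s''.tick.setV x (i + 1)) ∧ s''.t ≤ s'.t + 1 + f i)
        s'.tick)
    (hQ : ∀ s', I n s' → Frame (.for x e p) s s' → s'.t ≤ s.t + 1 + ∑ i ∈ Finset.range n, (f i + 2) →
      Q s'.tick) :
    wp S (.for x e p) Q s := by
  have hF : Frame (.for x e p) s (s.tick.setV x 0) :=
    ⟨fun y hy => by
      have : y ≠ x := fun h => by simp [Prog.for, Prog.mv, h] at hy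
      simp [this], fun _ _ => rfl, fun _ => rfl⟩
  refine ⟨by simp, by simp, ?_⟩
  refine ⟨fun s' => s'.v x ≤ n ∧ I (s'.v x) s' ∧ Frame (.for x e p) s s' ∧
    s'.t ≤ s.t + 1 + ∑ i ∈ Finset.range (s'.v x), (f i + 2), fun s' => n - s'.v x,
    ⟨by simp, by simpa using h0, hF, by simp⟩, ?_⟩
  rintro s' ⟨hx, hI, hF', ht⟩
  obtain ⟨hok, hev⟩ := he _ _ hI hF'
  refine ⟨by simp, hok, fun hc => ?_, fun hc => ?_⟩
  · simp only [Test.Holds, E.eval_var, hev] at hc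
    refine wp_mono (p := p) (wp_frame (p := p) (hstep _ s' hc hI rfl hF')) ?_
    rintro s'' ⟨⟨h1, h2, h3⟩, hF''⟩
    simp only [wp, E.ok_add, E.ok_var, E.ok_one, E.eval_add, E.eval_var, E.eval_one, h1]
    refine ⟨by simp, by omega, ⟨by simp; omega, by simpa using h2, ?_, ?_⟩, by simp; omega⟩
    · refine ⟨fun y hy => ?_, fun y hy => ?_, fun hy => ?_⟩
      · have : y ≠ x := fun h => by simp [Prog.for, Prog.mv, h] at hy
        have h4 : p.mv y = false := by simp_all [Prog.for, Prog.mv]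
        simp [this, hF''.v y h4, hF'.v y hy]
      · have h4 : p.ma y = false := by simp_all [Prog.for, Prog.ma]
        simp [hF''.a y h4, hF'.a y hy]
      · have h4 : p.em = false := by simp_all [Prog.for, Prog.em]
        simp [hF''.out h4, hF'.out hy]
    · simp only [St.setV_t, St.tick_t, St.setV_v_self, Finset.sum_range_succ]
      omega
  · simp only [Test.Holds, E.eval_var, hev] at hc
    have hxn : s'.v x = n := by omega
    rw [hxn] at hI ht
    exact hQ s' hI hF' ht

/-! ## Compilation to the word RAM -/

namespace E

/-- Evaluate the expression into register `r`; arrays are interleaved with stride `K`. -/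
def comp (K : ℕ) : E → ℕ → Cmd
  | .num c, r => .const r c
  | .var y, r => .seq (.const r 0) (.op .add r y.idx r)
  | .op o e f, r => .seq (e.comp K r) (.seq (f.comp K (r + 1)) (.op o r r (r + 1)))
  | .rd j e, r => .seq (e.comp K r) (.seq (.const (r + 1) K) (.seq (.op .mul r r (r + 1))
      (.seq (.const (r + 1) j.idx) (.seq (.op .add r r (r + 1)) (.seq (.op .add r r baseReg)
        (.load r r))))))

/-- The running time of the compiled expression. -/
def cost : E → ℕ
  | .num _ => 1
  | .var _ => 2
  | .op _ e f => e.cost + f.cost + 1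
  | .rd _ e => e.cost + 6

/-- The degree of a polynomial that bounds the values. -/
def deg : E → ℕ
  | .num _ => 1
  | .var _ => 1
  | .op _ e f => e.deg + f.deg
  | .rd _ e => e.deg

/-- The greatest constant. -/
def cst : E → ℕ
  | .num c => c
  | .var _ => 0
  | .op _ e f => max e.cst f.cst
  | .rd _ e => e.cst

/-- All arrays that occur have a number below `K`. -/
def inLay (K : ℕ) : E → Prop
  | .num _ => True
  | .var _ => True
  | .op _ e f => e.inLay K ∧ f.inLay K
  | .rd j e => j.idx < K ∧ e.inLay K

theorem inLay_numArr (e : E) : e.inLay numArr := by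
  induction e with
  | num | var => trivial
  | op o e f h1 h2 => exact ⟨h1, h2⟩
  | rd j e h => exact ⟨j.idx_lt, h⟩

theorem one_le_deg (e : E) : 1 ≤ e.deg := by
  induction e with
  | num | var => exact le_rfl
  | op o e f h1 h2 => simp only [deg]; omega
  | rd j e h => exact h

end E

/-- The high-level state `h` is represented by the configuration `c`: stride `K`, base `b`,
bound `S`, time factor `κ`. -/
structure Rel (K b S κ : ℕ) (h : St) (c : Config) : Prop where
  reg : ∀ x : Var, c.reg x.idx = h.v x
  base : c.reg baseReg = b
  mem : ∀ j : Arr, j.idx < K → ∀ i < S, c.mem (b + K * i + j.idx) = h.a j i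
  regLe : ∀ x, h.v x ≤ S
  memLe : ∀ j : Arr, j.idx < K → ∀ i < S, h.a j i ≤ S
  time : c.time ≤ κ * h.t
  space : c.space ≤ b + K * S
  out : c.out = h.out

section sim

variable {K b S κ w B m : ℕ}

/-- Since `2 ≤ B` and the exponents are positive, both bounds are at least `2`, where a sum is at
most the product. Every operation may thus be counted like a multiplication, which adds degrees. -/
theorem E.opEval_le {o : BinOp} {x y B m n : ℕ} (hB : 2 ≤ B) (hm : 1 ≤ m) (hn : 1 ≤ n)
    (hx : x ≤ B ^ m) (hy : y ≤ B ^ n) : E.opEval o x y ≤ B ^ (m + n) := by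
  have h1 : 2 ≤ B ^ m := hB.trans (Nat.le_self_pow (by omega) B)
  have h2 : 2 ≤ B ^ n := hB.trans (Nat.le_self_pow (by omega) B)
  have h3 : B ^ m ≤ B ^ (m + n) := Nat.pow_le_pow_right (by omega) (by omega)
  cases o with
  | add => rw [pow_add]; simp only [E.opEval]; nlinarith
  | sub => simp only [E.opEval]; omega
  | mul => rw [pow_add]; exact Nat.mul_le_mul hx hy
  | div => exact (Nat.div_le_self _ _).trans (hx.trans h3)
  | mod => exact (Nat.mod_le _ _).trans (hx.trans h3)

theorem E.eval_le {e : E} {h : St} (hB : 2 ≤ B) (hS : S ≤ B) (hc : e.cst ≤ B)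
    (hlay : e.inLay K) (hr : ∀ x, h.v x ≤ S) (hm : ∀ j : Arr, j.idx < K → ∀ i < S, h.a j i ≤ S)
    (hok : e.ok S h) : e.eval h ≤ B ^ e.deg := by
  have h1 : ∀ n, 1 ≤ n → B ≤ B ^ n := fun n hn => Nat.le_self_pow (by omega) B
  induction e with
  | num c => simpa [E.deg, E.cst] using hc
  | var y => simpa [E.deg] using (hr y).trans hS
  | op o e f ih1 ih2 =>
    simp only [E.cst, max_le_iff] at hc
    exact E.opEval_le hB e.one_le_deg f.one_le_deg (ih1 hc.1 hlay.1 hok.1) (ih2 hc.2 hlay.2 hok.2)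
  | rd j e ih => exact (hm j hlay.1 _ hok.2).trans (hS.trans (h1 _ e.one_le_deg))

/-- Assumptions under which no operation overflows. -/
structure Fits (K b S w B m : ℕ) : Prop where
  two : 2 ≤ B
  sle : S ≤ B
  addr : b + K * S ≤ B
  kle : K ≤ B
  lt : B ^ m < 2 ^ w
  hm : 1 ≤ m

/-- Temporaries form a stack: code compiled for register `r` writes only to registers from `r` on,
above all variables and the base. Hence a left operand in `r` survives the evaluation of the right
one in `r + 1`. The word operations agree with those on naturals because `E.eval_le` keeps every
result below `2 ^ w`. -/
theorem E.comp_spec (hf : Fits K b S w B m) {e : E} {h : St} {c : Config}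
    (hreg : ∀ x : Var, c.reg x.idx = h.v x) (hbase : c.reg baseReg = b)
    (hmem : ∀ j : Arr, j.idx < K → ∀ i < S, c.mem (b + K * i + j.idx) = h.a j i)
    (hr : ∀ x, h.v x ≤ S) (hm : ∀ j : Arr, j.idx < K → ∀ i < S, h.a j i ≤ S)
    (hsp : c.space ≤ b + K * S)
    (hc : e.cst ≤ B) (hlay : e.inLay K) (hdeg : e.deg ≤ m) (hok : e.ok S h) {r : ℕ}
    (hbr : baseReg < r) :
    ∃ c', Exec w (e.comp K r) c c' ∧ c'.reg r = e.eval h ∧ (∀ r' < r, c'.reg r' = c.reg r') ∧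
      c'.mem = c.mem ∧ c'.out = c.out ∧ c'.time = c.time + e.cost ∧ c'.space ≤ b + K * S := by
  have hw : ∀ x, x ≤ B → x < 2 ^ w := fun x hx =>
    lt_of_le_of_lt (hx.trans (Nat.le_self_pow (by have := hf.hm; omega) B)) hf.lt
  induction e generalizing c r with
  | num k =>
    exact ⟨_, .const .., by
        simp only [Config.setReg, Config.tick, Function.update_self, E.eval_num]
        exact Nat.mod_eq_of_lt (hw _ hc),
      fun r' hr' => by simp [Config.setReg, Config.tick, (Nat.ne_of_lt hr')], rfl, rfl, rfl, hsp⟩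
  | var y =>
    have hy := y.idx_lt
    refine ⟨_, .seq (.const ..) (.op ..), ?_, fun r' hr' => ?_, rfl, rfl, rfl, hsp⟩
    · have h1 : y.idx ≠ r := by omega
      simp [Config.setReg, Config.tick, BinOp.eval, h1, hreg]
      exact Nat.mod_eq_of_lt (hw _ ((hr y).trans hf.sle))
    · simp [Config.setReg, Config.tick, (Nat.ne_of_lt hr')]
  | op o e f ih1 ih2 =>
    have hle := E.eval_le hf.two hf.sle hc hlay hr hm hok
    simp only [E.cst, max_le_iff] at hc
    simp only [E.deg] at hdeg
    obtain ⟨c1, x1, v1, k1, m1, o1, t1, s1⟩ :=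
      ih1 hreg hbase hmem hsp hc.1 hlay.1 (by omega) hok.1 hbr
    obtain ⟨c2, x2, v2, k2, m2, o2, t2, s2⟩ :=
      ih2 (c := c1) (r := r + 1)
        (fun x => by rw [k1 _ (by have := x.idx_lt; omega), hreg])
        (by rw [k1 _ (by omega), hbase]) (by rw [m1]; exact hmem) s1 hc.2 hlay.2 (by omega) hok.2
        (by omega)
    refine ⟨_, .seq x1 (.seq x2 (.op ..)), ?_, fun r' hr' => ?_, ?_, ?_, ?_, ?_⟩
    · have hlt : E.opEval o (e.eval h) (f.eval h) < 2 ^ w :=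
        lt_of_le_of_lt (hle.trans (Nat.pow_le_pow_right (by have := hf.two; omega) hdeg)) hf.lt
      have e1 : c2.reg r = e.eval h := by rw [k2 r (by omega), v1]
      simp only [Config.setReg, Config.tick, Function.update_self, e1, v2, E.eval]
      cases o <;> simp only [BinOp.eval, E.opEval] at hlt ⊢ <;> exact Nat.mod_eq_of_lt hlt
    · simp [Config.setReg, Config.tick, (Nat.ne_of_lt hr')]
      rw [k2 _ (by omega), k1 _ hr']
    · simp [Config.setReg, Config.tick, m1, m2]
    · simp [Config.setReg, Config.tick, o1, o2]
    · simp [Config.setReg, Config.tick, t1, t2, E.cost]; omega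
    · exact s2
  | rd j e ih =>
    obtain ⟨c1, x1, v1, k1, m1, o1, t1, s1⟩ := ih hreg hbase hmem hsp hc hlay.2 hdeg hok.1 hbr
    have hi := hok.2
    have hj := hlay.1
    have hb : c1.reg baseReg = b := by rw [k1 _ hbr, hbase]
    have hbr' : (baseReg : ℕ) ≠ r := by omega
    have hbr2 : (baseReg : ℕ) ≠ r + 1 := by omega
    have hadr : b + K * e.eval h + j.idx < b + K * S := by
      have : K * (e.eval h + 1) ≤ K * S := Nat.mul_le_mul_left _ hi
      rw [mul_add] at this; omega
    have hK : K % 2 ^ w = K := Nat.mod_eq_of_lt (hw _ hf.kle)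
    have hJ : j.idx % 2 ^ w = j.idx := Nat.mod_eq_of_lt (hw _ (by have := hf.kle; omega))
    have a1 : (e.eval h * K) % 2 ^ w = e.eval h * K :=
      Nat.mod_eq_of_lt (hw _ (by have := hf.addr; rw [mul_comm]; omega))
    have a2 : (e.eval h * K + j.idx) % 2 ^ w = e.eval h * K + j.idx :=
      Nat.mod_eq_of_lt (hw _ (by have := hf.addr; rw [mul_comm]; omega))
    have a3 : (e.eval h * K + j.idx + b) % 2 ^ w = b + K * e.eval h + j.idx := by
      rw [Nat.mod_eq_of_lt (hw _ (by have := hf.addr; rw [mul_comm]; omega)), mul_comm]; omega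
    have hr1 : r ≠ r + 1 := by omega
    refine ⟨_, .seq x1 (.seq (.const ..) (.seq (.op ..) (.seq (.const ..) (.seq (.op ..)
      (.seq (.op ..) (.load ..)))))), ?_, fun r' hr' => ?_, ?_, ?_, ?_, ?_⟩
    · simp [Config.setReg, Config.tick, Config.touch, BinOp.eval, hbr',
        hbr2, hK, hJ, v1, hb, a1, a2, a3, m1, hmem j hj _ hi, -Nat.add_mod_mod, -Nat.mod_add_mod]
    · have h2 : r' ≠ r := by omega
      have h3 : r' ≠ r + 1 := by omega
      simp [Config.setReg, Config.tick, Config.touch, Function.update_apply, h2, h3, k1 _ hr']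
    · simp [Config.setReg, Config.tick, Config.touch, m1]
    · simp [Config.setReg, Config.tick, Config.touch, o1]
    · simp [Config.setReg, Config.tick, Config.touch, t1, E.cost]; omega
    · simp [Config.setReg, Config.tick, Config.touch, BinOp.eval, hbr',
        hbr2, hK, hJ, v1, hb, a1, a2, a3, -Nat.add_mod_mod, -Nat.mod_add_mod]
      exact ⟨s1, by omega⟩

end sim

namespace Prog

abbrev tmp : ℕ := baseReg + 1

def evalTwo (K : ℕ) (e f : E) : Cmd := .seq (e.comp K tmp) (f.comp K (tmp + 1))

/-- A RAM loop tests two fixed registers, so the test expressions are evaluated once before the loop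
and again at the end of every round. For lack of a copy instruction, an assignment adds `0`. -/
def comp (K : ℕ) : Prog → Cmd
  | asg x e => .seq (e.comp K tmp) (.seq (.const (tmp + 1) 0) (.op .add x.idx tmp (tmp + 1)))
  | wr j i e => .seq (evalTwo K i e) (.seq (.const (tmp + 2) K) (.seq (.op .mul tmp tmp (tmp + 2))
      (.seq (.const (tmp + 2) j.idx) (.seq (.op .add tmp tmp (tmp + 2))
        (.seq (.op .add tmp tmp baseReg) (.store tmp (tmp + 1)))))))
  | emit e f => .seq (evalTwo K e f) (.emit tmp (tmp + 1))
  | skip => .skip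
  | seq p q => .seq (p.comp K) (q.comp K)
  | ite t e f p q => .seq (evalTwo K e f) (.cond t tmp (tmp + 1) (p.comp K) (q.comp K))
  | whl t e f p => .seq (evalTwo K e f) (.loop t tmp (tmp + 1) (.seq (p.comp K) (evalTwo K e f)))

/-- A bound on the cost of a single step. -/
def cost : Prog → ℕ
  | asg _ e => e.cost + 2
  | wr _ i e => i.cost + e.cost + 6
  | emit e f => e.cost + f.cost + 1
  | skip => 1
  | seq p q => max p.cost q.cost
  | ite _ e f p q => max (e.cost + f.cost + 1) (max p.cost q.cost)
  | whl _ e f p => max (e.cost + f.cost + 1) p.cost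

def deg : Prog → ℕ
  | asg _ e => e.deg
  | wr _ i e => max i.deg e.deg
  | emit e f => max e.deg f.deg
  | skip => 1
  | seq p q => max p.deg q.deg
  | ite _ e f p q => max (max e.deg f.deg) (max p.deg q.deg)
  | whl _ e f p => max (max e.deg f.deg) p.deg

def cst : Prog → ℕ
  | asg _ e => e.cst
  | wr _ i e => max i.cst e.cst
  | emit e f => max e.cst f.cst
  | skip => 0
  | seq p q => max p.cst q.cst
  | ite _ e f p q => max (max e.cst f.cst) (max p.cst q.cst)
  | whl _ e f p => max (max e.cst f.cst) p.cst

def inLay (K : ℕ) : Prog → Prop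
  | asg _ e => e.inLay K
  | wr j i e => j.idx < K ∧ i.inLay K ∧ e.inLay K
  | emit e f => e.inLay K ∧ f.inLay K
  | skip => True
  | seq p q => p.inLay K ∧ q.inLay K
  | ite _ e f p q => e.inLay K ∧ f.inLay K ∧ p.inLay K ∧ q.inLay K
  | whl _ e f p => e.inLay K ∧ f.inLay K ∧ p.inLay K

theorem inLay_numArr (p : Prog) : p.inLay numArr := by
  induction p with
  | asg x e => exact e.inLay_numArr
  | wr j i e => exact ⟨j.idx_lt, i.inLay_numArr, e.inLay_numArr⟩
  | emit e f => exact ⟨e.inLay_numArr, f.inLay_numArr⟩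
  | skip => trivial
  | seq p q h1 h2 => exact ⟨h1, h2⟩
  | ite t e f p q h1 h2 => exact ⟨e.inLay_numArr, f.inLay_numArr, h1, h2⟩
  | whl t e f p h => exact ⟨e.inLay_numArr, f.inLay_numArr, h⟩

end Prog

/-! ### The simulation of the imperative language on the word RAM. -/

section sim

variable {K b S κ w B m : ℕ}

/-- `Rel` with a budget of `r` extra time units. -/
structure RelT (K b S κ : ℕ) (h : St) (r : ℕ) (c : Config) : Prop where
  reg : ∀ x : Var, c.reg x.idx = h.v x
  base : c.reg baseReg = b
  mem : ∀ j : Arr, j.idx < K → ∀ i < S, c.mem (b + K * i + j.idx) = h.a j i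
  regLe : ∀ x, h.v x ≤ S
  memLe : ∀ j : Arr, j.idx < K → ∀ i < S, h.a j i ≤ S
  time : c.time ≤ κ * h.t + r
  space : c.space ≤ b + K * S
  out : c.out = h.out

theorem evalTwo_spec (hf : Fits K b S w B m) {e f : E} {h : St} {c : Config}
    (hR : Rel K b S κ h c) (hc : max e.cst f.cst ≤ B) (hlay : e.inLay K ∧ f.inLay K)
    (hdeg : max e.deg f.deg ≤ m) (hok : e.ok S h) (hok' : f.ok S h) :
    ∃ c', Exec w (Prog.evalTwo K e f) c c' ∧ c'.reg Prog.tmp = e.eval h ∧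
      c'.reg (Prog.tmp + 1) = f.eval h ∧ RelT K b S κ h (e.cost + f.cost) c' := by
  simp only [max_le_iff] at hc hdeg
  obtain ⟨c1, x1, v1, k1, m1, o1, t1, s1⟩ := E.comp_spec hf hR.reg hR.base hR.mem hR.regLe hR.memLe
    hR.space hc.1 hlay.1 hdeg.1 hok (r := Prog.tmp) (by simp)
  obtain ⟨c2, x2, v2, k2, m2, o2, t2, s2⟩ := E.comp_spec (c := c1) hf
    (fun x => by rw [k1 _ (by have := x.idx_lt; simp only [Prog.tmp]; omega), hR.reg])
    (by rw [k1 _ (by simp), hR.base]) (by rw [m1]; exact hR.mem) hR.regLe hR.memLe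
    s1 hc.2 hlay.2 hdeg.2 hok' (r := Prog.tmp + 1) (by simp)
  refine ⟨c2, .seq x1 x2, by rw [k2 _ (by simp), v1], v2, ?_, ?_, ?_, hR.regLe, hR.memLe, ?_, s2, ?_⟩
  · intro x
    have := x.idx_lt
    rw [k2 _ (by simp only [Prog.tmp]; omega), k1 _ (by simp only [Prog.tmp]; omega), hR.reg]
  · rw [k2 _ (by simp), k1 _ (by simp), hR.base]
  · rw [m2, m1]; exact hR.mem
  · have := hR.time; omega
  · rw [o2, o1, hR.out]

theorem base_ne_one : (baseReg : ℕ) ≠ Prog.tmp + 1 := by decide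
theorem base_ne_two : (baseReg : ℕ) ≠ Prog.tmp + 2 := by decide

/-- The time spent on evaluating the operands of a test is charged to the single high-level step of
that test. -/
theorem RelT.tick {h : St} {r : ℕ} {c : Config} (hR : RelT K b S κ h r c) (hr : r + 1 ≤ κ) :
    Rel K b S κ h.tick c.tick :=
  ⟨hR.reg, hR.base, hR.mem, hR.regLe, hR.memLe, by
    have := hR.time
    simp only [St.tick_t, Config.tick, mul_add]; omega, hR.space, hR.out⟩

/-- Interleaved arrays do not overlap: division by the stride recovers the index and the array. -/
theorem addr_inj {i i' j j' : ℕ} (hj : j < K) (hj' : j' < K)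
    (h : b + K * i + j = b + K * i' + j') : i = i' ∧ j = j' := by
  have h1 : K * i + j = K * i' + j' := by omega
  have h2 := congrArg (· / K) h1
  simp only [Nat.mul_add_div (by omega : 0 < K), Nat.div_eq_of_lt hj, Nat.div_eq_of_lt hj'] at h2
  have h3 : i = i' := by omega
  subst h3; omega

/-- The compiled program simulates the high-level program. -/
theorem wp_sound (hf : Fits K b S w B m) {p : Prog} (hc : p.cst ≤ B) (hlay : p.inLay K)
    (hdeg : p.deg ≤ m) (hcost : p.cost ≤ κ) {Q : St → Prop} {h : St} {c : Config}
    (hR : Rel K b S κ h c) (hwp : wp S p Q h) :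
    ∃ c' h', Exec w (p.comp K) c c' ∧ Q h' ∧ Rel K b S κ h' c' := by
  have hw : ∀ x, x ≤ B → x < 2 ^ w := fun x hx =>
    lt_of_le_of_lt (hx.trans (Nat.le_self_pow (by have := hf.hm; omega) B)) hf.lt
  induction p generalizing Q h c with
  | asg x e =>
    obtain ⟨hok, hle, hq⟩ := hwp
    obtain ⟨c1, x1, v1, k1, m1, o1, t1, s1⟩ := E.comp_spec hf hR.reg hR.base hR.mem hR.regLe
      hR.memLe hR.space hc hlay hdeg hok (r := Prog.tmp) (by simp)
    refine ⟨_, _, .seq x1 (.seq (.const ..) (.op ..)), hq, ?_, ?_, ?_, ?_, hR.memLe, ?_, s1, ?_⟩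
    · intro y
      by_cases hxy : y = x
      · subst hxy
        simp [Config.setReg, Config.tick, BinOp.eval, v1]
        exact Nat.mod_eq_of_lt (hw _ (hle.trans hf.sle))
      · have h1 : y.idx ≠ x.idx := fun h => hxy (Var.idx_inj h)
        have h2 := y.idx_lt
        have h3 : y.idx ≠ Prog.tmp + 1 := by simp only [Prog.tmp]; omega
        simp [Config.setReg, Config.tick, hxy, h1, h3, k1 y.idx (by simp only [Prog.tmp]; omega),
          hR.reg]
    · have h2 := x.idx_lt
      have h1 : (baseReg : ℕ) ≠ x.idx := by omega
      have h3 := k1 baseReg (by simp)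
      simp only [Config.setReg, Config.tick, Function.update_apply, h1, if_false]
      simp [h3, hR.base, base_ne_one]
    · simpa [Config.setReg, Config.tick, m1] using hR.mem
    · intro y
      by_cases hxy : y = x
      · subst hxy; simpa using hle
      · simpa [hxy] using hR.regLe y
    · have := hR.time
      simp only [Prog.cost] at hcost
      simp only [Config.setReg, Config.tick, t1, St.setV_t, St.tick_t, mul_add]; omega
    · simp [Config.setReg, Config.tick, o1, hR.out]
  | wr j i e =>
    obtain ⟨hoki, hok, hi, hle, hq⟩ := hwp
    obtain ⟨c1, x1, v1, v2, hR1⟩ := evalTwo_spec hf hR hc hlay.2 hdeg hoki hok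
    have hj := hlay.1
    have hadr : b + K * i.eval h + j.idx < b + K * S := by
      have : K * (i.eval h + 1) ≤ K * S := Nat.mul_le_mul_left _ hi
      rw [mul_add] at this; omega
    have hK : K % 2 ^ w = K := Nat.mod_eq_of_lt (hw _ hf.kle)
    have hJ : j.idx % 2 ^ w = j.idx := Nat.mod_eq_of_lt (hw _ (by have := hf.kle; omega))
    have a1 : (i.eval h * K) % 2 ^ w = i.eval h * K :=
      Nat.mod_eq_of_lt (hw _ (by have := hf.addr; rw [mul_comm]; omega))
    have a2 : (i.eval h * K + j.idx) % 2 ^ w = i.eval h * K + j.idx :=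
      Nat.mod_eq_of_lt (hw _ (by have := hf.addr; rw [mul_comm]; omega))
    have a3 : (i.eval h * K + j.idx + b) % 2 ^ w = b + K * i.eval h + j.idx := by
      rw [Nat.mod_eq_of_lt (hw _ (by have := hf.addr; rw [mul_comm]; omega)), mul_comm]; omega
    have hb := hR1.base
    refine ⟨_, _, .seq x1 (.seq (.const ..) (.seq (.op ..) (.seq (.const ..) (.seq (.op ..)
      (.seq (.op ..) (.store ..)))))), hq, ?_, ?_, ?_, hR.regLe, ?_, ?_, ?_, ?_⟩
    · intro y
      have h2 := y.idx_lt
      have h3 : y.idx ≠ Prog.tmp := by simp only [Prog.tmp]; omega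
      have h4 : y.idx ≠ Prog.tmp + 2 := by simp only [Prog.tmp]; omega
      simp [Config.setReg, Config.tick, Config.touch, Config.setMem, Function.update_apply, h3, h4,
        hR1.reg]
    · simp only [Config.setReg, Config.tick, Config.touch, Config.setMem, Function.update_apply]
      simp [hb, base_ne_two]
    · have hreg : ∀ c : Config, (c.reg Prog.tmp = b + K * i.eval h + j.idx) →
          c.reg (Prog.tmp + 1) = e.eval h → c.mem = c1.mem → ∀ l : Arr, l.idx < K → ∀ i' < S,
          ((c.tick.touch (c.reg Prog.tmp)).setMem (c.reg Prog.tmp) (c.reg (Prog.tmp + 1))).mem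
            (b + K * i' + l.idx) = (h.tick.setA j (i.eval h) (e.eval h)).a l i' := by
        intro c h1 h2 h3 l hl i' hi'
        simp only [Config.setMem, Config.touch, Config.tick, h1, h2, h3]
        by_cases hlj : l = j
        · subst hlj
          by_cases hii : i' = i.eval h
          · subst hii; simp
          · have : b + K * i' + l.idx ≠ b + K * i.eval h + l.idx :=
              fun h => hii (addr_inj hl hl h).1
            rw [Function.update_of_ne this, hR1.mem l hl i' hi']
            simp [hii]
        · have : b + K * i' + l.idx ≠ b + K * i.eval h + j.idx :=
            fun h => hlj (Arr.idx_inj (addr_inj hl hj h).2)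
          rw [Function.update_of_ne this, hR1.mem l hl i' hi']
          simp [hlj]
      refine hreg _ ?_ ?_ ?_
      · simp only [Config.setReg, Config.tick, Function.update_apply, BinOp.eval]
        simp [hK, hJ, v1, hb, base_ne_two, a1, a2, a3, -Nat.add_mod_mod, -Nat.mod_add_mod]
      · simp only [Config.setReg, Config.tick, Function.update_apply, BinOp.eval]
        simp [v2]
      · rfl
    · intro l hl i' hi'
      by_cases hlj : l = j
      · subst hlj
        by_cases hii : i' = i.eval h
        · subst hii; simpa using hle
        · simpa [hii] using hR.memLe l hl i' hi'
      · simpa [hlj] using hR.memLe l hl i' hi'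
    · have := hR1.time
      simp only [Prog.cost] at hcost
      simp only [Config.setReg, Config.tick, Config.touch, Config.setMem, St.setA_t, St.tick_t,
        mul_add]; omega
    · simp only [Config.setReg, Config.tick, Config.touch, Config.setMem, Function.update_apply,
        BinOp.eval]
      simp [hK, hJ, v1, hb, base_ne_two, a1, a2, a3, -Nat.add_mod_mod, -Nat.mod_add_mod]
      exact ⟨hR1.space, by omega⟩
    · simp [Config.setReg, Config.tick, Config.touch, Config.setMem, hR1.out]
  | emit e f =>
    obtain ⟨hok, hok', hq⟩ := hwp
    obtain ⟨c1, x1, v1, v2, hR1⟩ := evalTwo_spec hf hR hc hlay hdeg hok hok'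
    refine ⟨_, _, .seq x1 (.emit ..), hq, hR1.reg, hR1.base, hR1.mem, hR.regLe, hR.memLe, ?_,
      hR1.space, ?_⟩
    · have := hR1.time
      simp only [Prog.cost] at hcost
      simp only [Config.report, Config.tick, St.put_t, St.tick_t, mul_add]; omega
    · simp [Config.report, Config.tick, hR1.out, v1, v2]
  | skip =>
    refine ⟨_, _, .skip _, hwp, hR.reg, hR.base, hR.mem, hR.regLe, hR.memLe, ?_, hR.space, hR.out⟩
    have := hR.time
    simp only [Prog.cost] at hcost
    simp only [Config.tick, St.tick_t, mul_add]; omega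
  | seq p q ihp ihq =>
    simp only [Prog.cst, Prog.deg, Prog.cost, max_le_iff] at hc hdeg hcost
    obtain ⟨c1, h1, x1, q1, R1⟩ := ihp hc.1 hlay.1 hdeg.1 hcost.1 hR hwp
    obtain ⟨c2, h2, x2, q2, R2⟩ := ihq hc.2 hlay.2 hdeg.2 hcost.2 R1 q1
    exact ⟨c2, h2, .seq x1 x2, q2, R2⟩
  | ite t e f p q ihp ihq =>
    simp only [Prog.cst, Prog.deg, Prog.cost] at hc hdeg hcost
    rw [max_le_iff] at hc hdeg hcost
    have hcost2 := max_le_iff.1 hcost.2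
    have hc2 := max_le_iff.1 hc.2
    have hd2 := max_le_iff.1 hdeg.2
    obtain ⟨hok, hok', hp, hq⟩ := hwp
    obtain ⟨c1, x1, v1, v2, hR1⟩ := evalTwo_spec hf hR hc.1 ⟨hlay.1, hlay.2.1⟩ hdeg.1 hok hok'
    have hR2 := hR1.tick hcost.1
    by_cases ht : t.Holds (e.eval h) (f.eval h)
    · obtain ⟨c2, h2, x2, q2, R2⟩ := ihp hc2.1 hlay.2.2.1 hd2.1 hcost2.1 hR2 (hp ht)
      exact ⟨c2, h2, .seq x1 (.cond_true (by rwa [v1, v2]) x2), q2, R2⟩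
    · obtain ⟨c2, h2, x2, q2, R2⟩ := ihq hc2.2 hlay.2.2.2 hd2.2 hcost2.2 hR2 (hq ht)
      exact ⟨c2, h2, .seq x1 (.cond_false (by rwa [v1, v2]) x2), q2, R2⟩
  | whl t e f p ih =>
    simp only [Prog.cst, Prog.deg, Prog.cost] at hc hdeg hcost
    rw [max_le_iff] at hc hdeg hcost
    obtain ⟨I, μ, h0, hI⟩ := hwp
    obtain ⟨c1, x1, v1, v2, hR1⟩ :=
      evalTwo_spec hf hR hc.1 ⟨hlay.1, hlay.2.1⟩ hdeg.1 (hI h h0).1 (hI h h0).2.1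
    -- The induction is on a bound for the measure, and it starts at the test itself, with both
    -- operands already in their registers.
    suffices H : ∀ n, ∀ h : St, μ h ≤ n → I h → ∀ c1 : Config, c1.reg Prog.tmp = e.eval h →
        c1.reg (Prog.tmp + 1) = f.eval h → RelT K b S κ h (e.cost + f.cost) c1 →
        ∃ c' h', Exec w (.loop t Prog.tmp (Prog.tmp + 1) (.seq (p.comp K) (Prog.evalTwo K e f))) c1
          c' ∧ Q h' ∧ Rel K b S κ h' c' by
      obtain ⟨c', h', x', q', R'⟩ := H _ h le_rfl h0 c1 v1 v2 hR1
      exact ⟨c', h', .seq x1 x', q', R'⟩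
    intro n
    induction n with
    | zero =>
      intro h hμ hh c1 v1 v2 hR1
      obtain ⟨-, -, hb, hx⟩ := hI h hh
      by_cases ht : t.Holds (e.eval h) (f.eval h)
      · obtain ⟨c2, h2, x2, q2, R2⟩ := ih hc.2 hlay.2.2 hdeg.2 hcost.2 (hR1.tick hcost.1) (hb ht)
        exact absurd q2.2 (by omega)
      · exact ⟨_, _, .loop_false (by rwa [v1, v2]), hx ht, hR1.tick hcost.1⟩
    | succ n ihn =>
      intro h hμ hh c1 v1 v2 hR1
      obtain ⟨-, -, hb, hx⟩ := hI h hh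
      by_cases ht : t.Holds (e.eval h) (f.eval h)
      · obtain ⟨c2, h2, x2, q2, R2⟩ := ih hc.2 hlay.2.2 hdeg.2 hcost.2 (hR1.tick hcost.1) (hb ht)
        obtain ⟨c3, x3, v3, v4, hR3⟩ :=
          evalTwo_spec hf R2 hc.1 ⟨hlay.1, hlay.2.1⟩ hdeg.1 (hI h2 q2.1).1 (hI h2 q2.1).2.1
        obtain ⟨c', h', x', q', R'⟩ := ihn h2 (by omega) q2.1 c3 v3 v4 hR3
        exact ⟨c', h', .loop_true (by rwa [v1, v2]) (.seq x2 x3) x', q', R'⟩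
      · exact ⟨_, _, .loop_false (by rwa [v1, v2]), hx ht, hR1.tick hcost.1⟩

end sim

/-! ## Tries, longest suffixes and the failure tree -/

section trie

open Classical

variable {A : Type} {N : ℕ} {str : ℕ → List A}

/-- The nodes `0, …, N - 1` of a trie, numbered by increasing depth; `str x` is the string of the
node `x`. -/
structure IsTrie (N : ℕ) (str : ℕ → List A) : Prop where
  pos : 0 < N
  zero : str 0 = []
  inj : ∀ x < N, ∀ y < N, str x = str y → x = y
  mono : ∀ x y, x ≤ y → y < N → (str x).length ≤ (str y).length
  closed : ∀ x < N, x ≠ 0 → ∃ y < N, ∃ a, str x = str y ++ [a]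

/-- The longest suffix of a string that is the string of a node. -/
noncomputable def longestSuffix (N : ℕ) (str : ℕ → List A) : List A → List A
  | [] => []
  | a :: s => if ∃ x < N, str x = a :: s then a :: s else longestSuffix N str s

/-- The node of a string. -/
noncomputable def node (N : ℕ) (str : ℕ → List A) (s : List A) : ℕ :=
  if h : ∃ x < N, str x = s then h.choose else 0

/-- The state that the automaton reaches by reading a string. -/
noncomputable def state (N : ℕ) (str : ℕ → List A) (s : List A) : ℕ :=
  node N str (longestSuffix N str s)

/-- The failure link. -/
noncomputable def failLink (N : ℕ) (str : ℕ → List A) (x : ℕ) : ℕ := state N str (str x).tail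

namespace IsTrie

variable (T : IsTrie N str)
include T

theorem node_lt (s : List A) : node N str s < N := by
  unfold node; split_ifs with h
  · exact h.choose_spec.1
  · exact T.pos

omit T in
theorem str_node {s : List A} (h : ∃ x < N, str x = s) : str (node N str s) = s := by
  unfold node; rw [dif_pos h]; exact h.choose_spec.2

theorem node_str {x : ℕ} (h : x < N) : node N str (str x) = x :=
  T.inj _ (T.node_lt _) _ h (str_node ⟨x, h, rfl⟩)

omit T in
theorem longestSuffix_suffix (s : List A) : longestSuffix N str s <:+ s := by
  induction s with
  | nil => simp [longestSuffix]
  | cons a s ih =>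
    unfold longestSuffix; split_ifs
    · exact List.suffix_refl _
    · exact ih.trans (List.suffix_cons a s)

theorem longestSuffix_node (s : List A) : ∃ x < N, str x = longestSuffix N str s := by
  induction s with
  | nil => exact ⟨0, T.pos, by simp [longestSuffix, T.zero]⟩
  | cons a s ih => unfold longestSuffix; split_ifs with h; exacts [h, ih]

omit T in
theorem suffix_longestSuffix {s t : List A} (h : t <:+ s) (ht : ∃ x < N, str x = t) :
    t <:+ longestSuffix N str s := by
  induction s with
  | nil => simpa [longestSuffix] using h
  | cons a s ih =>
    rcases List.suffix_cons_iff.1 h with h1 | h1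
    · subst h1; simp [longestSuffix, ht]
    · unfold longestSuffix; split_ifs
      · exact h
      · exact ih h1

omit T in
theorem suffix_antisymm {s t : List A} (h : s <:+ t) (h' : t <:+ s) : s = t :=
  h.eq_of_length (le_antisymm h.length_le h'.length_le)

omit T in
theorem append_singleton_suffix_iff {s t : List A} {a b : A} :
    s ++ [a] <:+ t ++ [b] ↔ a = b ∧ s <:+ t := by
  rw [← List.reverse_prefix, ← List.reverse_prefix (l₁ := s)]
  simp [List.cons_prefix_cons]

/-- A nonempty node that is a suffix of `s ++ [c]` has its parent among the nodes that are suffixes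
of `s`, hence among the suffixes of the longest such node. So the automaton may forget everything
else about `s`. -/
theorem longestSuffix_append (s : List A) (c : A) :
    longestSuffix N str (s ++ [c]) = longestSuffix N str (longestSuffix N str s ++ [c]) := by
  apply suffix_antisymm
  · obtain ⟨x, hx, hxs⟩ := T.longestSuffix_node (s ++ [c])
    have hs : longestSuffix N str (s ++ [c]) <:+ s ++ [c] := longestSuffix_suffix _
    refine suffix_longestSuffix ?_ ⟨x, hx, hxs⟩
    rw [← hxs] at hs ⊢
    by_cases h0 : x = 0
    · rw [h0, T.zero]; exact List.nil_suffix
    · obtain ⟨y, hy, a, e⟩ := T.closed x hx h0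
      rw [e] at hs ⊢
      rw [append_singleton_suffix_iff] at hs ⊢
      exact ⟨hs.1, suffix_longestSuffix hs.2 ⟨y, hy, rfl⟩⟩
  · refine suffix_longestSuffix ((longestSuffix_suffix _).trans ?_) (T.longestSuffix_node _)
    rw [append_singleton_suffix_iff]
    exact ⟨rfl, longestSuffix_suffix _⟩

omit T in
theorem longestSuffix_str {x : ℕ} (hx : x < N) : longestSuffix N str (str x) = str x :=
  suffix_antisymm (longestSuffix_suffix _) (suffix_longestSuffix (List.suffix_refl _) ⟨x, hx, rfl⟩)

theorem str_state (s : List A) : str (state N str s) = longestSuffix N str s :=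
  str_node (T.longestSuffix_node s)

theorem state_lt (s : List A) : state N str s < N := T.node_lt _

theorem state_append (s : List A) (c : A) :
    state N str (s ++ [c]) = state N str (str (state N str s) ++ [c]) := by
  rw [T.str_state]; unfold state; rw [← T.longestSuffix_append]

theorem state_str {x : ℕ} (hx : x < N) : state N str (str x) = x := by
  unfold state; rw [longestSuffix_str hx, T.node_str hx]

theorem state_nil : state N str [] = 0 := by
  have := T.state_str T.pos
  rwa [T.zero] at this

/-- Every node that is a suffix of `s` is a suffix of the longest one, so the state decides which
subpatterns end here. -/
theorem suffix_iff_state {u : ℕ} (hu : u < N) (s : List A) :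
    str u <:+ s ↔ str u <:+ str (state N str s) := by
  rw [T.str_state]
  exact ⟨fun h => suffix_longestSuffix h ⟨u, hu, rfl⟩, fun h => h.trans (longestSuffix_suffix _)⟩

theorem failLink_lt' (x : ℕ) : failLink N str x < N := T.state_lt _

theorem failLink_zero : failLink N str 0 = 0 := by
  unfold failLink; rw [T.zero]; exact T.state_nil

theorem str_ne_nil {x : ℕ} (hx : x < N) (h0 : x ≠ 0) : str x ≠ [] := fun h =>
  h0 (T.inj _ hx _ T.pos (by rw [h, T.zero]))

theorem length_failLink_lt {x : ℕ} (hx : x < N) (h0 : x ≠ 0) :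
    (str (failLink N str x)).length < (str x).length := by
  have h1 := T.str_ne_nil hx h0
  have h2 : (longestSuffix N str (str x).tail).length ≤ (str x).tail.length :=
    (longestSuffix_suffix _).length_le
  rw [failLink, T.str_state]
  rw [List.length_tail] at h2
  have := List.length_pos_iff.2 h1
  omega

/-- Nodes are numbered by depth and a failure link shortens the string. This lets the order of the
numbers drive all recursions and loops over the failure tree. -/
theorem failLink_lt {x : ℕ} (hx : x < N) (h0 : x ≠ 0) : failLink N str x < x := by
  by_contra h
  have := T.mono x _ (not_lt.1 h) (T.failLink_lt' x)
  have := T.length_failLink_lt hx h0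
  omega

/-- A suffix of `str x` is `str x` itself or a suffix of its tail, and the latter are decided by the
state of the tail, which is the failure link. -/
theorem suffix_iff_failLink {u x : ℕ} (hu : u < N) (hx : x < N) (h0 : x ≠ 0) :
    str u <:+ str x ↔ u = x ∨ str u <:+ str (failLink N str x) := by
  have h1 := T.str_ne_nil hx h0
  unfold failLink
  rw [← T.suffix_iff_state hu]
  obtain ⟨a, s, e⟩ := List.exists_cons_of_ne_nil h1
  rw [e, List.suffix_cons_iff, List.tail_cons, ← e]
  exact or_congr ⟨fun h => T.inj _ hu _ hx h, fun h => by rw [h]⟩ Iff.rfl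

theorem suffix_failLink (x : ℕ) (hx : x < N) : str (failLink N str x) <:+ str x := by
  by_cases h0 : x = 0
  · subst h0; rw [T.failLink_zero]
  · exact (T.suffix_iff_failLink (T.failLink_lt' x) hx h0).2 (Or.inr (List.suffix_refl _))

theorem state_child {x : ℕ} (c : A) :
    state N str ((str x).tail ++ [c]) = state N str (str (failLink N str x) ++ [c]) :=
  T.state_append _ c

/-- The transition at a node that has no child for `c`. -/
theorem state_missing {x : ℕ} (hx : x < N) (h0 : x ≠ 0) (c : A)
    (h : ¬ ∃ y < N, str y = str x ++ [c]) :
    state N str (str x ++ [c]) = state N str (str (failLink N str x) ++ [c]) := by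
  rw [← T.state_child]
  obtain ⟨a, s, e⟩ := List.exists_cons_of_ne_nil (T.str_ne_nil hx h0)
  unfold state
  rw [e] at h ⊢
  simp only [List.tail_cons, List.cons_append] at h ⊢
  rw [longestSuffix, if_neg h]

theorem state_missing_zero (c : A) (h : ¬ ∃ y < N, str y = str 0 ++ [c]) :
    state N str (str 0 ++ [c]) = 0 := by
  rw [T.zero] at h ⊢
  simp only [List.nil_append] at h ⊢
  unfold state
  rw [longestSuffix, if_neg h]
  exact T.state_nil

/-- The failure link of a child. -/
theorem failLink_child {x y : ℕ} (hx : x < N) (h0 : x ≠ 0) (c : A) (h : str y = str x ++ [c]) :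
    failLink N str y = state N str (str (failLink N str x) ++ [c]) := by
  rw [← T.state_child, failLink, h, List.tail_append_of_ne_nil (T.str_ne_nil hx h0)]

theorem failLink_child_zero {y : ℕ} (c : A) (h : str y = str 0 ++ [c]) :
    failLink N str y = 0 := by
  rw [failLink, h, T.zero]; exact T.state_nil

end IsTrie

/-! ### The time line of the failure tree -/

variable (N str) (d : ℕ) (U : ℕ → ℕ)

/-- The number of patterns at a node. -/
noncomputable def wt (x : ℕ) : ℕ := ((Finset.range d).filter fun i => U i = x).card

/-- The number of patterns in a subtree. -/
noncomputable def sz (x : ℕ) : ℕ := ((Finset.range d).filter fun i => str x <:+ str (U i)).card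

/-- The time at which a subtree is entered. -/
noncomputable def start (x : ℕ) : ℕ :=
  if _h : failLink N str x < x then
    start (failLink N str x) + wt d U (failLink N str x) +
      2 * ∑ y ∈ (Finset.range x).filter (fun y => y ≠ 0 ∧ failLink N str y = failLink N str x),
        sz str d U y
  else 0
termination_by x

/-- The rank of a pattern among those at the same node. -/
noncomputable def rk (i : ℕ) : ℕ := ((Finset.range i).filter fun j => U j = U i).card

/-- The time at which a pattern is pushed. -/
noncomputable def tIn (i : ℕ) : ℕ := start N str d U (U i) + rk U i

/-- The time at which a pattern is popped. -/
noncomputable def tOut (i : ℕ) : ℕ :=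
  start N str d U (U i) + 2 * sz str d U (U i) - 1 - rk U i

variable {N str d U}

theorem sz_le (x : ℕ) : sz str d U x ≤ d := by
  unfold sz; exact (Finset.card_filter_le _ _).trans (by simp)

namespace IsTrie

variable (T : IsTrie N str) (hU : ∀ i < d, U i < N)
include T

omit T in
theorem start_zero : start N str d U 0 = 0 := by
  unfold start; rw [dif_neg (by omega)]

theorem start_eq {x : ℕ} (hx : x < N) (h0 : x ≠ 0) : start N str d U x =
    start N str d U (failLink N str x) + wt d U (failLink N str x) +
      2 * ∑ y ∈ (Finset.range x).filter (fun y => y ≠ 0 ∧ failLink N str y = failLink N str x),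
        sz str d U y := by
  rw [start, dif_pos (T.failLink_lt hx h0)]

/-- Climb from `u` to the last node below `x`. The bound `y ≤ u` is kept for `span_disjoint`, where
`y` is compared with a sibling. -/
theorem exists_child {x u : ℕ} (hx : x < N) (hu : u < N) (h : str x <:+ str u) (hne : u ≠ x) :
    ∃ y < N, y ≠ 0 ∧ failLink N str y = x ∧ y ≤ u ∧ str y <:+ str u := by
  induction u using Nat.strong_induction_on with
  | _ u ih =>
    have h0 : u ≠ 0 := by
      rintro rfl
      rw [T.zero, List.suffix_nil] at h
      exact hne (T.inj _ T.pos _ hx (by rw [h, T.zero]))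
    rcases (T.suffix_iff_failLink hx hu h0).1 h with h1 | h1
    · exact absurd h1.symm hne
    · by_cases h2 : failLink N str u = x
      · exact ⟨u, hu, h0, h2, le_rfl, List.suffix_refl _⟩
      · obtain ⟨y, a, b, c, e, f⟩ := ih _ (T.failLink_lt hu h0) (T.failLink_lt' u) h1 h2
        exact ⟨y, a, b, c, e.trans (T.failLink_lt hu h0).le, f.trans (T.suffix_failLink u hu)⟩

/-- Of two suffixes of `s` one is a suffix of the other. If it were a proper one, it would be a
suffix of the common failure link, which is shorter than both. -/
theorem child_unique {y z : ℕ} {s : List A} (hy : y < N) (hz : z < N) (y0 : y ≠ 0)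
    (z0 : z ≠ 0) (h : failLink N str y = failLink N str z) (hys : str y <:+ s) (hzs : str z <:+ s) :
    y = z := by
  have h1 := T.length_failLink_lt hy y0
  have h2 := T.length_failLink_lt hz z0
  rcases List.suffix_or_suffix_of_suffix hys hzs with h3 | h3
  · rcases (T.suffix_iff_failLink hy hz z0).1 h3 with h4 | h4
    · exact h4
    · have := h4.length_le; rw [← h] at this; omega
  · rcases (T.suffix_iff_failLink hz hy y0).1 h3 with h4 | h4
    · exact h4.symm
    · have := h4.length_le; rw [h] at this; omega

include hU

/-- A pattern in the subtree of `x` sits at `x` or below exactly one child of `x`. -/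
theorem sz_eq {x : ℕ} (hx : x < N) : sz str d U x = wt d U x +
    ∑ y ∈ (Finset.range N).filter (fun y => y ≠ 0 ∧ failLink N str y = x), sz str d U y := by
  have h1 : (Finset.range d).filter (fun i => str x <:+ str (U i)) =
      (Finset.range d).filter (fun i => U i = x) ∪
      ((Finset.range N).filter (fun y => y ≠ 0 ∧ failLink N str y = x)).biUnion
        fun y => (Finset.range d).filter (fun i => str y <:+ str (U i)) := by
    ext i
    simp only [Finset.mem_filter, Finset.mem_range, Finset.mem_union, Finset.mem_biUnion]
    constructor
    · rintro ⟨hi, h⟩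
      by_cases hix : U i = x
      · exact Or.inl ⟨hi, hix⟩
      · obtain ⟨y, a, b, c, -, f⟩ := T.exists_child hx (hU i hi) h hix
        exact Or.inr ⟨y, ⟨a, b, c⟩, hi, f⟩
    · rintro (⟨hi, h⟩ | ⟨y, ⟨a, b, c⟩, hi, f⟩)
      · exact ⟨hi, by rw [h]⟩
      · refine ⟨hi, List.IsSuffix.trans ?_ f⟩
        rw [← c]; exact T.suffix_failLink y a
  rw [sz, h1, Finset.card_union_of_disjoint, Finset.card_biUnion]
  · rfl
  · intro y hy z hz hyz
    simp only [Finset.coe_filter, Set.mem_ofPred_eq, Finset.mem_range] at hy hz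
    rw [Function.onFun, Finset.disjoint_left]
    intro i hi hi'
    simp only [Finset.mem_filter, Finset.mem_range] at hi hi'
    exact hyz (T.child_unique hy.1 hz.1 hy.2.1 hz.2.1 (by rw [hy.2.2, hz.2.2]) hi.2 hi'.2)
  · rw [Finset.disjoint_left]
    intro i hi hi'
    simp only [Finset.mem_filter, Finset.mem_range, Finset.mem_biUnion] at hi hi'
    obtain ⟨y, ⟨a, b, c⟩, -, f⟩ := hi'
    have := T.length_failLink_lt a b
    have := f.length_le
    rw [hi.2, ← c] at this
    omega

theorem wt_le_sz {x : ℕ} (hx : x < N) : wt d U x ≤ sz str d U x := by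
  rw [T.sz_eq hU hx]; omega

/-- The span of a child lies in the inner part of the span of its parent. -/
theorem span_child {y : ℕ} (hy : y < N) (h0 : y ≠ 0) :
    start N str d U (failLink N str y) + wt d U (failLink N str y) ≤ start N str d U y ∧
    start N str d U y + 2 * sz str d U y + wt d U (failLink N str y) ≤
      start N str d U (failLink N str y) + 2 * sz str d U (failLink N str y) := by
  have h1 := T.start_eq (d := d) (U := U) hy h0
  have h2 := T.sz_eq hU (T.failLink_lt' y)
  set f := failLink N str y
  have h3 : ∑ z ∈ (Finset.range y).filter (fun z => z ≠ 0 ∧ failLink N str z = f), sz str d U z +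
      sz str d U y ≤
      ∑ z ∈ (Finset.range N).filter (fun z => z ≠ 0 ∧ failLink N str z = f), sz str d U z := by
    rw [add_comm, ← Finset.sum_insert (by simp)]
    apply Finset.sum_le_sum_of_subset
    intro z hz
    simp only [Finset.mem_insert, Finset.mem_filter, Finset.mem_range] at hz ⊢
    rcases hz with rfl | hz
    · exact ⟨hy, h0, rfl⟩
    · exact ⟨by omega, hz.2⟩
  omega

omit hU in
-- The sum that defines the start of `z` runs over the siblings with smaller numbers, among them
-- `y`, and each reserves twice its size: one push and one pop per pattern.
theorem span_sibling {y z : ℕ} (hz : z < N) (hyz : y < z) (y0 : y ≠ 0)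
    (h : failLink N str y = failLink N str z) :
    start N str d U y + 2 * sz str d U y ≤ start N str d U z := by
  have h1 := T.start_eq (d := d) (U := U) (hyz.trans hz) y0
  have h2 := T.start_eq (d := d) (U := U) hz (by omega : z ≠ 0)
  rw [h] at h1
  set f := failLink N str z
  have h3 : ∑ x ∈ (Finset.range y).filter (fun x => x ≠ 0 ∧ failLink N str x = f), sz str d U x +
      sz str d U y ≤
      ∑ x ∈ (Finset.range z).filter (fun x => x ≠ 0 ∧ failLink N str x = f), sz str d U x := by
    rw [add_comm, ← Finset.sum_insert (by simp)]
    apply Finset.sum_le_sum_of_subset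
    intro x hx
    simp only [Finset.mem_insert, Finset.mem_filter, Finset.mem_range] at hx ⊢
    rcases hx with rfl | hx
    · exact ⟨hyz, y0, h⟩
    · exact ⟨by omega, hx.2⟩
  omega

/-- The span of a proper descendant lies in the inner part of the span of its ancestor. -/
theorem span_desc {u x : ℕ} (hu : u < N) (hx : x < N) (h : str u <:+ str x) (hne : u ≠ x) :
    start N str d U u + wt d U u ≤ start N str d U x ∧
    start N str d U x + 2 * sz str d U x + wt d U u ≤ start N str d U u + 2 * sz str d U u := by
  induction x using Nat.strong_induction_on with
  | _ x ih =>
    have h0 : x ≠ 0 := by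
      rintro rfl
      rw [T.zero, List.suffix_nil] at h
      exact hne (T.inj _ hu _ T.pos (by rw [h, T.zero]))
    have h1 := T.span_child hU hx h0
    have h2 := (T.suffix_iff_failLink hu hx h0).1 h
    by_cases h3 : u = failLink N str x
    · rwa [← h3] at h1
    · have := ih _ (T.failLink_lt hx h0) (T.failLink_lt' x) (h2.resolve_left hne) h3
      omega

/-- The spans of two nodes are nested or disjoint. -/
theorem span_disjoint {u x : ℕ} (hu : u < N) (hx : x < N) (h : ¬ str u <:+ str x)
    (h' : ¬ str x <:+ str u) :
    start N str d U u + 2 * sz str d U u ≤ start N str d U x ∨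
    start N str d U x + 2 * sz str d U x ≤ start N str d U u := by
  -- The sum is symmetric, so the larger of the two nodes may be called `x`.
  induction hn : u + x using Nat.strong_induction_on generalizing u x with
  | _ n ih =>
    wlog hux : u < x generalizing u x
    · have hne : u ≠ x := fun h1 => h (by rw [h1])
      exact (this hx hu h' h (by omega) (by omega)).symm
    have x0 : x ≠ 0 := by omega
    have hs := T.span_child hU hx x0
    have hu' : ¬ str u <:+ str (failLink N str x) := fun h1 =>
      h (h1.trans (T.suffix_failLink x hx))
    -- If the parent of `x` is an ancestor of `u`, then `u` lies below a sibling `y` of `x` with `y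
    -- ≤ u < x`, whose span ends before that of `x` starts. Otherwise `u` is incomparable with the
    -- parent of `x`, whose span contains that of `x`.
    by_cases h1 : str (failLink N str x) <:+ str u
    · have hne : u ≠ failLink N str x := fun h2 => hu' (by rw [← h2])
      obtain ⟨y, hy, y0, yf, yu, ys⟩ := T.exists_child (T.failLink_lt' x) hu h1 hne
      have h3 := T.span_sibling (d := d) (U := U) hx (by omega : y < x) y0 yf
      by_cases hyu : y = u
      · subst hyu; exact Or.inl h3
      · have := T.span_desc hU hy hu ys hyu
        left; omega
    · have := T.failLink_lt hx x0
      have := ih _ (by omega) hu (T.failLink_lt' x) hu' h1 rfl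
      omega

theorem start_le {x : ℕ} (hx : x < N) : start N str d U x + 2 * sz str d U x ≤ 2 * d := by
  have h0 : sz str d U 0 ≤ d := sz_le 0
  have h1 : start N str d U 0 = 0 := start_zero
  by_cases hx0 : x = 0
  · subst hx0; omega
  · have := T.span_desc hU (u := 0) T.pos hx (by rw [T.zero]; exact List.nil_suffix) (Ne.symm hx0)
    omega

omit T hU in
theorem rk_lt {i : ℕ} (hi : i < d) : rk U i < wt d U (U i) := by
  unfold rk wt
  apply Finset.card_lt_card
  rw [Finset.ssubset_iff]
  refine ⟨i, by simp, ?_⟩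
  intro j hj
  simp only [Finset.mem_insert, Finset.mem_filter, Finset.mem_range] at hj ⊢
  rcases hj with rfl | hj
  · exact ⟨hi, rfl⟩
  · exact ⟨by omega, hj.2⟩

omit T hU in
theorem rk_lt_rk {i j : ℕ} (hij : i < j) (h : U i = U j) : rk U i < rk U j := by
  unfold rk
  apply Finset.card_lt_card
  rw [Finset.ssubset_iff]
  refine ⟨i, by simp, ?_⟩
  intro l hl
  simp only [Finset.mem_insert, Finset.mem_filter, Finset.mem_range] at hl ⊢
  rcases hl with rfl | hl
  · exact ⟨hij, h⟩
  · exact ⟨by omega, hl.2.trans h⟩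

theorem tIn_lt_tOut {i : ℕ} (hi : i < d) : tIn N str d U i < tOut N str d U i := by
  have h1 := rk_lt (U := U) hi
  have h2 := T.wt_le_sz hU (hU i hi)
  unfold tIn tOut; omega

theorem tOut_lt {i : ℕ} (hi : i < d) : tOut N str d U i < 2 * d := by
  have h1 := rk_lt (U := U) hi
  have h2 := T.wt_le_sz hU (hU i hi)
  have h3 := T.start_le hU (hU i hi)
  unfold tOut; omega

/-- The intervals of two patterns are nested or disjoint. -/
theorem laminar {i j : ℕ} (hi : i < d) (hj : j < d) (hij : i ≠ j) :
    (tIn N str d U i < tIn N str d U j ∧ tOut N str d U j < tOut N str d U i) ∨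
    (tIn N str d U j < tIn N str d U i ∧ tOut N str d U i < tOut N str d U j) ∨
    tOut N str d U i < tIn N str d U j ∨ tOut N str d U j < tIn N str d U i := by
  have a1 := rk_lt (U := U) hi
  have a2 := T.wt_le_sz hU (hU i hi)
  have b1 := rk_lt (U := U) hj
  have b2 := T.wt_le_sz hU (hU j hj)
  unfold tIn tOut
  -- At a common node patterns are pushed by increasing rank and popped by decreasing rank, so their
  -- intervals are nested.
  by_cases hu : U i = U j
  · rw [hu] at a1 a2 ⊢
    rcases Nat.lt_or_gt_of_ne hij with h | h
    · have := rk_lt_rk h hu; omega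
    · have := rk_lt_rk h hu.symm; omega
  · by_cases h1 : str (U i) <:+ str (U j)
    · have := T.span_desc hU (hU i hi) (hU j hj) h1 hu
      omega
    · by_cases h2 : str (U j) <:+ str (U i)
      · have := T.span_desc hU (hU j hj) (hU i hi) h2 (Ne.symm hu)
        omega
      · have := T.span_disjoint hU (hU i hi) (hU j hj) h1 h2
        omega

/-- A pattern is active at the time of a node iff its first subpattern is a suffix of that node. -/
theorem active_iff {i x : ℕ} (hi : i < d) (hx : x < N) :
    (tIn N str d U i < start N str d U x + wt d U x ∧
      start N str d U x + wt d U x ≤ tOut N str d U i) ↔ str (U i) <:+ str x := by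
  have a1 := rk_lt (U := U) hi
  have a2 := T.wt_le_sz hU (hU i hi)
  have b2 := T.wt_le_sz hU hx
  unfold tIn tOut
  by_cases hu : U i = x
  · subst hu; simp only [List.suffix_refl, iff_true]; omega
  · by_cases h1 : str (U i) <:+ str x
    · have := T.span_desc hU (hU i hi) hx h1 hu
      simp only [h1, iff_true]; omega
    · simp only [h1, iff_false]
      -- A pattern strictly below `x` is pushed no earlier than `start + wt` of `x`, which is too
      -- late to be active at that time.
      by_cases h2 : str x <:+ str (U i)
      · have := T.span_desc hU hx (hU i hi) h2 (Ne.symm hu)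
        omega
      · have := T.span_disjoint hU (hU i hi) hx h1 h2
        omega

end IsTrie

end trie

/-! ## Persistent stacks -/

/-- `oi` lists the pushes (odd) and pops (even) of the patterns in the order of time. -/
structure Timeline (d : ℕ) (a b oi : ℕ → ℕ) : Prop where
  lt : ∀ i < d, a i < b i
  out_lt : ∀ i < d, b i < 2 * d
  laminar : ∀ i < d, ∀ j < d, i ≠ j → (a i < a j ∧ b j < b i) ∨ (a j < a i ∧ b i < b j) ∨
    b i < a j ∨ b j < a i
  push : ∀ i < d, oi (a i) = 2 * i + 1
  pop : ∀ i < d, oi (b i) = 2 * i + 2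
  of_push : ∀ k < 2 * d, ∀ i, oi k = 2 * i + 1 → i < d ∧ a i = k
  of_pop : ∀ k < 2 * d, ∀ i, oi k = 2 * i + 2 → i < d ∧ b i = k

section stack

open Classical

variable {d : ℕ} {a b oi : ℕ → ℕ} {sel : ℕ → Prop}

/-- The operation at time `k` concerns a selected pattern. -/
def isOp (oi : ℕ → ℕ) (sel : ℕ → Prop) (k : ℕ) : Prop := 0 < oi k ∧ sel ((oi k - 1) / 2)

/-- The stack before time `k`. -/
noncomputable def stk (oi : ℕ → ℕ) (sel : ℕ → Prop) : ℕ → List ℕ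
  | 0 => []
  | k + 1 => if isOp oi sel k then
      (if oi k % 2 = 1 then (oi k - 1) / 2 :: stk oi sel k else (stk oi sel k).tail)
    else stk oi sel k

/-- The number of operations before time `k`. -/
noncomputable def cnt (oi : ℕ → ℕ) (sel : ℕ → Prop) (k : ℕ) : ℕ :=
  ((Finset.range k).filter (isOp oi sel)).card

/-- The pointer to a list. -/
def ptr : List ℕ → ℕ
  | [] => 0
  | i :: _ => i + 1

theorem cnt_succ (k : ℕ) : cnt oi sel (k + 1) = cnt oi sel k + if isOp oi sel k then 1 else 0 := by
  unfold cnt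
  rw [Finset.range_add_one, Finset.filter_insert]
  split_ifs
  · rw [Finset.card_insert_of_notMem (by simp)]
  · rfl

theorem cnt_mono {k l : ℕ} (h : k ≤ l) : cnt oi sel k ≤ cnt oi sel l :=
  Finset.card_le_card (Finset.filter_subset_filter _ (Finset.range_mono h))

theorem cnt_le (k : ℕ) : cnt oi sel k ≤ k :=
  (Finset.card_filter_le _ _).trans (by simp)

/-- `cnt` grows in steps of one, so each value below `cnt k` is the number of an operation before
time `k`. This is how cells of the event arrays are traced back to times. -/
theorem exists_op {k e : ℕ} (h : e < cnt oi sel k) :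
    ∃ l < k, isOp oi sel l ∧ cnt oi sel l = e := by
  induction k with
  | zero => simp [cnt] at h
  | succ k ih =>
    rw [cnt_succ] at h
    by_cases h1 : e < cnt oi sel k
    · obtain ⟨l, h2, h3⟩ := ih h1
      exact ⟨l, by omega, h3⟩
    · by_cases h2 : isOp oi sel k
      · exact ⟨k, by omega, h2, by simp only [h2, if_true] at h; omega⟩
      · simp only [h2, if_false] at h; omega

/-- Nothing changes between operations, so it suffices to record a version at each operation. -/
theorem stk_eq_of_cnt_eq {k l : ℕ} (hkl : k ≤ l) (h : cnt oi sel k = cnt oi sel l) :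
    stk oi sel k = stk oi sel l := by
  induction l, hkl using Nat.le_induction with
  | base => rfl
  | succ l hkl ih =>
    have h1 := cnt_mono (oi := oi) (sel := sel) hkl
    rw [cnt_succ] at h
    have h2 : ¬ isOp oi sel l := fun h2 => by simp only [h2, if_true] at h; omega
    simp only [h2, if_false] at h
    rw [ih h, stk, if_neg h2]

namespace Timeline

variable (L : Timeline d a b oi)
include L

/-- The three claims need each other. Laminarity makes the history last in, first out, so the
pattern to be popped is always on top. The third claim is the basis of persistence: in every version
the part below `i` is the stack from before the push of `i`, so one link per pattern serves all
versions. -/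
theorem stk_spec (k : ℕ) (hk : k ≤ 2 * d) :
    (∀ i, i ∈ stk oi sel k ↔ i < d ∧ sel i ∧ a i < k ∧ k ≤ b i) ∧
    (stk oi sel k).Pairwise (fun i j => a j < a i) ∧
    (∀ i l, (i :: l) <:+ stk oi sel k → l = stk oi sel (a i)) := by
  induction k with
  | zero => simp [stk]
  | succ k ih =>
    obtain ⟨hm, hp, hl⟩ := ih (by omega)
    -- Pushes are odd entries of `oi` and pops are even ones, so they never share a time.
    have hab : ∀ i < d, ∀ j < d, a i ≠ b j := fun i hi j hj h => by
      have h1 := L.push i hi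
      have h2 := L.pop j hj
      rw [h] at h1; omega
    rw [stk]
    split_ifs with h1 h2
    · obtain ⟨hi, ha⟩ := L.of_push k (by omega) ((oi k - 1) / 2) (by omega)
      set i := (oi k - 1) / 2 with hidef
      refine ⟨fun j => ?_, ?_, ?_⟩
      · rw [List.mem_cons, hm]
        constructor
        · rintro (rfl | ⟨hj, hs, h3, h4⟩)
          · exact ⟨hi, h1.2, by omega, by have := L.lt _ hi; omega⟩
          · have := hab _ hi _ hj
            exact ⟨hj, hs, by omega, by omega⟩
        · rintro ⟨hj, hs, h3, h4⟩
          by_cases hji : j = i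
          · exact Or.inl hji
          · right
            refine ⟨hj, hs, ?_, by omega⟩
            have := L.laminar j hj i hi hji
            have := L.lt i hi
            omega
      · refine List.pairwise_cons.2 ⟨fun j hj => ?_, hp⟩
        have := (hm j).1 hj
        omega
      · intro j l h
        rcases List.suffix_cons_iff.1 h with h | h
        · obtain ⟨rfl, rfl⟩ := List.cons.inj h
          rw [ha]
        · exact hl j l h
    · obtain ⟨hi, hb⟩ := L.of_pop k (by omega) ((oi k - 1) / 2) (by have := h1.1; omega)
      set i := (oi k - 1) / 2 with hidef
      have hai := L.lt i hi
      have hmem : i ∈ stk oi sel k := (hm i).2 ⟨hi, h1.2, by omega, by omega⟩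
      obtain ⟨j, l, hjl⟩ := List.exists_cons_of_ne_nil (List.ne_nil_of_mem hmem)
      rw [hjl] at hm hp hl hmem ⊢
      -- Another pattern on top would have been pushed after `i` and still be alive when `i` is
      -- popped, against laminarity.
      have hji : j = i := by
        by_contra hne
        have h3 : i ∈ l := (List.mem_cons.1 hmem).resolve_left (Ne.symm hne)
        have h4 := (List.pairwise_cons.1 hp).1 i h3
        obtain ⟨hj, -, h5, h6⟩ := (hm j).1 List.mem_cons_self
        have := L.laminar i hi j hj (Ne.symm hne)
        omega
      subst hji
      obtain ⟨hp1, hp2⟩ := List.pairwise_cons.1 hp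
      refine ⟨fun r => ?_, hp2, fun r l' h => hl r l' (h.trans (List.suffix_cons _ _))⟩
      rw [List.tail_cons]
      constructor
      · intro hr
        obtain ⟨c1, c2, c3, c4⟩ := (hm r).1 (List.mem_cons_of_mem _ hr)
        have h4 := hp1 r hr
        have hri : r ≠ i := fun h => by rw [h] at h4; omega
        have := L.laminar r c1 i hi hri
        exact ⟨c1, c2, by omega, by omega⟩
      · rintro ⟨c1, c2, c3, c4⟩
        have h5 := hab r c1 i hi
        have h6 := (hm r).2 ⟨c1, c2, by omega, by omega⟩
        refine (List.mem_cons.1 h6).resolve_left fun h => ?_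
        rw [h] at c4; omega
    · refine ⟨fun j => ?_, hp, hl⟩
      rw [hm]
      constructor
      · rintro ⟨hj, hs, h3, h4⟩
        refine ⟨hj, hs, by omega, ?_⟩
        by_contra h5
        have h6 := L.pop j hj
        rw [show b j = k by omega] at h6
        exact h1 ⟨by omega, by rw [h6]; convert hs using 1; omega⟩
      · rintro ⟨hj, hs, h3, h4⟩
        refine ⟨hj, hs, ?_, by omega⟩
        by_contra h5
        have h6 := L.push j hj
        rw [show a j = k by omega] at h6
        exact h1 ⟨by omega, by rw [h6]; convert hs using 1; omega⟩

theorem nodup_stk {k : ℕ} (hk : k ≤ 2 * d) : (stk oi sel k).Nodup := by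
  refine ((L.stk_spec k hk).2.1).imp fun {i j} h => ?_
  rintro rfl; omega

end Timeline

end stack

/-! ## The algorithm -/

namespace Algo

open Prog Var Arr

def inc (j : Arr) (e : E) (f : E) : Prog := wr j e (E.rd j e + f)

/-- Determine the length of the dictionary and copy it to the first array. -/
def copyInput : Prog :=
  asg d (E.rd inp 0);;
  asg pos 1;;
  .for i d (asg pos (pos + 4 + E.rd inp (pos + 2) + E.rd inp (pos + 3)));;
  .for i pos (wr inp (E.num numArr * i + pos) (E.rd inp i))

def parseFields : Prog :=
  wr LO i (E.rd inp pos);;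
  wr HI i (E.rd inp (pos + 1));;
  wr LN (2 * i) (E.rd inp (pos + 2));;
  wr LN (2 * i + 1) (E.rd inp (pos + 3));;
  wr PS (2 * i) (pos + 4);;
  wr PS (2 * i + 1) (pos + 4 + E.rd inp (pos + 2))

def parseOne : Prog :=
  parseFields;;
  ite .lt (E.rd inp pos) al (asg al (E.rd inp pos)) skip;;
  ite .lt be (E.rd inp (pos + 1)) (asg be (E.rd inp (pos + 1))) skip;;
  ite .lt mm (E.rd inp (pos + 3)) (asg mm (E.rd inp (pos + 3))) skip;;
  asg pos (pos + 4 + E.rd inp (pos + 2) + E.rd inp (pos + 3))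

/-- Read the patterns; compute `α*`, `β*`, `M`. -/
def parse : Prog :=
  asg pos 1;;
  asg al (E.rd inp 1);;
  asg be 0;;
  asg mm 0;;
  .for i d parseOne;;
  asg rr (be + mm + 1);;
  asg ds (be + 1 - al)

/-- Extend the path of the subpattern `x` by its character number `h`. -/
def extend (σ : ℕ) : Prog :=
  asg c (E.rd CU x * E.num σ + E.rd inp (E.rd PS x + h));;
  ite .eq (E.rd G c) 0 (wr G c nn;;asg nn (nn + 1)) skip;;
  wr CU x (E.rd G c);;
  wr LV nw x;;
  asg nw (nw + 1)

def level (σ : ℕ) : Prog :=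
  asg nw 0;;
  .for k nl (asg x (E.rd LV k);;ite .lt h (E.rd LN x) (extend σ) skip);;
  asg nl nw;;
  asg h (h + 1)

/-- Build the trie level by level. -/
def trie (σ : ℕ) : Prog :=
  asg nl (d + d);;
  .for k nl (wr LV k k);;
  asg nn 1;;
  asg h 0;;
  whl .lt 0 nl (level σ)

/-- Mark the nodes of the second subpatterns and count the first subpatterns at each node. -/
def mark : Prog :=
  .for i d (
    wr ID (E.rd CU (2 * i + 1)) (i + 1);;
    wr RK i (E.rd WT (E.rd CU (2 * i)));;
    inc WT (E.rd CU (2 * i)) 1);;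
  .for i d (wr VI i (E.rd ID (E.rd CU (2 * i + 1)) - 1))

/-- A cell `0` of `G` means that the child is missing, since the root is nobody's child. The table
of children is overwritten by the transitions in place. -/
def transition (σ : ℕ) : Prog :=
  ite .eq x 0 (asg z 0) (asg z (E.rd G (E.rd F x * E.num σ + c)));;
  asg y (E.rd G (x * E.num σ + c));;
  ite .eq y 0 (wr G (x * E.num σ + c) z) (wr F y z)

/-- Complete the automaton: failure links, transitions, links to second subpatterns. -/
def automaton (σ : ℕ) : Prog :=
  .for x nn (
    .for c (E.num σ) (transition σ);;
    ite .eq (E.rd ID x) 0 (wr DL x (E.rd DL (E.rd F x))) (wr DL x x))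

/-- The numbers of patterns in the subtrees of the failure tree. -/
def sizes : Prog :=
  .for i (nn - 1) (
    asg x (nn - 1 - i);;
    inc SZ x (E.rd WT x);;
    inc SZ (E.rd F x) (E.rd SZ x))

/-- The times at which the nodes are entered. -/
def starts : Prog :=
  .for i (nn - 1) (
    asg x (i + 1);;
    wr ST x (E.rd NX (E.rd F x));;
    inc NX (E.rd F x) (2 * E.rd SZ x);;
    wr NX x (E.rd ST x + E.rd WT x))

/-- The sequence of pushes and pops. -/
def ops : Prog :=
  .for i d (
    asg x (E.rd CU (2 * i));;
    wr OI (E.rd ST x + E.rd RK i) (2 * i + 1);;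
    wr OI (E.rd ST x + 2 * E.rd SZ x - 1 - E.rd RK i) (2 * i + 2))

/-- The offsets of the second subpatterns in the arrays of events. -/
def offsets : Prog :=
  .for k (2 * d) (ite .lt 0 (E.rd OI k) (inc CN (E.rd VI ((E.rd OI k - 1) / 2)) 1) skip);;
  .for i d (wr BB (i + 1) (E.rd BB i + E.rd CN i))

/-- Heads and links hold the index of a pattern plus one, `0` being the empty stack. Events are
stored in rows of length `2 * d`, one per gap length; in its row the stack of `vid` owns the section
that starts at `BB vid`, of which `FI c` cells are filled. -/
def event : Prog :=
  asg vid (E.rd VI i);;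
  asg c (g * d + vid);;
  ite .eq (E.rd OI k % 2) 1 (wr LK (g * d + i) (E.rd HD c);;wr HD c (i + 1))
    (wr HD c (E.rd LK (g * d + (E.rd HD c - 1))));;
  asg b (g * (2 * d) + E.rd BB vid + E.rd FI c);;
  wr ET b k;;
  wr EH b (E.rd HD c);;
  inc FI c 1

/-- For each gap length, run the stacks and record their versions. -/
def planes : Prog :=
  .for g ds (.for k (2 * d) (
    ite .lt 0 (E.rd OI k) (
      asg i ((E.rd OI k - 1) / 2);;
      ite .lt (g + al) (E.rd LO i) skip (ite .lt (E.rd HI i) (g + al) skip event)) skip))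

def build (σ : ℕ) : Prog :=
  parse;;trie σ;;mark;;automaton σ;;sizes;;starts;;ops;;offsets;;planes

/-- Binary search for the number of events of the stack that happen before the time `tau`. -/
def search : Prog :=
  whl .lt lo hi (
    asg mid ((lo + hi) / 2);;
    ite .lt (E.rd ET (b + mid)) tau (asg lo (mid + 1)) (asg hi mid))

def reportList : Prog :=
  whl .lt 0 hd (emit (hd - 1) (g + al);;asg hd (E.rd LK (g * d + (hd - 1))))

/-- Report the occurrences with second subpattern number `vid` and gap length number `g`. -/
def reportGap : Prog :=
  asg y (E.rd RG ((cur + rr - (E.rd LN (2 * vid + 1) + (g + al))) % rr));;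
  asg tau (E.rd ST y + E.rd WT y);;
  asg b (g * (2 * d) + E.rd BB vid);;
  asg lo 0;;
  asg hi (E.rd FI (g * d + vid));;
  search;;
  ite .lt 0 lo (asg hd (E.rd EH (b + lo - 1));;reportList) skip

/-- `x` runs through the marked nodes on the path of failure links, from the longest second
subpattern to the shortest. The root is never marked, so `0` ends the chain. -/
def query (σ : ℕ) : Prog :=
  asg q (E.rd G (q * E.num σ + ch));;
  asg cur ((cur + 1) % rr);;
  wr RG cur q;;
  asg x (E.rd DL q);;
  whl .lt 0 x (
    asg vid (E.rd ID x - 1);;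
    .for g ds reportGap;;
    asg x (E.rd DL (E.rd F x)))

end Algo

/-! ## The encoding of the dictionary -/

section dict

variable {σ : ℕ} (D : Dictionary σ)

def loF (i : ℕ) : ℕ := (D[i]?.map (·.lo)).getD 0
def hiF (i : ℕ) : ℕ := (D[i]?.map (·.hi)).getD 0
def fstF (i : ℕ) : List (Fin σ) := (D[i]?.map (·.fst)).getD []
def sndF (i : ℕ) : List (Fin σ) := (D[i]?.map (·.snd)).getD []

/-- The subpatterns, first and second ones alternating. -/
def subF (k : ℕ) : List (Fin σ) := if k % 2 = 0 then fstF D (k / 2) else sndF D (k / 2)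

def block (P : GappedPattern σ) : List ℕ :=
  [P.lo, P.hi, P.fst.length, P.snd.length] ++ P.fst.map Fin.val ++ P.snd.map Fin.val

/-- The position of pattern `i` in the encoding. -/
def posF (i : ℕ) : ℕ := 1 + ((D.take i).flatMap block).length

def inF (a : ℕ) : ℕ := (encode D).getD a 0

variable {D}

theorem subF_even (i : ℕ) : subF D (2 * i) = fstF D i := by simp [subF]
theorem subF_odd (i : ℕ) : subF D (2 * i + 1) = sndF D i := by
  have h1 : (2 * i + 1) % 2 = 1 := by omega
  have h2 : (2 * i + 1) / 2 = i := by omega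
  simp [subF, h1, h2]

theorem posF_zero : posF D 0 = 1 := by simp [posF]

theorem posF_succ {i : ℕ} (hi : i < D.length) :
    posF D (i + 1) = posF D i + 4 + (fstF D i).length + (sndF D i).length := by
  simp only [posF, List.take_add_one, List.getElem?_eq_getElem hi, Option.toList_some,
    List.flatMap_append, List.length_append, fstF, sndF, Option.map_some, Option.getD_some]
  simp [block]; omega

theorem encode_length : (encode D).length = posF D D.length := by
  simp [encode, posF, block]; omega

theorem posF_mono {i j : ℕ} (h : i ≤ j) : posF D i ≤ posF D j := by
  unfold posF
  have : (D.take i).Sublist (D.take j) := (List.take_sublist_take_left h)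
  have := (this.flatMap block).length_le
  omega

theorem posF_succ_le {i : ℕ} (hi : i < D.length) :
    posF D i + 4 + (fstF D i).length + (sndF D i).length ≤ (encode D).length := by
  rw [← posF_succ hi, encode_length]; exact posF_mono hi

theorem encode_split {i : ℕ} (hi : i < D.length) : encode D =
    (D.length :: (D.take i).flatMap block) ++ (block D[i] ++ (D.drop (i + 1)).flatMap block) := by
  have h : D = D.take i ++ D[i] :: D.drop (i + 1) := by
    rw [← List.drop_eq_getElem_cons hi, List.take_append_drop]
  have h2 : D.flatMap block = (D.take i).flatMap block ++ (block D[i] ++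
      (D.drop (i + 1)).flatMap block) := by
    rw [← List.flatMap_cons, ← List.flatMap_append, ← h]
  rw [List.cons_append, ← h2]; rfl

theorem inF_block {i : ℕ} (hi : i < D.length) (r : ℕ) (hr : r < (block D[i]).length) :
    inF D (posF D i + r) = (block D[i]).getD r 0 := by
  unfold inF
  rw [encode_split hi, List.getD_append_right _ _ _ _ (by simp [posF]; omega)]
  rw [List.getD_append _ _ _ _ (by simp [posF]; simpa [posF, Nat.add_sub_cancel_left, add_comm,
    add_assoc, add_left_comm] using hr)]
  congr 1
  simp [posF]; omega

theorem block_length (P : GappedPattern σ) :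
    (block P).length = 4 + P.fst.length + P.snd.length := by simp [block]; omega

theorem inF_lo {i : ℕ} (hi : i < D.length) : inF D (posF D i) = loF D i := by
  have := inF_block hi 0 (by simp [block])
  simpa [block, loF, hi] using this

theorem inF_hi {i : ℕ} (hi : i < D.length) : inF D (posF D i + 1) = hiF D i := by
  have := inF_block hi 1 (by simp [block])
  simpa [block, hiF, hi] using this

theorem inF_fst {i : ℕ} (hi : i < D.length) : inF D (posF D i + 2) = (fstF D i).length := by
  have := inF_block hi 2 (by simp [block])
  simpa [block, fstF, hi] using this

theorem inF_snd {i : ℕ} (hi : i < D.length) : inF D (posF D i + 3) = (sndF D i).length := by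
  have := inF_block hi 3 (by simp [block])
  simpa [block, sndF, hi] using this

theorem inF_fst_get {i r : ℕ} (hi : i < D.length) (hr : r < (fstF D i).length) :
    inF D (posF D i + 4 + r) = ((fstF D i)[r] : ℕ) := by
  have e : fstF D i = D[i].fst := by simp [fstF, hi]
  have hr' : r < D[i].fst.length := by rwa [← e]
  have := inF_block hi (4 + r) (by rw [block_length]; omega)
  rw [add_assoc, this]
  simp only [e]
  rw [List.getD_eq_getElem?_getD]
  simp [block, show 4 + r = r + 4 by omega, List.getElem?_append, hr']

theorem inF_snd_get {i r : ℕ} (hi : i < D.length) (hr : r < (sndF D i).length) :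
    inF D (posF D i + 4 + (fstF D i).length + r) = ((sndF D i)[r] : ℕ) := by
  have e : fstF D i = D[i].fst := by simp [fstF, hi]
  have e' : sndF D i = D[i].snd := by simp [sndF, hi]
  have hr' : r < D[i].snd.length := by rwa [← e']
  have := inF_block hi (4 + (fstF D i).length + r) (by rw [block_length, e]; omega)
  rw [show posF D i + 4 + (fstF D i).length + r = posF D i + (4 + (fstF D i).length + r) by omega,
    this]
  simp only [e, e']
  rw [List.getD_eq_getElem?_getD]
  simp [block, show 4 + D[i].fst.length + r = D[i].fst.length + r + 4 by omega, hr']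

theorem inF_zero : inF D 0 = D.length := by simp [inF, encode]

theorem fstF_ne {i : ℕ} (hi : i < D.length) : fstF D i ≠ [] := by
  simpa [fstF, hi] using D[i].fst_ne

theorem sndF_ne {i : ℕ} (hi : i < D.length) : sndF D i ≠ [] := by
  simpa [sndF, hi] using D[i].snd_ne

theorem loF_le_hiF (i : ℕ) : loF D i ≤ hiF D i := by
  unfold loF hiF
  cases h : D[i]? with
  | none => simp
  | some P => simpa using P.lo_le_hi

theorem encode_length_eq : (encode D).length = 1 + 4 * D.length + size D := by
  simp only [encode, size, List.length_cons, List.length_flatMap]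
  have : ∀ D : Dictionary σ, (D.map fun P => ([P.lo, P.hi, P.fst.length, P.snd.length] ++
      P.fst.map Fin.val ++ P.snd.map Fin.val).length).sum =
      4 * D.length + (D.map fun P => P.fst.length + P.snd.length).sum := by
    intro D
    induction D with
    | nil => rfl
    | cons P D ih =>
      rw [List.map_cons, List.sum_cons, ih]
      simp; omega
  rw [this]; omega

theorem posF_eq_sum {i : ℕ} (hi : i ≤ D.length) : posF D i = 1 + 4 * i +
    ∑ j ∈ Finset.range i, ((fstF D j).length + (sndF D j).length) := by
  induction i with
  | zero => simp [posF]
  | succ i ih =>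
    rw [posF_succ (by omega), ih (by omega), Finset.sum_range_succ]; omega

theorem size_eq_sum : size D = ∑ i ∈ Finset.range D.length,
    ((fstF D i).length + (sndF D i).length) := by
  have h1 := posF_eq_sum (D := D) le_rfl
  rw [← encode_length, encode_length_eq] at h1
  omega

theorem two_mul_length_le : 2 * D.length ≤ size D := by
  unfold size
  induction D with
  | nil => simp
  | cons P D ih =>
    have h1 := List.length_pos_iff.2 P.fst_ne
    have h2 := List.length_pos_iff.2 P.snd_ne
    simp only [List.map_cons, List.sum_cons, List.length_cons]; omega

theorem exists_mem_iff {p : GappedPattern σ → ℕ} {a : ℕ} :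
    (∃ P ∈ D, p P = a) ↔ ∃ i < D.length, (D[i]?.map p).getD 0 = a := by
  constructor
  · rintro ⟨P, hP, rfl⟩
    obtain ⟨i, hi, rfl⟩ := List.getElem_of_mem hP
    exact ⟨i, hi, by simp [hi]⟩
  · rintro ⟨i, hi, rfl⟩
    exact ⟨D[i], List.getElem_mem hi, by simp [hi]⟩

theorem alphaStar_eq {a : ℕ} (h : ∀ i < D.length, a ≤ loF D i)
    (h' : ∃ i < D.length, a = loF D i) : alphaStar D = a := by
  unfold alphaStar
  simp only [exists_mem_iff]
  obtain ⟨i, hi, e⟩ := h'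
  refine IsLeast.csInf_eq ⟨⟨i, hi, e.symm⟩, ?_⟩
  rintro b ⟨j, hj, rfl⟩
  exact h j hj

theorem betaStar_eq {a : ℕ} (h : ∀ i < D.length, hiF D i ≤ a)
    (h' : ∃ i < D.length, a = hiF D i) : betaStar D = a := by
  unfold betaStar
  simp only [exists_mem_iff]
  obtain ⟨i, hi, e⟩ := h'
  refine IsGreatest.csSup_eq ⟨⟨i, hi, e.symm⟩, ?_⟩
  rintro b ⟨j, hj, rfl⟩
  exact h j hj

theorem maxSnd_eq {a : ℕ} (h : ∀ i < D.length, (sndF D i).length ≤ a)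
    (h' : ∃ i < D.length, a = (sndF D i).length) : maxSnd D = a := by
  have e : ∀ i < D.length, (D[i]?.map fun P => P.snd.length).getD 0 = (sndF D i).length := by
    intro i hi; simp [sndF, hi]
  unfold maxSnd
  simp only [exists_mem_iff (p := fun P => P.snd.length)]
  obtain ⟨i, hi, e'⟩ := h'
  refine IsGreatest.csSup_eq ⟨⟨i, hi, by rw [e i hi, e']⟩, ?_⟩
  rintro b ⟨j, hj, rfl⟩
  rw [e j hj]; exact h j hj

theorem exists_max (f : ℕ → ℕ) {n : ℕ} (hn : 0 < n) : ∃ a, (∀ i < n, f i ≤ a) ∧ ∃ i < n, a = f i := by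
  obtain ⟨i, hi, h⟩ := Finset.exists_max_image (Finset.range n) f ⟨0, by simpa using hn⟩
  exact ⟨f i, fun j hj => h j (by simpa using hj), i, by simpa using hi, rfl⟩

theorem exists_min (f : ℕ → ℕ) {n : ℕ} (hn : 0 < n) : ∃ a, (∀ i < n, a ≤ f i) ∧ ∃ i < n, a = f i := by
  obtain ⟨i, hi, h⟩ := Finset.exists_min_image (Finset.range n) f ⟨0, by simpa using hn⟩
  exact ⟨f i, fun j hj => h j (by simpa using hj), i, by simpa using hi, rfl⟩

theorem alphaStar_le {i : ℕ} (hi : i < D.length) : alphaStar D ≤ loF D i := by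
  obtain ⟨a, h, h'⟩ := exists_min (loF D) (Nat.zero_lt_of_lt hi)
  rw [alphaStar_eq h h']; exact h i hi

theorem le_betaStar {i : ℕ} (hi : i < D.length) : hiF D i ≤ betaStar D := by
  obtain ⟨a, h, h'⟩ := exists_max (hiF D) (Nat.zero_lt_of_lt hi)
  rw [betaStar_eq h h']; exact h i hi

theorem le_maxSnd {i : ℕ} (hi : i < D.length) : (sndF D i).length ≤ maxSnd D := by
  obtain ⟨a, h, h'⟩ := exists_max (fun i => (sndF D i).length) (Nat.zero_lt_of_lt hi)
  rw [maxSnd_eq h h']; exact h i hi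

theorem alphaStar_le_betaStar (hD : D ≠ []) : alphaStar D ≤ betaStar D :=
  have h0 : 0 < D.length := List.length_pos_iff.2 hD
  (alphaStar_le h0).trans ((loF_le_hiF 0).trans (le_betaStar h0))

theorem sub_length_le {i : ℕ} (hi : i < D.length) :
    (fstF D i).length + (sndF D i).length ≤ size D := by
  rw [size_eq_sum]
  exact Finset.single_le_sum (f := fun i => (fstF D i).length + (sndF D i).length)
    (fun _ _ => Nat.zero_le _) (by simpa using hi)

theorem maxSnd_le_size (hD : D ≠ []) : maxSnd D ≤ size D := by
  obtain ⟨a, h, i, hi, e⟩ := exists_max (fun i => (sndF D i).length) (List.length_pos_iff.2 hD)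
  rw [maxSnd_eq h ⟨i, hi, e⟩, e]
  have := sub_length_le hi
  omega

end dict

/-- The bound on indices and values is large enough. -/
structure Big {σ : ℕ} (D : Dictionary σ) (S : ℕ) : Prop where
  size : 100 * (size D + 1) ≤ S
  alph : (σ + 1) * (DMOG.size D + 1) ≤ S
  gaps : 4 * (D.length * (betaStar D - alphaStar D + 1)) ≤ S
  ring : betaStar D + DMOG.size D + 2 ≤ S

/-! ### Copying and parsing the input. -/

variable {σ : ℕ} {D : Dictionary σ} {S : ℕ}

theorem inF_of_le {a : ℕ} (h : (encode D).length ≤ a) : inF D a = 0 :=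
  List.getD_eq_default _ _ h

theorem Big.inF_le (hS : Big D S) (a : ℕ) : inF D a ≤ S := by
  have h2 := two_mul_length_le (D := D)
  have h3 : σ ≤ S := by have := hS.alph; nlinarith
  have hS1 := hS.size
  have hS4 := hS.ring
  by_cases ha : a < (encode D).length
  · have : inF D a ∈ encode D := by
      unfold inF; rw [List.getD_eq_getElem _ _ ha]; exact List.getElem_mem ha
    rcases List.mem_cons.1 this with h | h
    · omega
    · obtain ⟨P, hP, h⟩ := List.mem_flatMap.1 h
      obtain ⟨i, hi, rfl⟩ := List.getElem_of_mem hP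
      have hb := le_betaStar hi
      have hl := loF_le_hiF (D := D) i
      have hs := sub_length_le hi
      simp only [hiF, loF, fstF, sndF, List.getElem?_eq_getElem hi, Option.map_some,
        Option.getD_some] at hb hl hs
      simp only [List.cons_append, List.nil_append, List.mem_cons, List.mem_append,
        List.mem_map] at h
      rcases h with h | h | h | h | ⟨c, -, h⟩ | ⟨c, -, h⟩
      · omega
      · omega
      · omega
      · omega
      · have := c.isLt; omega
      · have := c.isLt; omega
  · rw [inF_of_le (not_lt.1 ha)]; omega

theorem wp_setMin {x : Var} {e : E} {s : St} (hok : e.ok S s) (hle : e.eval s ≤ S) :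
    wp S (.ite .lt e (E.var x) (.asg x e) .skip)
      (fun s' => s'.v x = min (s.v x) (e.eval s) ∧ s'.t ≤ s.t + 2) s := by
  have h1 : ∀ e : E, e.eval s.tick = e.eval s := fun e => by
    induction e <;> simp_all [E.eval]
  have h2 : ∀ e : E, e.ok S s.tick ↔ e.ok S s := fun e => by
    induction e <;> simp_all [E.ok]
  simp [wp, Test.Holds, h1, h2, hok, hle]
  omega

theorem wp_setMax {x : Var} {e : E} {s : St} (hok : e.ok S s) (hle : e.eval s ≤ S) :
    wp S (.ite .lt (E.var x) e (.asg x e) .skip)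
      (fun s' => s'.v x = max (s.v x) (e.eval s) ∧ s'.t ≤ s.t + 2) s := by
  have h1 : ∀ e : E, e.eval s.tick = e.eval s := fun e => by
    induction e <;> simp_all [E.eval]
  have h2 : ∀ e : E, e.ok S s.tick ↔ e.ok S s := fun e => by
    induction e <;> simp_all [E.ok]
  simp [wp, Test.Holds, h1, h2, hok, hle]
  omega

/-- The targets `numArr * i + pos` lie beyond the input, so no source word is overwritten. They are
the cells of the array `inp` in the interleaved layout with base `pos`. -/
theorem wp_copyInput (hS : Big D S) {s : St} (hi : ∀ a, s.a .inp a = inF D a) :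
    wp S Algo.copyInput (fun s' => s'.v .pos = (encode D).length ∧ s'.v .d = D.length ∧
      (∀ a, s'.a .inp a = if a < (encode D).length then inF D a else
        if (a - (encode D).length) % numArr = 0 ∧
          (a - (encode D).length) / numArr < (encode D).length
        then inF D ((a - (encode D).length) / numArr) else 0) ∧
      s'.t ≤ s.t + 20 * size D + 20) s := by
  have hL := encode_length_eq (D := D)
  have h2 := two_mul_length_le (D := D)
  have hS1 := hS.size
  simp only [Algo.copyInput]
  refine ⟨by simp; omega, by simp [hi, inF_zero]; omega, ?_⟩
  refine ⟨by simp, by simp; omega, ?_⟩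
  simp only [E.eval_rd, E.eval_zero, hi, inF_zero, E.eval_one]
  refine wp_seq (R := fun s' => s'.v .pos = (encode D).length ∧ s'.t ≤ s.t + 4 + 3 * D.length)
    (wp_for D.length (fun i s' => s'.v .pos = posF D i) (fun _ => 1) (by omega)
    (by simp [posF_zero]) ?_ ?_ ?_) ?_
  · intro i s' _ hF
    have := hF.v .d rfl
    simp [this]
  · intro i s' hi' hpos hxi hF
    have ha := hF.a .inp rfl
    simp only [St.setV_a, St.tick_a] at ha
    have h3 := inF_fst hi'
    have h4 := inF_snd hi'
    have h5 := posF_succ_le hi'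
    have h6 := posF_succ hi'
    simp [wp, hpos, ha, hi, h3, h4, hxi]
    omega
  · intro s' hpos hF ht
    simp only [St.tick_v, St.tick_t, hpos, encode_length, true_and]
    simp at ht
    omega
  rintro s1 ⟨hpos, ht⟩ hF1
  have ha1 := hF1.a .inp rfl
  have hd1 := hF1.v .d rfl
  simp at ha1 hd1
  set L := (encode D).length with hLdef
  refine wp_for L (fun i s' => ∀ a, s'.a .inp a = if a < L then inF D a else
        if (a - L) % numArr = 0 ∧ (a - L) / numArr < i
        then inF D ((a - L) / numArr) else 0) (fun _ => 1) (by omega) ?_ ?_ ?_ ?_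
  · intro a
    simp only [St.setV_a, St.tick_a, ha1, hi, Nat.not_lt_zero, and_false, if_false]
    split_ifs with h
    · rfl
    · exact inF_of_le (by omega)
  · intro i s' _ hF
    have := hF.v .pos rfl
    simp [this, hpos]
  · intro i s' hi' hI hxi hF
    have h3 := hF.v .pos rfl
    have h4 := hS.inF_le i
    have hn : numArr = 26 := rfl
    simp [wp, h3, hpos, hxi, hI, hi', h4]
    simp only [hn]
    refine ⟨by omega, by omega, fun a => ?_⟩
    rw [Function.update_apply]
    by_cases h5 : a = 26 * i + L
    · subst h5
      have h6 : ¬ 26 * i + L < L := by omega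
      simp [h6]
    · simp only [h5, if_false, hI]
      by_cases h6 : a < L
      · simp [h6]
      · simp only [h6, if_false]
        congr 1
        simp only [eq_iff_iff, hn]
        omega
  · intro s' hI hF ht'
    have h3 := hF.v .pos rfl
    have h4 := hF.v .d rfl
    simp only [St.tick_v, St.tick_t, St.tick_a, h3, h4, hpos, hd1, true_and]
    refine ⟨hI, ?_⟩
    simp at ht'
    omega

/-- The result of reading the dictionary. -/
structure Parsed {σ : ℕ} (D : Dictionary σ) (s : St) : Prop where
  inp : ∀ a, s.a .inp a = inF D a
  d : s.v .d = D.length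
  lo : ∀ i < D.length, s.a .LO i = loF D i
  hi : ∀ i < D.length, s.a .HI i = hiF D i
  ln : ∀ k < 2 * D.length, s.a .LN k = (subF D k).length
  ps : ∀ k < 2 * D.length, ∀ r (hr : r < (subF D k).length),
    s.a .PS k + r < (encode D).length ∧ inF D (s.a .PS k + r) = ((subF D k)[r] : ℕ)
  al : s.v .al = alphaStar D
  rr : s.v .rr = betaStar D + maxSnd D + 1
  ds : s.v .ds = betaStar D + 1 - alphaStar D

theorem Parsed.frame {p : Prog} {s s' : St} (h : Parsed D s) (F : Frame p s s')
    (hp : (p.mv .d || p.mv .al || p.mv .rr || p.mv .ds || p.ma .inp || p.ma .LO || p.ma .HI ||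
      p.ma .LN || p.ma .PS) = false) : Parsed D s' := by
  simp only [Bool.or_eq_false_iff, and_assoc] at hp
  obtain ⟨v1, v2, v3, v4, a1, a2, a3, a4, a5⟩ := hp
  obtain ⟨h1, h2, h3, h4, h5, h6, h7, h8, h9⟩ := h
  rw [← F.a _ a1] at h1
  rw [← F.v _ v1] at h2
  rw [← F.a _ a2] at h3
  rw [← F.a _ a3] at h4
  rw [← F.a _ a4] at h5
  rw [← F.a _ a5] at h6
  rw [← F.v _ v2] at h7
  rw [← F.v _ v3] at h8
  rw [← F.v _ v4] at h9
  exact ⟨h1, h2, h3, h4, h5, h6, h7, h8, h9⟩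

theorem Parsed.tick {s : St} (h : Parsed D s) : Parsed D s.tick := by
  obtain ⟨h1, h2, h3, h4, h5, h6, h7, h8, h9⟩ := h
  exact ⟨h1, h2, h3, h4, h5, h6, h7, h8, h9⟩

theorem Parsed.setV {s : St} {x : Var} {n : ℕ} (h : Parsed D s)
    (hx : Var.d ≠ x ∧ Var.al ≠ x ∧ Var.rr ≠ x ∧ Var.ds ≠ x) : Parsed D (s.setV x n) := by
  obtain ⟨h1, h2, h3, h4, h5, h6, h7, h8, h9⟩ := h
  obtain ⟨x1, x2, x3, x4⟩ := hx
  exact ⟨h1, by simpa [x1], h3, h4, h5, h6, by simpa [x2], by simpa [x3], by simpa [x4]⟩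

theorem wp_parse (hS : Big D S) (hD : D ≠ []) {s : St} (hi : ∀ a, s.a .inp a = inF D a)
    (hd : s.v .d = D.length) :
    wp S Algo.parse (fun s' => Parsed D s' ∧ s'.t ≤ s.t + 20 * D.length + 20) s := by
  have hL := encode_length_eq (D := D)
  have h2 := two_mul_length_le (D := D)
  have hS1 := hS.size
  have hS4 := hS.ring
  have hd0 : 0 < D.length := List.length_pos_iff.2 hD
  have hM := maxSnd_le_size hD
  simp only [Algo.parse]
  refine ⟨by simp, by simp; omega, ?_⟩
  refine ⟨by simp; omega, by simp [hi]; exact hS.inF_le _, ?_⟩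
  refine ⟨by simp, by simp, ?_⟩
  refine ⟨by simp, by simp, ?_⟩
  simp only [E.eval_rd, E.eval_zero, hi, E.eval_one, St.setV_a, St.tick_a]
  have hlo0 : inF D 1 = loF D 0 := by rw [← inF_lo hd0, posF_zero]
  refine wp_seq (R := fun s' => (∀ i < D.length, s'.a .LO i = loF D i) ∧
      (∀ i < D.length, s'.a .HI i = hiF D i) ∧
      (∀ i < D.length, s'.a .LN (2 * i) = (fstF D i).length ∧
        s'.a .LN (2 * i + 1) = (sndF D i).length ∧ s'.a .PS (2 * i) = posF D i + 4 ∧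
        s'.a .PS (2 * i + 1) = posF D i + 4 + (fstF D i).length) ∧
      s'.v .al = alphaStar D ∧ s'.v .be = betaStar D ∧ s'.v .mm = maxSnd D ∧
      s'.t ≤ s.t + 17 * D.length + 10)
    (wp_for D.length (fun n s' => s'.v .pos = posF D n ∧ (∀ i < n, s'.a .LO i = loF D i) ∧
      (∀ i < n, s'.a .HI i = hiF D i) ∧
      (∀ i < n, s'.a .LN (2 * i) = (fstF D i).length ∧
        s'.a .LN (2 * i + 1) = (sndF D i).length ∧ s'.a .PS (2 * i) = posF D i + 4 ∧
        s'.a .PS (2 * i + 1) = posF D i + 4 + (fstF D i).length) ∧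
      ((∀ i < n, s'.v .al ≤ loF D i) ∧ ∃ i < D.length, s'.v .al = loF D i) ∧
      ((∀ i < n, hiF D i ≤ s'.v .be) ∧ (s'.v .be = 0 ∨ ∃ i < D.length, s'.v .be = hiF D i)) ∧
      ((∀ i < n, (sndF D i).length ≤ s'.v .mm) ∧
        (s'.v .mm = 0 ∨ ∃ i < D.length, s'.v .mm = (sndF D i).length))) (fun _ => 13) (by omega)
    ?_ ?_ ?_ ?_) ?_
  · simp [posF_zero, hlo0]
    exact ⟨0, hd0, rfl⟩
  · intro i s' _ hF
    have := hF.v .d rfl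
    simpa [hd] using this
  · rintro i s' hi' ⟨hpos, h3, h4, h5, ⟨h6, h6'⟩, ⟨h7, h7'⟩, ⟨h8, h8'⟩⟩ hxi hF
    have ha : s'.a .inp = inF D := by rw [hF.a .inp rfl]; funext a; simp [hi]
    have e1 := inF_lo hi'
    have e2 := inF_hi hi'
    have e3 := inF_fst hi'
    have e4 := inF_snd hi'
    have e5 := posF_succ_le hi'
    have e6 := posF_succ hi'
    have e7 := hS.inF_le (posF D i)
    have e8 := hS.inF_le (posF D i + 1)
    have e9 := sub_length_le hi'
    have e10 := hS.inF_le 1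
    rw [e1] at e7
    rw [e2] at e8
    refine wp_seq (R := fun s'' =>
        s''.a .LO = Function.update (s'.a .LO) i (loF D i) ∧
        s''.a .HI = Function.update (s'.a .HI) i (hiF D i) ∧ s''.a .LN =
        Function.update (Function.update (s'.a .LN) (2 * i) (fstF D i).length) (2 * i + 1)
          (sndF D i).length ∧
        s''.a .PS = Function.update (Function.update (s'.a .PS) (2 * i) (posF D i + 4)) (2 * i + 1)
          (posF D i + 4 + (fstF D i).length) ∧ s''.t = s'.t + 7) ?_ ?_
    · simp [Algo.parseFields, wp, hpos, ha, hxi, e1, e2, e3, e4]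
      omega
    rintro s1 ⟨a1, a2, a3, a4, t1⟩ F1
    have i1 : s1.a .inp = inF D := by rw [F1.a .inp rfl]; exact ha
    have p1 : s1.v .pos = posF D i := by rw [F1.v .pos rfl]; exact hpos
    refine wp_seq (wp_setMin (by simp [p1]; omega) (by simp [p1, i1, e1]; omega)) ?_
    rintro s2 ⟨m2, t2⟩ F2
    have i2 : s2.a .inp = inF D := by rw [F2.a .inp rfl]; exact i1
    have p2 : s2.v .pos = posF D i := by rw [F2.v .pos rfl]; exact p1
    refine wp_seq (wp_setMax (by simp [p2]; omega) (by simp [p2, i2, e2]; omega)) ?_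
    rintro s3 ⟨m3, t3⟩ F3
    have i3 : s3.a .inp = inF D := by rw [F3.a .inp rfl]; exact i2
    have p3 : s3.v .pos = posF D i := by rw [F3.v .pos rfl]; exact p2
    refine wp_seq (wp_setMax (by simp [p3]; omega) (by simp [p3, i3, e4]; omega)) ?_
    rintro s4 ⟨m4, t4⟩ F4
    have i4 : s4.a .inp = inF D := by rw [F4.a .inp rfl]; exact i3
    have p4 : s4.v .pos = posF D i := by rw [F4.v .pos rfl]; exact p3
    have x4 : s4.v .i = i := by rw [F4.v .i rfl, F3.v .i rfl, F2.v .i rfl, F1.v .i rfl]; exact hxi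
    have al4 : s4.v .al = min (s'.v .al) (loF D i) := by
      rw [F4.v .al rfl, F3.v .al rfl, m2, F1.v .al rfl]; simp [p1, i1, e1]
    have be4 : s4.v .be = max (s'.v .be) (hiF D i) := by
      rw [F4.v .be rfl, m3, F2.v .be rfl, F1.v .be rfl]; simp [p2, i2, e2]
    have mm4 : s4.v .mm = max (s'.v .mm) (sndF D i).length := by
      rw [m4, F3.v .mm rfl, F2.v .mm rfl, F1.v .mm rfl]; simp [p3, i3, e4]
    have A : ∀ j ∈ [Arr.LO, .HI, .LN, .PS], s4.a j = s1.a j := by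
      intro j hj
      simp only [List.mem_cons, List.not_mem_nil, or_false] at hj
      rcases hj with rfl | rfl | rfl | rfl <;> rw [F4.a _ rfl, F3.a _ rfl, F2.a _ rfl]
    simp [wp, i4, p4, e3, e4, x4, al4, be4, mm4, A, a1, a2, a3, a4, e6]
    refine ⟨by omega, by omega, ⟨?_, ?_, ?_, ⟨?_, ?_⟩, ⟨?_, ?_⟩, ?_, ?_⟩, by omega⟩
    · intro j hj
      by_cases hji : j = i
      · subst hji; simp
      · simp [hji, h3 j (by omega)]
    · intro j hj
      by_cases hji : j = i
      · subst hji; simp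
      · simp [hji, h4 j (by omega)]
    · intro j hj
      by_cases hji : j = i
      · subst hji; simp
      · have n1 : 2 * j ≠ 2 * i := by omega
        have n2 : 2 * j ≠ 2 * i + 1 := by omega
        have n3 : 2 * j + 1 ≠ 2 * i := by omega
        have := h5 j (by omega)
        simp [n1, n2, n3, this]
    · intro j hj
      rcases Nat.lt_or_eq_of_le hj with h | rfl
      · exact Or.inl (h6 j h)
      · exact Or.inr le_rfl
    · rcases le_total (s'.v .al) (loF D i) with h | h
      · simpa [h] using h6'
      · exact ⟨i, hi', by simp [h]⟩
    · intro j hj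
      rcases Nat.lt_or_eq_of_le hj with h | rfl
      · exact Or.inl (h7 j h)
      · exact Or.inr le_rfl
    · rcases le_total (hiF D i) (s'.v .be) with h | h
      · simp only [max_eq_left h]; rcases h7' with h' | h'
        · exact Or.inl ⟨h', by omega⟩
        · exact Or.inr h'
      · exact Or.inr ⟨i, hi', by simp [h]⟩
    · intro j hj
      rcases Nat.lt_or_eq_of_le hj with h | rfl
      · exact Or.inl (h8 j h)
      · exact Or.inr le_rfl
    · rcases le_total (sndF D i).length (s'.v .mm) with h | h
      · simp only [max_eq_left h]; rcases h8' with h' | h'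
        · left; exact ⟨h', by rw [h'] at h; exact List.length_eq_zero_iff.1 (by omega)⟩
        · exact Or.inr h'
      · exact Or.inr ⟨i, hi', by simp [h]⟩
  · rintro s' ⟨hpos, h3, h4, h5, ⟨h6, h6'⟩, ⟨h7, h7'⟩, ⟨h8, h8'⟩⟩ hF ht
    simp only [St.tick_v, St.tick_a, St.tick_t]
    refine ⟨h3, h4, h5, (alphaStar_eq h6 h6').symm, (betaStar_eq h7 ?_).symm,
      (maxSnd_eq h8 ?_).symm, ?_⟩
    -- If the initial value `0` has survived, all right gap borders are `0`, and pattern `0` attains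
    -- the maximum.
    · rcases h7' with h | h
      · exact ⟨0, hd0, by have := h7 0 hd0; omega⟩
      · exact h
    · rcases h8' with h | h
      · exact ⟨0, hd0, by have := h8 0 hd0; omega⟩
      · exact h
    · simp at ht; omega
  rintro s1 ⟨h3, h4, h5, h6, h7, h8, ht⟩ hF
  have e1 : s1.v .d = D.length := by rw [hF.v .d rfl]; simpa using hd
  have e2 : s1.a .inp = inF D := by rw [hF.a .inp rfl]; funext a; simp [hi]
  simp [wp, h6, h7, h8]
  refine ⟨by omega, by omega, ⟨by simp [e2], by simp [e1], by simpa using h3, by simpa using h4,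
    ?_, ?_, by simp [h6], by simp, by simp⟩, by omega⟩
  · intro k hk
    rcases Nat.even_or_odd' k with ⟨i, rfl | rfl⟩
    · simpa [subF_even] using (h5 i (by omega)).1
    · simpa [subF_odd] using (h5 i (by omega)).2.1
  · intro k hk r hr
    have hi : k / 2 < D.length := by omega
    have e5 := posF_succ_le hi
    rcases Nat.even_or_odd' k with ⟨i, rfl | rfl⟩
    · have hi : i < D.length := by omega
      have e5 := posF_succ_le hi
      simp only [subF_even] at hr ⊢
      simp [(h5 i hi).2.2.1, inF_fst_get hi hr]; omega
    · have hi : i < D.length := by omega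
      have e5 := posF_succ_le hi
      simp only [subF_odd] at hr ⊢
      simp [(h5 i hi).2.2.2, inF_snd_get hi hr]; omega

/-! ## Building the trie -/

/-- A trie together with its table of children; `0` stands for a missing child. -/
structure TrieTab {σ : ℕ} (N : ℕ) (str : ℕ → List (Fin σ)) (G : ℕ → ℕ) : Prop
    extends IsTrie N str where
  child : ∀ x < N, ∀ c : Fin σ, ∀ y < N, str y = str x ++ [c] → G (x * σ + c) = y
  none : ∀ x < N, ∀ c : Fin σ, (¬ ∃ y < N, str y = str x ++ [c]) → G (x * σ + c) = 0
  fresh : ∀ a, N * σ ≤ a → G a = 0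

theorem cell_inj {σ x y : ℕ} {a b : Fin σ} (h : x * σ + a = y * σ + b) : x = y ∧ a = b := by
  have ha := a.isLt
  have hb := b.isLt
  have h1 := congrArg (· / σ) h
  have h2 := congrArg (· % σ) h
  simp only [Nat.mul_comm _ σ, Nat.mul_add_div (by omega : 0 < σ), Nat.div_eq_of_lt ha,
    Nat.div_eq_of_lt hb, Nat.mul_add_mod, Nat.mod_eq_of_lt ha, Nat.mod_eq_of_lt hb] at h1 h2
  exact ⟨by omega, Fin.ext h2⟩

theorem cell_lt {σ x N : ℕ} (a : Fin σ) (h : x < N) : x * σ + a < N * σ := by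
  have h1 : (x + 1) * σ ≤ N * σ := Nat.mul_le_mul_right _ h
  have := a.isLt
  rw [add_mul] at h1; omega

theorem TrieTab.cell_eq_zero_iff {σ N : ℕ} {str : ℕ → List (Fin σ)} {G : ℕ → ℕ}
    (T : TrieTab N str G) {x : ℕ} (hx : x < N) (c : Fin σ) :
    G (x * σ + c) = 0 ↔ ¬ ∃ y < N, str y = str x ++ [c] := by
  refine ⟨?_, T.none x hx c⟩
  rintro h ⟨y, hy, e⟩
  rw [T.child x hx c y hy e] at h
  subst h
  rw [T.zero] at e
  simp at e

/-- By `hlen` the new node is a deepest one, which keeps the numbering by depth, and `fresh`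
provides its empty row of children. -/
theorem TrieTab.add {σ N : ℕ} {str : ℕ → List (Fin σ)} {G : ℕ → ℕ}
    (T : TrieTab N str G) {x : ℕ} (hx : x < N) (c : Fin σ)
    (hlen : ∀ y < N, (str y).length ≤ (str x).length + 1) (h : ¬ ∃ y < N, str y = str x ++ [c]) :
    TrieTab (N + 1) (Function.update str N (str x ++ [c])) (Function.update G (x * σ + c) N) := by
  have e : ∀ y < N, Function.update str N (str x ++ [c]) y = str y := fun y hy => by
    simp [Nat.ne_of_lt hy]
  have eN : Function.update str N (str x ++ [c]) N = str x ++ [c] := by simp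
  refine ⟨⟨by omega, ?_, ?_, ?_, ?_⟩, ?_, ?_, ?_⟩
  · rw [e 0 T.pos, T.zero]
  · intro y hy z hz hyz
    rcases Nat.lt_succ_iff_lt_or_eq.1 hy with hy | rfl <;>
      rcases Nat.lt_succ_iff_lt_or_eq.1 hz with hz | rfl
    · rw [e y hy, e z hz] at hyz; exact T.inj y hy z hz hyz
    · rw [e y hy, eN] at hyz; exact absurd ⟨y, hy, hyz⟩ h
    · rw [eN, e z hz] at hyz; exact absurd ⟨z, hz, hyz.symm⟩ h
    · rfl
  · intro y z hyz hz
    rcases Nat.lt_succ_iff_lt_or_eq.1 hz with hz | rfl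
    · rw [e y (by omega), e z hz]; exact T.mono y z hyz hz
    · rw [eN]
      rcases Nat.lt_or_eq_of_le hyz with hy | rfl
      · rw [e y hy]; simpa using hlen y hy
      · rw [eN]
  · intro y hy y0
    rcases Nat.lt_succ_iff_lt_or_eq.1 hy with hy | rfl
    · obtain ⟨z, hz, a, ea⟩ := T.closed y hy y0
      exact ⟨z, by omega, a, by rw [e y hy, e z hz, ea]⟩
    · exact ⟨x, by omega, c, by rw [eN, e x hx]⟩
  · intro y hy a z hz hyz
    rcases Nat.lt_succ_iff_lt_or_eq.1 hy with hy | rfl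
    · rw [e y hy] at hyz
      rcases Nat.lt_succ_iff_lt_or_eq.1 hz with hz | rfl
      · rw [e z hz] at hyz
        have hne : y * σ + a ≠ x * σ + c := fun hc => by
          obtain ⟨rfl, rfl⟩ := cell_inj hc
          exact h ⟨z, hz, hyz⟩
        rw [Function.update_of_ne hne]
        exact T.child y hy a z hz hyz
      · rw [eN] at hyz
        obtain ⟨h1, h2⟩ := List.append_inj' hyz rfl
        have := T.inj _ hx _ hy h1
        subst this
        rw [List.cons.injEq] at h2
        rw [h2.1]; simp
    -- The new node has no child, for its string would be longer than those of all nodes.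
    · exfalso
      rw [eN] at hyz
      have := congrArg List.length hyz
      rcases Nat.lt_succ_iff_lt_or_eq.1 hz with hz | rfl
      · rw [e z hz] at this
        have h3 := hlen z hz
        simp at this; omega
      · rw [eN] at this
        simp at this
  · intro y hy a hno
    have hne : y * σ + a ≠ x * σ + c := fun hc => by
      obtain ⟨rfl, rfl⟩ := cell_inj hc
      exact hno ⟨N, by omega, by rw [eN, e y hx]⟩
    rw [Function.update_of_ne hne]
    rcases Nat.lt_succ_iff_lt_or_eq.1 hy with hy | rfl
    · refine T.none y hy a fun ⟨z, hz, ez⟩ => hno ⟨z, by omega, by rw [e z hz, e y hy, ez]⟩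
    · exact T.fresh _ (by omega)
  · intro a ha
    have := cell_lt c hx
    rw [add_mul] at ha
    rw [Function.update_of_ne (by omega)]
    exact T.fresh _ (by omega)

section

variable {σ : ℕ} {D : Dictionary σ} {S : ℕ}

/-- The subpatterns of length at least `h`. -/
def live (D : Dictionary σ) (h : ℕ) : List ℕ :=
  (List.range (2 * D.length)).filter fun k => h ≤ (subF D k).length

theorem live_succ (h : ℕ) :
    live D (h + 1) = (live D h).filter fun k => h < (subF D k).length := by
  unfold live
  rw [List.filter_filter]
  congr 1; funext k
  simp only [Bool.and_eq_decide, decide_eq_true_eq, decide_eq_decide]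
  omega

theorem live_zero : live D 0 = List.range (2 * D.length) := by simp [live]

theorem mem_live {h k : ℕ} : k ∈ live D h ↔ k < 2 * D.length ∧ h ≤ (subF D k).length := by
  simp [live]

theorem live_nodup (h : ℕ) : (live D h).Nodup := List.nodup_range.filter _

theorem length_live_le (h : ℕ) : (live D h).length ≤ 2 * D.length :=
  (List.length_filter_le _ _).trans (by simp)

/-- The sums count pairs of a subpattern and a level from `h` on, and level `h` contributes its live
subpatterns. In this way the time of all levels is charged to the total length. -/
theorem sum_sub_live (D : Dictionary σ) (h : ℕ) :
    ∑ k ∈ Finset.range (2 * D.length), ((subF D k).length + 1 - h) = (live D h).length +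
      ∑ k ∈ Finset.range (2 * D.length), ((subF D k).length + 1 - (h + 1)) := by
  unfold live
  induction 2 * D.length with
  | zero => simp
  | succ n ih =>
    rw [Finset.sum_range_succ, Finset.sum_range_succ, List.range_succ, List.filter_append,
      List.length_append, ih]
    by_cases h1 : h ≤ (subF D n).length
    · simp [h1]; omega
    · simp [h1]; omega

/-- A level adds at most one node per live subpattern; summed up, the number of nodes stays within
the total length. -/
theorem sum_min_live (D : Dictionary σ) (h : ℕ) :
    ∑ k ∈ Finset.range (2 * D.length), min (h + 1) (subF D k).length = (live D (h + 1)).length +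
      ∑ k ∈ Finset.range (2 * D.length), min h (subF D k).length := by
  unfold live
  induction 2 * D.length with
  | zero => simp
  | succ n ih =>
    rw [Finset.sum_range_succ, Finset.sum_range_succ, List.range_succ, List.filter_append,
      List.length_append, ih]
    clear ih
    by_cases h1 : h < (subF D n).length
    · simp [h1]; omega
    · simp [h1]; omega

theorem sum_length_subF : ∑ k ∈ Finset.range (2 * D.length), (subF D k).length = size D := by
  rw [size_eq_sum]
  induction D.length with
  | zero => simp
  | succ n ih =>
    rw [Finset.sum_range_succ, ← ih, mul_add, mul_one, Finset.sum_range_succ, Finset.sum_range_succ,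
      subF_even, subF_odd, add_assoc]

theorem sum_min_le (h : ℕ) :
    ∑ k ∈ Finset.range (2 * D.length), min h (subF D k).length ≤ size D := by
  rw [← sum_length_subF]
  exact Finset.sum_le_sum fun _ _ => min_le_right _ _

/-- The state of the construction at level `h` after `j` of the live subpatterns. -/
structure LevelInv (D : Dictionary σ) (h j : ℕ) (str : ℕ → List (Fin σ)) (s : St) : Prop where
  tab : TrieTab (s.v .nn) str (s.a .G)
  cuLt : ∀ k < 2 * D.length, s.a .CU k < s.v .nn
  cu : ∀ k < 2 * D.length, str (s.a .CU k) =
    if k ∈ (live D h).take j then (subF D k).take (h + 1) else (subF D k).take h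
  len : ∀ x < s.v .nn, (str x).length ≤ h + 1
  nw : s.v .nw = (((live D h).take j).filter fun k => h < (subF D k).length).length
  left : ∀ i < s.v .nw,
    (((live D h).take j).filter fun k => h < (subF D k).length)[i]? = some (s.a .LV i)
  right : ∀ i, j ≤ i → i < (live D h).length → (live D h)[i]? = some (s.a .LV i)
  bound : s.v .nn ≤ 1 + ∑ k ∈ Finset.range (2 * D.length), min h (subF D k).length + s.v .nw

/-- The list `LV` is compacted in place: at most `j` entries have been kept so far, so the write at
`nw` never destroys an entry that is still to be read. -/
theorem wp_extend (hS : Big D S) {h j : ℕ} {str : ℕ → List (Fin σ)} {s : St} {k : ℕ}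
    (hP : Parsed D s) (hh : s.v .h = h) (hj : (live D h)[j]? = some k) (hI : LevelInv D h j str s)
    (hx : s.v .x = k) (hlt : h < (subF D k).length) :
    wp S (Algo.extend σ) (fun s' => (∃ str', LevelInv D h (j + 1) str' s') ∧ s'.t ≤ s.t + 7) s := by
  have hL := encode_length_eq (D := D)
  have h2 := two_mul_length_le (D := D)
  have hS1 := hS.size
  have hS2 := hS.alph
  have hkl : k ∈ live D h := List.mem_of_getElem? hj
  have hk : k < 2 * D.length := (mem_live.1 hkl).1
  obtain ⟨hps, hin⟩ := hP.ps k hk h hlt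
  have hjl : j < (live D h).length := (List.getElem?_eq_some_iff.1 hj).1
  have hll := length_live_le (D := D) h
  have hnot : k ∉ (live D h).take j := by
    intro hm
    obtain ⟨i, hi, hi'⟩ := List.getElem_of_mem hm
    rw [List.getElem_take] at hi'
    have hi2 : i < j := by rw [List.length_take] at hi; omega
    have e2 := (List.getElem?_eq_some_iff.1 hj).2
    have := (List.Nodup.getElem_inj_iff (live_nodup (D := D) h)).1 (hi'.trans e2.symm)
    omega
  have htake : (live D h).take (j + 1) = (live D h).take j ++ [k] := by
    rw [List.take_add_one, hj]; rfl
  have hfil : ((live D h).take (j + 1)).filter (fun k => h < (subF D k).length) =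
      ((live D h).take j).filter (fun k => h < (subF D k).length) ++ [k] := by
    rw [htake, List.filter_append]; simp [hlt]
  set fl := ((live D h).take j).filter (fun k => h < (subF D k).length) with hfl
  have hnw : fl.length ≤ j := (List.length_filter_le _ _).trans (by rw [List.length_take]; omega)
  have hbd := hI.bound
  -- The subpattern at hand has not yet been charged for this level, so there is room for one more
  -- node within `size D`.
  have hmin : ∑ k ∈ Finset.range (2 * D.length), min h (subF D k).length + (fl.length + 1) ≤
      size D := by
    have e1 := sum_min_live D h
    have e2 := sum_min_le (D := D) (h + 1)
    have e3 : fl.length + 1 ≤ (live D (h + 1)).length := by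
      rw [live_succ, ← List.take_append_drop (j + 1) (live D h), List.filter_append, hfil]
      simp
    omega
  have hnw' : s.v .nw = fl.length := hI.nw
  have hnn : s.v .nn ≤ size D := by omega
  have hcuk := hI.cu k hk
  rw [if_neg hnot] at hcuk
  have hcl := hI.cuLt k hk
  set u := s.a .CU k with hu
  set c := (subF D k)[h] with hc
  have hcell := cell_lt c hcl
  have hcS : u * σ + c < S := by
    have : s.v .nn * σ ≤ size D * σ := Nat.mul_le_mul_right _ hnn
    nlinarith
  have hstr : str u ++ [c] = (subF D k).take (h + 1) := by
    rw [hcuk, List.take_append_getElem]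
  have hlen : ∀ y < s.v .nn, (str y).length ≤ (str u).length + 1 := by
    intro y hy
    have := hI.len y hy
    rw [hcuk, List.length_take]; omega
  have hlenu : (str u ++ [c]).length = h + 1 := by
    rw [hstr, List.length_take]; omega
  -- the common end: `y` is the node of the extended string
  have fin : ∀ (s' : St) (str' : ℕ → List (Fin σ)) (y : ℕ), TrieTab (s'.v .nn) str' (s'.a .G) →
      s.v .nn ≤ s'.v .nn → s'.v .nn ≤ s.v .nn + 1 → (∀ x < s.v .nn, str' x = str x) →
      y < s'.v .nn → str' y = str u ++ [c] → (∀ x < s'.v .nn, (str' x).length ≤ h + 1) →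
      s'.a .CU = Function.update (s.a .CU) k y → s'.a .LV = Function.update (s.a .LV) (s.v .nw) k →
      s'.v .nw = s.v .nw + 1 → LevelInv D h (j + 1) str' s' := by
    intro s' str' y T' hn1 hn2 hext hy hstry hlen' hCU hLV hNW
    refine ⟨T', ?_, ?_, hlen', ?_, ?_, ?_, ?_⟩
    · intro k' hk'
      rw [hCU, Function.update_apply]
      split_ifs
      · exact hy
      · have := hI.cuLt k' hk'; omega
    · intro k' hk'
      rw [hCU, Function.update_apply, htake]
      by_cases hkk : k' = k
      · subst hkk; simp [hstry, hstr]
      · have := hI.cu k' hk'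
        simp only [hkk, if_false, List.mem_append, List.mem_singleton, or_false]
        rw [hext _ (hI.cuLt k' hk'), this]
    · rw [hNW, hfil, hnw']; simp
    · intro i hi
      rw [hfil, hLV, Function.update_apply]
      split_ifs with h3
      · rw [h3, hnw']; simp
      · rw [List.getElem?_append_left (by omega)]
        exact hI.left i (by omega)
    · intro i hi hi'
      rw [hLV, Function.update_of_ne (by omega)]
      exact hI.right i (by omega) hi'
    · omega
  have ek := hP.inp
  simp only [Algo.extend]
  refine ⟨by simp [hx, hh]; omega,
    by simp [hx, hh, ek, hin, ← hu]; omega, ?_⟩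
  simp only [E.eval_add, E.eval_mul, E.eval_rd, E.eval_var, E.eval_num, hx, hh, ek, hin, ← hu]
  refine ⟨by simpa using hcS, by simp, fun hc0 => ?_, fun hc0 => ?_⟩
  · simp [Test.Holds] at hc0
    have hno := (hI.tab.cell_eq_zero_iff hcl c).1 hc0
    simp [wp, hx]
    refine ⟨by omega, by omega, by omega, by omega, by omega, by omega, by omega, by omega, by omega,
      ⟨_, fin _ (Function.update str (s.v .nn) (str u ++ [c])) (s.v .nn) ?_ ?_ ?_ ?_ ?_ ?_ ?_ ?_ ?_
        ?_⟩⟩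
    · simpa using hI.tab.add hcl c hlen hno
    · simp
    · simp
    · intro x hx; simp [Nat.ne_of_lt hx]
    · simp
    · simp
    · intro x hx
      simp at hx
      rw [Function.update_apply]
      split_ifs
      · omega
      · exact hI.len x (by omega)
    · simp
    · simp
    · simp
  · simp [Test.Holds] at hc0
    have hyes : ∃ y < s.v .nn, str y = str u ++ [c] := by
      by_contra hno; exact hc0 (hI.tab.none u hcl c hno)
    obtain ⟨y, hy, ey⟩ := hyes
    have hg := hI.tab.child u hcl c y hy ey
    simp [wp, hx, hg]
    refine ⟨by omega, by omega, by omega, by omega, by omega, by omega,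
      ⟨str, fin _ _ y ?_ ?_ ?_ ?_ ?_ ?_ ?_ ?_ ?_ ?_⟩⟩
    · simpa using hI.tab
    · simp
    · simp
    · intro x hx; rfl
    · simpa using hy
    · exact ey
    · intro x hx
      exact hI.len x (by simpa using hx)
    · simp
    · simp
    · simp

/-- The state of the construction before level `h`. -/
structure LevelStart (D : Dictionary σ) (h : ℕ) (str : ℕ → List (Fin σ)) (s : St) : Prop where
  lev : s.v .h = h
  tab : TrieTab (s.v .nn) str (s.a .G)
  cuLt : ∀ k < 2 * D.length, s.a .CU k < s.v .nn
  cu : ∀ k < 2 * D.length, str (s.a .CU k) = (subF D k).take h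
  len : ∀ x < s.v .nn, (str x).length ≤ h
  nl : s.v .nl = (live D h).length
  lv : ∀ i < (live D h).length, (live D h)[i]? = some (s.a .LV i)
  bound : s.v .nn ≤ 1 + ∑ k ∈ Finset.range (2 * D.length), min h (subF D k).length

theorem wp_level (hS : Big D S) {h : ℕ} {str : ℕ → List (Fin σ)} {s : St}
    (hP : Parsed D s) (hI : LevelStart D h str s) (hhS : h < S) :
    wp S (Algo.level σ) (fun s' => (∃ str', LevelStart D (h + 1) str' s') ∧
      s'.t ≤ s.t + 12 * (live D h).length + 6) s := by
  have h2 := two_mul_length_le (D := D)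
  have hS1 := hS.size
  have hll := length_live_le (D := D) h
  simp only [Algo.level]
  refine ⟨by simp, by simp, ?_⟩
  refine wp_seq (R := fun s' => (∃ str', LevelInv D h (live D h).length str' s') ∧
      s'.t ≤ s.t + 3 + 12 * (live D h).length)
    (wp_for (live D h).length (fun j s' => ∃ str', LevelInv D h j str' s') (fun _ => 10) (by omega)
      ?_ ?_ ?_ ?_) ?_
  · refine ⟨str, ?_⟩
    refine ⟨by simpa using hI.tab, by simpa using hI.cuLt, by simpa using hI.cu,
      fun x hx => (hI.len x (by simpa using hx)).trans (by omega), by simp, by simp,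
      fun i _ hi => by simpa using hI.lv i hi, by simpa using hI.bound⟩
  · intro i s' _ hF
    have := hF.v .nl rfl
    simp [this, hI.nl]
  · rintro j s' hj ⟨str', hJ⟩ hxj hF
    have hP' : Parsed D s' := (hP.tick.setV (by simp)).frame hF rfl
    have hh : s'.v .h = h := by rw [hF.v .h rfl]; simpa using hI.lev
    obtain ⟨k, hk⟩ : ∃ k, (live D h)[j]? = some k := ⟨_, List.getElem?_eq_getElem hj⟩
    have hkl : k ∈ live D h := List.mem_of_getElem? hk
    have hk2 := (mem_live.1 hkl).1
    have hlvj : s'.a .LV j = k := by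
      have := hJ.right j le_rfl hj
      rw [hk] at this; simpa using this.symm
    have hln := hP'.ln k hk2
    refine ⟨by simp [hxj]; omega, by simp [hxj, hlvj]; omega, ?_⟩
    simp only [E.eval_rd, E.eval_var, St.tick_v, hxj, St.tick_a, hlvj]
    have hJ' : LevelInv D h j str' (s'.tick.tick.setV .x k).tick := by
      refine ⟨by simpa using hJ.tab, by simpa using hJ.cuLt, by simpa using hJ.cu,
        by simpa using hJ.len, by simpa using hJ.nw, by simpa using hJ.left,
        by simpa using hJ.right, by simpa using hJ.bound⟩
    have hP'' : Parsed D (s'.tick.tick.setV .x k).tick := (hP'.tick.tick.setV (by simp)).tick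
    refine ⟨by simp, by simp; omega, fun hc => ?_, fun hc => ?_⟩
    · simp [Test.Holds, hh, hln] at hc
      refine wp_mono (wp_frame (wp_extend hS hP'' (by simpa using hh) hk hJ' (by simp) hc)) ?_
      rintro s'' ⟨⟨⟨str'', hJ''⟩, ht⟩, hF''⟩
      refine ⟨by rw [hF''.v .k rfl]; simpa using hxj, ⟨str'', ?_⟩, ?_⟩
      · refine ⟨by simpa using hJ''.tab, by simpa using hJ''.cuLt, by simpa using hJ''.cu,
        by simpa using hJ''.len, by simpa using hJ''.nw, by simpa using hJ''.left,
        by simpa using hJ''.right, by simpa using hJ''.bound⟩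
      · simp at ht; omega
    · simp [Test.Holds, hh, hln] at hc
      have htake : (live D h).take (j + 1) = (live D h).take j ++ [k] := by
        rw [List.take_add_one, hk]; rfl
      have hfil : ((live D h).take (j + 1)).filter (fun k => h < (subF D k).length) =
          ((live D h).take j).filter (fun k => h < (subF D k).length) := by
        rw [htake, List.filter_append]; simp [Nat.not_lt.2 hc]
      simp only [wp]
      refine ⟨by simpa using hxj, ⟨str', ?_⟩, by simp⟩
      refine ⟨by simpa using hJ.tab, by simpa using hJ.cuLt, ?_,
        by simpa using hJ.len, by rw [hfil]; simpa using hJ.nw, by rw [hfil]; simpa using hJ.left,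
        fun i hi hi' => by simpa using hJ.right i (by omega) hi', by simpa using hJ.bound⟩
      intro k' hk'
      have := hJ.cu k' hk'
      rw [htake]
      by_cases hkk : k' = k
      · subst hkk
        simp only [St.setV_a, St.tick_a, this, List.mem_append, List.mem_singleton, or_true, if_true]
        -- This subpattern is exhausted, so its path is the same at both levels.
        have e1 : (subF D k').take h = subF D k' := List.take_of_length_le hc
        have e2 : (subF D k').take (h + 1) = subF D k' := List.take_of_length_le (by omega)
        rw [e1, e2, ite_self]
      · simpa [hkk] using this
  · rintro s' ⟨str', hJ⟩ hF ht
    refine ⟨⟨str', ?_⟩, by simp at ht ⊢; omega⟩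
    refine ⟨by simpa using hJ.tab, by simpa using hJ.cuLt, by simpa using hJ.cu,
        by simpa using hJ.len, by simpa using hJ.nw, by simpa using hJ.left,
        by simpa using hJ.right, by simpa using hJ.bound⟩
  rintro s' ⟨⟨str', hJ⟩, ht⟩ hF
  have hh : s'.v .h = h := by rw [hF.v .h rfl]; simpa using hI.lev
  have hnw := hJ.nw
  have hleft := hJ.left
  have hcu := hJ.cu
  rw [List.take_length, ← live_succ] at hnw
  rw [List.take_length, ← live_succ] at hleft
  rw [List.take_length] at hcu
  have h3 := length_live_le (D := D) (h + 1)
  simp [wp, hh, hnw]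
  refine ⟨by omega, by omega, ⟨str', ?_⟩, by omega⟩
  refine ⟨by simp, by simpa using hJ.tab, by simpa using hJ.cuLt, ?_, by simpa using hJ.len,
    by simp, ?_, ?_⟩
  · intro k hk
    simp only [St.setV_a, St.tick_a]
    rw [hcu k hk]
    split_ifs with h4
    · rfl
    · rw [mem_live] at h4
      rw [List.take_of_length_le (by omega), List.take_of_length_le (by omega)]
  · rw [hnw] at hleft; simpa using hleft
  · have := hJ.bound
    rw [sum_min_live]
    simp; omega

/-- The trie of all subpatterns has been built. -/
structure Built (D : Dictionary σ) (str : ℕ → List (Fin σ)) (s : St) : Prop where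
  tab : TrieTab (s.v .nn) str (s.a .G)
  cuLt : ∀ k < 2 * D.length, s.a .CU k < s.v .nn
  cu : ∀ k < 2 * D.length, str (s.a .CU k) = subF D k
  bound : s.v .nn ≤ 1 + size D

theorem wp_trie (hS : Big D S) {s : St} (hP : Parsed D s) (hG : ∀ a, s.a .G a = 0)
    (hCU : ∀ a, s.a .CU a = 0) :
    wp S (Algo.trie σ) (fun s' => (∃ str', Built D str' s') ∧ s'.t ≤ s.t + 50 * size D + 20) s := by
  have h2 := two_mul_length_le (D := D)
  have hS1 := hS.size
  have hd := hP.d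
  simp only [Algo.trie]
  refine ⟨by simp, by simp [hd]; omega, ?_⟩
  simp only [E.eval_add, E.eval_var, hd]
  refine wp_seq (R := fun s' => (∀ k < 2 * D.length, s'.a .LV k = k) ∧
      s'.t ≤ s.t + 3 + 3 * (2 * D.length))
    (wp_for (2 * D.length) (fun j s' => ∀ k < j, s'.a .LV k = k) (fun _ => 1) (by omega)
      (by simp) ?_ ?_ ?_) ?_
  · intro i s' _ hF
    have := hF.v .nl rfl
    simp [this]; omega
  · intro i s' hi hI hxi hF
    simp [wp, hxi]
    refine ⟨by omega, by omega, fun k hk => ?_⟩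
    rw [Function.update_apply]
    split_ifs with h
    · exact h.symm
    · exact hI k (by omega)
  · intro s' hI hF ht
    refine ⟨by simpa using hI, by simp at ht ⊢; omega⟩
  rintro s1 ⟨hlv, ht1⟩ hF1
  refine ⟨by simp, by simp; omega, ?_⟩
  refine ⟨by simp, by simp, ?_⟩
  simp only [E.eval_one, E.eval_zero]
  have hG1 : s1.a .G = s.a .G := hF1.a .G rfl
  have hCU1 : s1.a .CU = s.a .CU := hF1.a .CU rfl
  have hnl1 : s1.v .nl = 2 * D.length := by rw [hF1.v .nl rfl]; simp; omega
  have hP1 : Parsed D s1 := (hP.tick.setV (by simp)).frame hF1 rfl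
  set s2 := (s1.tick.setV .nn 1).tick.setV .h 0 with hs2
  have hstart : LevelStart D 0 (fun _ => []) s2 := by
    refine ⟨by simp [hs2], ⟨⟨by simp [hs2], rfl, by simp [hs2], by simp, ?_⟩, by simp, ?_, ?_⟩,
      by simp [hs2, hCU1, hCU], by simp, by simp, by simp [hs2, hnl1, live_zero], ?_, by simp [hs2]⟩
    · intro x hx h0; simp [hs2] at hx; omega
    · intro x hx c _; simp [hs2, hG1, hG]
    · intro a _; simp [hs2, hG1, hG]
    · intro i hi
      rw [live_zero] at hi ⊢
      simp at hi
      simp [hs2, hi, hlv]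
  have hP2 : Parsed D s2 := (hP1.tick.setV (by simp)).tick.setV (by simp)
  have ht2 : s2.t = s1.t + 2 := by simp [hs2]
  -- The potential counts the pairs of a subpattern and a level from `h` on. A level with `l > 0`
  -- live subpatterns, including the test of the loop, takes at most `12 l + 7 ≤ 19 l` steps and
  -- lowers the potential by `l`.
  set Φ : ℕ → ℕ := fun h => ∑ k ∈ Finset.range (2 * D.length), ((subF D k).length + 1 - h) with hΦ
  have hΦ0 : Φ 0 = size D + 2 * D.length := by
    simp [hΦ, Finset.sum_add_distrib, sum_length_subF]
  refine ⟨fun s' => (∃ h str', LevelStart D h str' s' ∧ s'.t + 19 * Φ h ≤ s2.t + 19 * Φ 0) ∧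
    Parsed D s', fun s' => Φ (s'.v .h), ⟨⟨0, _, hstart, le_rfl⟩, hP2⟩, ?_⟩
  rintro s' ⟨⟨h, str', hI, ht⟩, hP'⟩
  refine ⟨by simp, by simp, fun hc => ?_, fun hc => ?_⟩
  · simp [Test.Holds, hI.nl] at hc
    have hsum := sum_sub_live D h
    have hh : h < S := by
      obtain ⟨k, hk⟩ := List.exists_mem_of_length_pos hc
      obtain ⟨hk1, hk2⟩ := mem_live.1 hk
      have := Finset.single_le_sum (f := fun k => (subF D k).length) (s := Finset.range (2 * D.length))
        (fun _ _ => Nat.zero_le _) (Finset.mem_range.2 hk1)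
      rw [sum_length_subF] at this
      omega
    have hI' : LevelStart D h str' s'.tick := by
      obtain ⟨a1, a2, a3, a4, a5, a6, a7, a8⟩ := hI
      exact ⟨a1, a2, a3, a4, a5, a6, a7, a8⟩
    have hP'' := hP'.tick
    refine wp_mono (wp_frame (wp_level hS hP'' hI' hh)) ?_
    rintro s'' ⟨⟨⟨str'', hJ⟩, htt⟩, hF⟩
    have e1 : Φ h = (live D h).length + Φ (h + 1) := hsum
    refine ⟨⟨⟨h + 1, str'', hJ, ?_⟩, hP''.frame hF rfl⟩, ?_⟩
    · simp at htt; omega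
    · show Φ (s''.v .h) < Φ (s'.v .h)
      rw [hJ.lev, hI.lev]; omega
  · simp [Test.Holds, hI.nl] at hc
    refine ⟨⟨str', ?_⟩, ?_⟩
    · refine ⟨hI.tab, hI.cuLt, fun k hk => ?_, ?_⟩
      · have := hI.cu k hk
        rw [St.tick_a, this, List.take_of_length_le]
        by_contra h4
        have : k ∈ live D h := mem_live.2 ⟨hk, by omega⟩
        rw [hc] at this; simp at this
      · have h3 := hI.bound
        have h4 := sum_min_le (D := D) h
        simp; omega
    · simp; omega

end

/-! ## Marking nodes and completing the automaton -/

section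

variable {σ : ℕ} {D : Dictionary σ} {S N : ℕ} {str : ℕ → List (Fin σ)}

/-- The node of the first subpattern of pattern `i`. -/
noncomputable def uNode (D : Dictionary σ) (N : ℕ) (str : ℕ → List (Fin σ)) (i : ℕ) : ℕ :=
  node N str (fstF D i)

/-- The node of the second subpattern of pattern `i`. -/
noncomputable def vNode (D : Dictionary σ) (N : ℕ) (str : ℕ → List (Fin σ)) (i : ℕ) : ℕ :=
  node N str (sndF D i)

/-- The trie contains all subpatterns. -/
structure TrieOf (D : Dictionary σ) (N : ℕ) (str : ℕ → List (Fin σ)) : Prop extends IsTrie N str where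
  strU : ∀ i < D.length, str (uNode D N str i) = fstF D i
  strV : ∀ i < D.length, str (vNode D N str i) = sndF D i
  bound : N ≤ 1 + size D

namespace TrieOf

variable (T : TrieOf D N str)
include T

theorem uLt (i : ℕ) : uNode D N str i < N := T.node_lt _
theorem vLt (i : ℕ) : vNode D N str i < N := T.node_lt _

theorem uNe {i : ℕ} (hi : i < D.length) : uNode D N str i ≠ 0 := fun h => by
  have := T.strU i hi
  rw [h, T.zero] at this
  exact fstF_ne hi this.symm

theorem vNe {i : ℕ} (hi : i < D.length) : vNode D N str i ≠ 0 := fun h => by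
  have := T.strV i hi
  rw [h, T.zero] at this
  exact sndF_ne hi this.symm

end TrieOf

theorem Built.trieOf {s : St} (h : Built D str s) : TrieOf D (s.v .nn) str := by
  refine ⟨h.tab.toIsTrie, fun i hi => ?_, fun i hi => ?_, h.bound⟩
  · refine IsTrie.str_node ⟨_, h.cuLt (2 * i) (by omega), ?_⟩
    rw [h.cu _ (by omega), subF_even]
  · refine IsTrie.str_node ⟨_, h.cuLt (2 * i + 1) (by omega), ?_⟩
    rw [h.cu _ (by omega), subF_odd]

theorem Built.cu_even {s : St} (h : Built D str s) {i : ℕ} (hi : i < D.length) :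
    s.a .CU (2 * i) = uNode D (s.v .nn) str i := by
  have T := h.trieOf
  exact T.inj _ (h.cuLt _ (by omega)) _ (T.uLt i)
    (by rw [h.cu _ (by omega), T.strU i hi, subF_even])

theorem Built.cu_odd {s : St} (h : Built D str s) {i : ℕ} (hi : i < D.length) :
    s.a .CU (2 * i + 1) = vNode D (s.v .nn) str i := by
  have T := h.trieOf
  exact T.inj _ (h.cuLt _ (by omega)) _ (T.vLt i)
    (by rw [h.cu _ (by omega), T.strV i hi, subF_odd])

/-- The nodes of the second subpatterns are marked; `VI` numbers the second subpatterns. -/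
structure Marked (D : Dictionary σ) (N : ℕ) (str : ℕ → List (Fin σ)) (s : St) : Prop where
  rk : ∀ i < D.length, s.a .RK i = rk (uNode D N str) i
  wt : ∀ x, s.a .WT x = wt D.length (uNode D N str) x
  viLt : ∀ i < D.length, s.a .VI i < D.length
  viSnd : ∀ i < D.length, vNode D N str (s.a .VI i) = vNode D N str i
  idV : ∀ i < D.length, s.a .ID (vNode D N str i) = s.a .VI i + 1
  idZ : ∀ x, (∀ i < D.length, vNode D N str i ≠ x) → s.a .ID x = 0

theorem wt_succ (n : ℕ) (U : ℕ → ℕ) (x : ℕ) :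
    wt (n + 1) U x = wt n U x + if U n = x then 1 else 0 := by
  unfold wt
  rw [Finset.range_add_one, Finset.filter_insert]
  split_ifs
  · rw [Finset.card_insert_of_notMem (by simp)]
  · rfl

theorem wt_le (n : ℕ) (U : ℕ → ℕ) (x : ℕ) : wt n U x ≤ n :=
  (Finset.card_filter_le _ _).trans (by simp)

/-- Among the patterns with the same second subpattern the last one leaves its index in `ID`, and
this index becomes their common number in `VI`. The rank of a pattern is the count at its first node
just before it is counted itself. -/
theorem wp_mark (hS : Big D S) {s : St} (hP : Parsed D s) (hB : Built D str s)
    (hID : ∀ a, s.a .ID a = 0) (hWT : ∀ a, s.a .WT a = 0) :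
    wp S Algo.mark (fun s' => Marked D (s.v .nn) str s' ∧ s'.t ≤ s.t + 8 * D.length + 8) s := by
  have h2 := two_mul_length_le (D := D)
  have hS1 := hS.size
  have hd := hP.d
  have T := hB.trieOf
  have hNs := hB.bound
  set N := s.v .nn with hN
  set U := uNode D N str with hU
  set V := vNode D N str with hV
  refine wp_seq (R := fun s' => (∀ x, (s'.a .ID x = 0 ∧ ∀ i < D.length, V i ≠ x) ∨
      ∃ i < D.length, V i = x ∧ s'.a .ID x = i + 1) ∧ (∀ i < D.length, s'.a .RK i = rk U i) ∧
      (∀ x, s'.a .WT x = wt D.length U x) ∧ s'.t ≤ s.t + 2 + 5 * D.length)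
    (wp_for D.length (fun n s' => (∀ x, (s'.a .ID x = 0 ∧ ∀ i < n, V i ≠ x) ∨
      ∃ i < n, V i = x ∧ s'.a .ID x = i + 1) ∧ (∀ i < n, s'.a .RK i = rk U i) ∧
      (∀ x, s'.a .WT x = wt n U x)) (fun _ => 3) (by omega) ?_ ?_ ?_ ?_) ?_
  · simp [hID, hWT, wt]
  · intro i s' _ hF
    simp [hF.v .d rfl, hd]
  · rintro i s' hi ⟨hI1, hI2, hI3⟩ hxi hF
    have hCU : s'.a .CU = s.a .CU := hF.a .CU rfl
    have e1 := hB.cu_even hi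
    have e2 := hB.cu_odd hi
    have l1 := T.uLt i
    have l2 := T.vLt i
    have w1 := wt_le i U (U i)
    simp only [← hN, ← hU, ← hV] at e1 e2 l1 l2
    simp [wp, Algo.inc, hxi, hCU, e1, e2, hI3]
    refine ⟨by omega, by omega, by omega, by omega, by omega, by omega, by omega, by omega,
      by omega, by omega, ⟨?_, ?_, ?_⟩⟩
    · intro x
      rw [Function.update_apply]
      split_ifs with hx
      · exact Or.inr ⟨i, by omega, hx.symm, rfl⟩
      · rcases hI1 x with ⟨h3, h4⟩ | ⟨j, h3, h4, h5⟩
        · refine Or.inl ⟨h3, fun j hj => ?_⟩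
          rcases Nat.lt_or_eq_of_le hj with h | rfl
          · exact h4 j h
          · exact fun h => hx h.symm
        · exact Or.inr ⟨j, by omega, h4, h5⟩
    · intro j hj
      rw [Function.update_apply]
      split_ifs with hx
      · subst hx; rfl
      · exact hI2 j (by omega)
    · intro x
      rw [Function.update_apply, wt_succ]
      split_ifs with h3 h4 h4
      · rw [h3]
      · exact absurd h3.symm h4
      · exact absurd h4.symm h3
      · rw [hI3, add_zero]
  · rintro s' ⟨hI1, hI2, hI3⟩ hF ht
    refine ⟨by simpa using hI1, by simpa using hI2, by simpa using hI3, by simp at ht ⊢; omega⟩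
  rintro s1 ⟨hI1, hI2, hI3, ht1⟩ hF1
  have hCU1 : s1.a .CU = s.a .CU := hF1.a .CU rfl
  have hidV : ∀ i < D.length, ∃ j < D.length, V j = V i ∧ s1.a .ID (V i) = j + 1 := by
    intro i hi
    rcases hI1 (V i) with ⟨-, h⟩ | h
    · exact absurd rfl (h i hi)
    · exact h
  refine wp_for D.length (fun n s' => ∀ i < n, s'.a .VI i = s1.a .ID (V i) - 1) (fun _ => 1)
    (by omega) (by simp) ?_ ?_ ?_
  · intro i s' _ hF
    simp [hF.v .d rfl, hF1.v .d rfl, hd]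
  · intro i s' hi hI hxi hF
    have hCU : s'.a .CU = s.a .CU := by rw [hF.a .CU rfl, hCU1]
    have hID1 : s'.a .ID = s1.a .ID := hF.a .ID rfl
    have e2 := hB.cu_odd hi
    have l2 := T.vLt i
    simp only [← hN, ← hV] at e2 l2
    obtain ⟨j, hj, -, ej⟩ := hidV i hi
    simp [wp, hxi, hCU, e2, hID1]
    refine ⟨by omega, by omega, by omega, fun k hk => ?_⟩
    rw [Function.update_apply]
    split_ifs with hx
    · subst hx; rfl
    · exact hI k (by omega)
  · intro s' hI hF ht
    have a1 : s'.a .ID = s1.a .ID := hF.a .ID rfl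
    have a2 : s'.a .RK = s1.a .RK := hF.a .RK rfl
    have a3 : s'.a .WT = s1.a .WT := hF.a .WT rfl
    refine ⟨⟨?_, ?_, ?_, ?_, ?_, ?_⟩, by simp at ht ⊢; omega⟩
    · simpa [a2] using hI2
    · simpa [a3] using hI3
    · intro i hi
      obtain ⟨j, hj, -, ej⟩ := hidV i hi
      simp [hI i hi, ej, hj]
    · intro i hi
      obtain ⟨j, hj, hv, ej⟩ := hidV i hi
      simpa [hI i hi, ej] using hv
    · intro i hi
      obtain ⟨j, hj, hv, ej⟩ := hidV i hi
      simp only [St.tick_a, a1, hI i hi]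
      rw [ej]; rfl
    · intro x hx
      rcases hI1 x with ⟨h, -⟩ | ⟨i, hi, h, -⟩
      · simpa [a1] using h
      · exact absurd h (hx i hi)

/-- The nearest marked node on the path of failure links. -/
noncomputable def dictLink (N : ℕ) (str : ℕ → List (Fin σ)) (m : ℕ → ℕ) (x : ℕ) : ℕ :=
  if m x = 0 then (if _h : failLink N str x < x then dictLink N str m (failLink N str x) else 0)
  else x
termination_by x

/-- The automaton is complete up to row `x` and column `n`. -/
structure AutoInv (N : ℕ) (str : ℕ → List (Fin σ)) (G₀ : ℕ → ℕ) (x n : ℕ) (s : St) : Prop where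
  done : ∀ y < x, ∀ c : Fin σ, s.a .G (y * σ + c) = state N str (str y ++ [c])
  row : ∀ c : Fin σ, c < n → s.a .G (x * σ + c) = state N str (str x ++ [c])
  todo : ∀ a, x * σ + n ≤ a → s.a .G a = G₀ a
  zero : s.a .F 0 = 0
  fail : ∀ y < N, ∀ p c, (p < x ∨ (p = x ∧ (c : Fin σ) < n)) → str y = str p ++ [c] →
    s.a .F y = failLink N str y

theorem AutoInv.congr {G₀ : ℕ → ℕ} {x n : ℕ} {s s' : St} (h : AutoInv N str G₀ x n s)
    (hG : s'.a .G = s.a .G) (hF : s'.a .F = s.a .F) : AutoInv N str G₀ x n s' := by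
  obtain ⟨h1, h2, h3, h4, h5⟩ := h
  rw [← hG] at h1 h2 h3
  rw [← hF] at h4 h5
  exact ⟨h1, h2, h3, h4, h5⟩

theorem AutoInv.next {G₀ : ℕ → ℕ} {x : ℕ} {s : St} (h : AutoInv N str G₀ x σ s) :
    AutoInv N str G₀ (x + 1) 0 s := by
  refine ⟨?_, fun c hc => by omega, fun a ha => h.todo a (by rw [add_mul] at ha; omega), h.zero,
    ?_⟩
  · intro y hy c
    rcases Nat.lt_succ_iff_lt_or_eq.1 hy with h1 | rfl
    · exact h.done y h1 c
    · exact h.row c c.isLt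
  · intro y hy p c hp e
    refine h.fail y hy p c ?_ e
    rcases hp with hp | ⟨-, hc⟩
    · rcases Nat.lt_succ_iff_lt_or_eq.1 hp with h1 | rfl
      · exact Or.inl h1
      · exact Or.inr ⟨rfl, c.isLt⟩
    · omega

/-- The trie parent of `x` is shallower and so has a smaller number; its finished row has already
set the link of `x`. -/
theorem AutoInv.failLink_eq (T : IsTrie N str) {G₀ : ℕ → ℕ} {x n : ℕ} {s : St}
    (h : AutoInv N str G₀ x n s) (hx : x < N) : s.a .F x = failLink N str x := by
  by_cases h0 : x = 0
  · subst h0; rw [h.zero, T.failLink_zero]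
  · obtain ⟨p, hp, c, e⟩ := T.closed x hx h0
    refine h.fail x hx p c (Or.inl ?_) e
    by_contra hpx
    have := T.mono x p (not_lt.1 hpx) hp
    rw [e] at this
    simp at this

/-- The row of `failLink x` is finished because `failLink x < x`, so `z` is the transition from
there. The same value is the failure link of an existing child and the transition for a missing one.
-/
theorem wp_transition (hS : Big D S) (hT : TrieOf D N str) {G₀ : ℕ → ℕ} (T : TrieTab N str G₀)
    {x : ℕ} (hx : x < N) (c : Fin σ) {s : St} (hxs : s.v .x = x) (hcs : s.v .c = c)
    (hI : AutoInv N str G₀ x c s) :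
    wp S (Algo.transition σ) (fun s' => AutoInv N str G₀ x (c + 1) s' ∧ s'.t ≤ s.t + 5) s := by
  have hNs := hT.bound
  have hS1 := hS.size
  have hS2 := hS.alph
  have hcell : ∀ y < N, y * σ + c < S := fun y hy => by
    have h1 := cell_lt c hy
    have h2 : N * σ ≤ (1 + size D) * σ := Nat.mul_le_mul_right _ hNs
    nlinarith
  have hfl := T.failLink_lt' x
  have hFx := hI.failLink_eq T.toIsTrie hx
  -- The root is its own failure link and its row is not yet finished; there the right value is the
  -- root itself, in both uses.
  set z := if x = 0 then 0 else state N str (str (failLink N str x) ++ [c]) with hz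
  have hzlt : z < N := by
    rw [hz]; split_ifs
    · exact T.pos
    · exact T.state_lt _
  have hGx : s.a .G (x * σ + c) = G₀ (x * σ + c) := hI.todo _ le_rfl
  refine wp_seq (R := fun s' => s'.v .z = z ∧ s'.t ≤ s.t + 2) ?_ ?_
  · by_cases h0 : x = 0
    · simp [wp, Test.Holds, hxs, h0, hz]
    · have h1 := hI.done _ (T.failLink_lt hx h0) c
      have h2 := hcell _ hfl
      simp [wp, Test.Holds, hxs, h0, hFx, hcs, h1]
      simp only [hz, h0, if_false] at hzlt ⊢
      exact ⟨⟨by omega, h2⟩, by omega, trivial⟩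
  rintro s1 ⟨hz1, ht1⟩ hF1
  have g1 : s1.a .G = s.a .G := hF1.a .G rfl
  have f1 : s1.a .F = s.a .F := hF1.a .F rfl
  have x1 : s1.v .x = x := by rw [hF1.v .x rfl, hxs]
  have c1 : s1.v .c = c := by rw [hF1.v .c rfl, hcs]
  have hGS : G₀ (x * σ + c) < N := by
    by_cases h : ∃ y < N, str y = str x ++ [c]
    · obtain ⟨y, hy, e⟩ := h
      rw [T.child x hx c y hy e]; exact hy
    · rw [T.none x hx c h]; exact T.pos
  have hIs := hI
  have hxS := hcell x hx
  by_cases h : ∃ y < N, str y = str x ++ [c]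
  · obtain ⟨y, hy, e⟩ := h
    have hGy := T.child x hx c y hy e
    have hy0 : y ≠ 0 := by
      rintro rfl; rw [T.zero] at e; simp at e
    have hzf : z = failLink N str y := by
      rw [hz]; split_ifs with h0
      · subst h0; rw [T.failLink_child_zero c e]
      · rw [T.failLink_child hx h0 c e]
    simp [wp, Test.Holds, x1, c1, g1, hGx, hGy, hz1, hy0]
    refine ⟨by omega, by omega, by omega, by omega, ?_, by omega⟩
    refine ⟨by simpa [g1] using hI.done, ?_, ?_, by simp [hy0.symm, f1, hI.zero], ?_⟩
    · intro c' hc'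
      rcases Nat.lt_succ_iff_lt_or_eq.1 hc' with h1 | h1
      · simpa [g1] using hI.row c' h1
      · have : c' = c := Fin.ext h1
        subst this
        simp only [St.setA_a_ne, St.tick_a, St.setV_a, g1, ne_eq, reduceCtorEq, not_false_eq_true]
        rw [hGx, hGy, ← e, T.state_str hy]
    · intro a ha
      simpa [g1] using hI.todo a (by omega)
    · intro y' hy' p c' hp e'
      simp only [St.setA_a_self, St.tick_a, St.setV_a, Function.update_apply, f1]
      split_ifs with h1
      · rw [h1, hzf]
      · refine hI.fail y' hy' p c' ?_ e'
        rcases hp with hp | ⟨rfl, hp⟩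
        · exact Or.inl hp
        · rcases Nat.lt_succ_iff_lt_or_eq.1 hp with h2 | h2
          · exact Or.inr ⟨rfl, h2⟩
          · have : c' = c := Fin.ext h2
            subst this
            exact absurd (T.inj _ hy' _ hy (e'.trans e.symm)) h1
  · have hG0 := T.none x hx c h
    have hzs : z = state N str (str x ++ [c]) := by
      rw [hz]; split_ifs with h0
      · subst h0; rw [T.state_missing_zero c h]
      · rw [T.state_missing hx h0 c h]
    simp [wp, Test.Holds, x1, c1, g1, hGx, hG0, hz1]
    refine ⟨by omega, by omega, ?_, by omega⟩
    refine ⟨?_, ?_, ?_, by simp [f1, hI.zero], ?_⟩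
    · intro y hy c'
      have hne : y * σ + c' ≠ x * σ + c := fun h => by
        have := (cell_inj h).1; omega
      simpa [g1, hne] using hI.done y hy c'
    · intro c' hc'
      by_cases h1 : c' = c
      · subst h1; simp [hzs]
      · have h2 : (c' : ℕ) ≠ c := fun h => h1 (Fin.ext h)
        simpa [g1, h2] using hI.row c' (by omega)
    · intro a ha
      have h2 : a ≠ x * σ + c := by omega
      simpa [g1, h2] using hI.todo a (by omega)
    · intro y' hy' p c' hp e'
      simp only [St.setA_a_ne, St.tick_a, St.setV_a, f1, ne_eq, reduceCtorEq, not_false_eq_true]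
      refine hI.fail y' hy' p c' ?_ e'
      rcases hp with hp | ⟨rfl, hp⟩
      · exact Or.inl hp
      · rcases Nat.lt_succ_iff_lt_or_eq.1 hp with h2 | h2
        · exact Or.inr ⟨rfl, h2⟩
        · have : c' = c := Fin.ext h2
          subst this
          exact absurd ⟨y', hy', e'⟩ h

/-- The complete automaton. -/
structure Auto (N : ℕ) (str : ℕ → List (Fin σ)) (s : St) : Prop where
  goto : ∀ x < N, ∀ c : Fin σ, s.a .G (x * σ + c) = state N str (str x ++ [c])
  fail : ∀ x < N, s.a .F x = failLink N str x
  link : ∀ x < N, s.a .DL x = dictLink N str (s.a .ID) x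

theorem dictLink_lt (T : IsTrie N str) (m : ℕ → ℕ) {x : ℕ} (hx : x < N) :
    dictLink N str m x < N := by
  induction x using Nat.strong_induction_on with
  | _ x ih =>
    rw [dictLink]; split_ifs with h1 h2
    · exact ih _ h2 (T.failLink_lt' x)
    · exact T.pos
    · exact hx

theorem wp_automaton (hS : Big D S) (hT : TrieOf D N str) {s : St} (hN : s.v .nn = N)
    (T : TrieTab N str (s.a .G)) (hF0 : s.a .F 0 = 0) (hDL : ∀ a, s.a .DL a = 0) :
    wp S (Algo.automaton σ) (fun s' => Auto N str s' ∧
      s'.t ≤ s.t + 2 + N * (7 * σ + 7)) s := by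
  have hNs := hT.bound
  have hS1 := hS.size
  have hS2 := hS.alph
  have hσS : σ ≤ S := by nlinarith
  refine wp_for N (fun x s' => AutoInv N str (s.a .G) x 0 s' ∧
      (∀ y < x, s'.a .DL y = dictLink N str (s.a .ID) y) ∧ (∀ y, x ≤ y → s'.a .DL y = 0))
    (fun _ => 7 * σ + 5) (by omega) ?_ ?_ ?_ ?_
  · refine ⟨⟨by simp, by simp, by simp, by simpa using hF0, by simp⟩, by simp, by simp [hDL]⟩
  · intro i s' _ hF
    simp [hF.v .nn rfl, hN]
  · rintro x s' hx ⟨hI, hd1, hd2⟩ hxs hF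
    refine wp_seq (R := fun s'' => AutoInv N str (s.a .G) x σ s'' ∧ s''.t ≤ s'.t + 3 + 7 * σ)
      (wp_for σ (fun c s'' => AutoInv N str (s.a .G) x c s'') (fun _ => 5) hσS
        (hI.congr rfl rfl) ?_ ?_ ?_) ?_
    · intro c s'' _ _
      simp
    · intro c s'' hc hI' hcs hF'
      have hx'' : s''.v .x = x := by rw [hF'.v .x rfl]; simpa using hxs
      refine wp_mono (wp_frame (wp_transition hS hT T hx ⟨c, hc⟩ (s := s''.tick)
        (by simpa using hx'') (by simpa using hcs) (hI'.congr rfl rfl))) ?_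
      rintro s3 ⟨⟨h1, h2⟩, hF3⟩
      refine ⟨by rw [hF3.v .c rfl]; simpa using hcs, h1.congr rfl rfl, by simpa using h2⟩
    · intro s'' hI' hF' ht
      refine ⟨hI'.congr rfl rfl, ?_⟩
      simp at ht ⊢; omega
    · rintro s1 ⟨hI1, ht1⟩ hF1
      have hx1 : s1.v .x = x := by rw [hF1.v .x rfl]; simpa using hxs
      have hID1 : s1.a .ID = s.a .ID := by rw [hF1.a .ID rfl, St.tick_a, hF.a .ID rfl]
      have hDL1 : s1.a .DL = s'.a .DL := by rw [hF1.a .DL rfl, St.tick_a]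
      have hf1 := hI1.failLink_eq T.toIsTrie hx
      have hfl := T.failLink_lt' x
      have fin : ∀ v, v = dictLink N str (s.a .ID) x →
          ∀ s2 : St, s2.a .G = s1.a .G → s2.a .F = s1.a .F → s2.v .x = x → s2.t ≤ s1.t + 2 →
          s2.a .DL = Function.update (s1.a .DL) x v →
          s2.v .x = x ∧ (AutoInv N str (s.a .G) (x + 1) 0 (s2.tick.setV .x (x + 1)) ∧
          (∀ y < x + 1, (s2.tick.setV .x (x + 1)).a .DL y = dictLink N str (s.a .ID) y) ∧
          ∀ y, x + 1 ≤ y → (s2.tick.setV .x (x + 1)).a .DL y = 0) ∧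
          s2.t ≤ s'.t + 1 + (7 * σ + 5) := by
        intro v hv s2 g2 f2 x2 t2 l2
        refine ⟨x2, ⟨hI1.next.congr (by simpa using g2) (by simpa using f2), ?_, ?_⟩, by omega⟩
        · intro y hy
          simp only [St.setV_a, St.tick_a, l2, hDL1, Function.update_apply]
          split_ifs with h
          · rw [h, hv]
          · exact hd1 y (by omega)
        · intro y hy
          simp only [St.setV_a, St.tick_a, l2, hDL1, Function.update_apply]
          rw [if_neg (by omega)]
          exact hd2 y (by omega)
      have hdl : s.a .ID x = 0 →
          s'.a .DL (failLink N str x) = dictLink N str (s.a .ID) x := by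
        intro h0
        rw [dictLink, if_pos h0]
        -- At the root the program copies `DL 0` to itself; its initial value `0` agrees with the
        -- default in `dictLink`.
        by_cases hx0 : x = 0
        · subst hx0
          rw [T.failLink_zero, hd2 0 le_rfl, dif_neg (by omega)]
        · rw [dif_pos (T.failLink_lt hx hx0), hd1 _ (T.failLink_lt hx hx0)]
      have hdlt := dictLink_lt T.toIsTrie (s.a .ID) hx
      refine ⟨by simp [hx1]; omega, by simp, fun hc => ?_, fun hc => ?_⟩
      · simp [Test.Holds, hx1, hID1] at hc
        have := hdl hc
        refine ⟨by simp, by simp [hx1, hf1]; omega, by simp [hx1]; omega,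
          by simp [hx1, hf1, hDL1, this]; omega, ?_⟩
        refine fin _ rfl _ (by simp) (by simp) (by simpa using hx1) (by simp) ?_
        simp [hx1, hf1, hDL1, this]
      · simp [Test.Holds, hx1, hID1] at hc
        refine ⟨by simp, by simp, by simp [hx1]; omega, by simp [hx1]; omega, ?_⟩
        refine fin _ rfl _ (by simp) (by simp) (by simpa using hx1) (by simp) ?_
        rw [dictLink, if_neg hc]
        simp [hx1]
  · rintro s' ⟨hI, hd1, hd2⟩ hF ht
    have hID' : s'.a .ID = s.a .ID := hF.a .ID rfl
    refine ⟨⟨hI.done, ?_, by simpa [hID'] using hd1⟩, ?_⟩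
    · intro x hx
      by_cases h0 : x = 0
      · subst h0; simp [hI.zero, T.failLink_zero]
      · obtain ⟨p, hp, c, e⟩ := T.closed x hx h0
        exact hI.fail x hx p c (Or.inl hp) e
    · simp at ht ⊢
      nlinarith

end

/-! ## The sequence of pushes and pops -/

section

variable {σ : ℕ} {D : Dictionary σ} {S N : ℕ} {str : ℕ → List (Fin σ)}

/-- The total size of the children of `z` among the nodes in `t`. -/
noncomputable def childSum (D : Dictionary σ) (N : ℕ) (str : ℕ → List (Fin σ)) (t : Finset ℕ)
    (z : ℕ) : ℕ :=
  ∑ y ∈ t, if y ≠ 0 ∧ failLink N str y = z then sz str D.length (uNode D N str) y else 0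

theorem childSum_range_succ (n z : ℕ) : childSum D N str (Finset.range (n + 1)) z =
    childSum D N str (Finset.range n) z +
      if n ≠ 0 ∧ failLink N str n = z then sz str D.length (uNode D N str) n else 0 :=
  Finset.sum_range_succ _ _

theorem childSum_Ico {m : ℕ} (hm : m < N) (z : ℕ) : childSum D N str (Finset.Ico m N) z =
    (if m ≠ 0 ∧ failLink N str m = z then sz str D.length (uNode D N str) m else 0) +
      childSum D N str (Finset.Ico (m + 1) N) z :=
  Finset.sum_eq_sum_Ico_succ_bot hm _

namespace TrieOf

variable (T : TrieOf D N str)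
include T

/-- First subpatterns are nonempty, so none of them sits at the root. -/
theorem wt_zero : wt D.length (uNode D N str) 0 = 0 := by
  unfold wt
  rw [Finset.card_eq_zero, Finset.filter_eq_empty_iff]
  intro i hi
  exact T.uNe (Finset.mem_range.1 hi)

theorem childSum_of_le {z n : ℕ} (hz : z < N) (hn : z + 1 ≤ n) :
    childSum D N str (Finset.range n) z = childSum D N str (Finset.Ico (z + 1) n) z := by
  unfold childSum
  rw [Finset.range_eq_Ico, ← Finset.sum_Ico_consecutive _ (Nat.zero_le (z + 1)) hn]
  rw [Finset.sum_eq_zero, zero_add]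
  intro y hy
  rw [Finset.mem_Ico] at hy
  rw [if_neg]
  rintro ⟨h0, h⟩
  have := T.failLink_lt (by omega) h0
  omega

theorem childSum_zero_of_le {z n : ℕ} (hn : n ≤ z + 1) (hnN : n ≤ N) :
    childSum D N str (Finset.range n) z = 0 := by
  unfold childSum
  refine Finset.sum_eq_zero fun y hy => ?_
  rw [Finset.mem_range] at hy
  rw [if_neg]
  rintro ⟨h0, h⟩
  have := T.failLink_lt (by omega) h0
  omega

theorem sz_eq_childSum {x : ℕ} (hx : x < N) : sz str D.length (uNode D N str) x =
    wt D.length (uNode D N str) x + childSum D N str (Finset.Ico (x + 1) N) x := by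
  rw [T.sz_eq (fun i _ => T.uLt i) hx, Finset.sum_filter, ← T.childSum_of_le hx hx]
  rfl

theorem start_eq_childSum {x : ℕ} (hx : x < N) (h0 : x ≠ 0) :
    start N str D.length (uNode D N str) x =
      start N str D.length (uNode D N str) (failLink N str x) +
      wt D.length (uNode D N str) (failLink N str x) +
      2 * childSum D N str (Finset.range x) (failLink N str x) := by
  rw [T.start_eq hx h0, Finset.sum_filter]
  rfl

end TrieOf

/-- By decreasing numbers every node is visited after all its children in the failure tree, so its
size is complete when it is passed to the parent. -/
theorem wp_sizes (hS : Big D S) (T : TrieOf D N str) {s : St} (hN : s.v .nn = N)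
    (hF0 : ∀ x < N, s.a .F x = failLink N str x)
    (hWT : ∀ x, s.a .WT x = wt D.length (uNode D N str) x) (hSZ : ∀ a, s.a .SZ a = 0) :
    wp S Algo.sizes (fun s' => (∀ x < N, s'.a .SZ x = sz str D.length (uNode D N str) x) ∧
      s'.t ≤ s.t + 2 + 5 * N) s := by
  have hNs := T.bound
  have hS1 := hS.size
  have h2 := two_mul_length_le (D := D)
  have hpos := T.pos
  set w := wt D.length (uNode D N str) with hw
  refine wp_for (N - 1) (fun n s' => ∀ x < N, s'.a .SZ x = (if N - n ≤ x then w x else 0) +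
    childSum D N str (Finset.Ico (N - n) N) x) (fun _ => 3) (by omega) ?_ ?_ ?_ ?_
  · intro x hx
    rw [if_neg (by omega)]
    simp [hSZ, childSum]
  · intro i s' _ hF
    simp [hF.v .nn rfl, hN]
  · intro n s' hn hI hxi hF
    have hf : s'.a .F = s.a .F := hF.a .F rfl
    have hwt : s'.a .WT = s.a .WT := hF.a .WT rfl
    have hnn : s'.v .nn = N := by rw [hF.v .nn rfl, hN]
    obtain ⟨x, hx⟩ : ∃ x, N - (n + 1) = x := ⟨_, rfl⟩
    have hx' : N - 1 - n = x := by omega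
    have hx1 : N - n = x + 1 := by omega
    rw [hx1] at hI
    have hxN : x < N := by omega
    have hx0 : x ≠ 0 := by omega
    have hfl := T.failLink_lt hxN hx0
    have e1 : s'.a .SZ x + w x = sz str D.length (uNode D N str) x := by
      rw [hI x hxN, if_neg (by omega), T.sz_eq_childSum hxN, zero_add, add_comm]
    have e2 : s'.a .SZ (failLink N str x) = childSum D N str (Finset.Ico (x + 1) N)
        (failLink N str x) := by
      rw [hI _ (by omega), if_neg (by omega), zero_add]
    have e3 : childSum D N str (Finset.Ico (x + 1) N) (failLink N str x) +
        sz str D.length (uNode D N str) x ≤ D.length := by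
      have h1 := T.sz_eq_childSum (x := failLink N str x) (by omega)
      rw [← T.childSum_of_le (by omega) (by omega)] at h1
      have h3 := sz_le (str := str) (d := D.length) (U := uNode D N str) (failLink N str x)
      have h4 := childSum_Ico (D := D) (str := str) hxN (failLink N str x)
      rw [if_pos ⟨hx0, rfl⟩] at h4
      have h5 : childSum D N str (Finset.Ico x N) (failLink N str x) ≤
          childSum D N str (Finset.range N) (failLink N str x) :=
        Finset.sum_le_sum_of_subset (fun y hy => by simp at hy ⊢; omega)
      omega
    have hle := sz_le (str := str) (d := D.length) (U := uNode D N str) x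
    simp [wp, Algo.inc, hnn, hxi, hx', hf, hF0 x hxN, hwt, hWT, hfl.ne, e1, e2]
    refine ⟨by omega, by omega, by omega, by omega, by omega, by omega, by omega, ?_⟩
    intro z hz
    rw [hx, childSum_Ico hxN]
    by_cases hzf : z = failLink N str x
    · subst hzf
      simp only [Function.update_self, ne_eq, hx0, not_false_eq_true, and_self, if_true]
      rw [if_neg (by omega)]
      omega
    · rw [Function.update_of_ne hzf, if_neg (c := _ ∧ _) (fun h => hzf h.2.symm), zero_add]
      by_cases hzx : z = x
      · subst hzx
        rw [Function.update_self, if_pos (by omega), T.sz_eq_childSum hxN]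
      · rw [Function.update_of_ne hzx, hI z hz]
        congr 1
        split_ifs <;> omega
  · intro s' hI hF ht
    refine ⟨fun x hx => ?_, ?_⟩
    · have h1 := hI x hx
      have h4 : N - (N - 1) = 1 := by omega
      rw [h4] at h1
      simp only [St.tick_a, h1, T.sz_eq_childSum hx, ← T.childSum_of_le hx hx]
      rw [← T.wt_zero]
      have h5 := T.wt_zero
      have h6 := childSum_Ico (D := D) (str := str) hpos x
      simp only [ne_eq, not_true, false_and, if_false, zero_add] at h6
      rw [← h6, Finset.range_eq_Ico]
      -- The loop stops at node `1`, so the weight of the root is never added; it is `0` anyway.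
      by_cases h0 : x = 0
      · subst h0; simp
      · rw [if_pos (by omega)]
    · simp at ht ⊢; omega

/-- Increasing numbers visit parents first. For a visited node `z`, `NX z` is the first time in its
span that is taken neither by its own pushes nor by a child visited so far; the untouched `NX 0 = 0`
is right for the root because its weight is `0`. -/
theorem wp_starts (hS : Big D S) (T : TrieOf D N str) {s : St} (hN : s.v .nn = N)
    (hF0 : ∀ x < N, s.a .F x = failLink N str x)
    (hWT : ∀ x, s.a .WT x = wt D.length (uNode D N str) x)
    (hSZ : ∀ x < N, s.a .SZ x = sz str D.length (uNode D N str) x)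
    (hST : ∀ a, s.a .ST a = 0) (hNX : ∀ a, s.a .NX a = 0) :
    wp S Algo.starts (fun s' =>
      (∀ x < N, s'.a .ST x = start N str D.length (uNode D N str) x) ∧
      s'.t ≤ s.t + 2 + 6 * N) s := by
  have hNs := T.bound
  have hS1 := hS.size
  have h2 := two_mul_length_le (D := D)
  have hpos := T.pos
  have hU : ∀ i < D.length, uNode D N str i < N := fun i _ => T.uLt i
  set w := wt D.length (uNode D N str) with hw
  have h00 : start N str D.length (uNode D N str) 0 = 0 := IsTrie.start_zero
  refine wp_for (N - 1) (fun n s' => (∀ x ≤ n, s'.a .ST x = start N str D.length (uNode D N str) x) ∧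
    ∀ z < N, s'.a .NX z = (if z ≤ n then start N str D.length (uNode D N str) z + w z else 0) +
      2 * childSum D N str (Finset.range (n + 1)) z) (fun _ => 4) (by omega) ?_ ?_ ?_ ?_
  · refine ⟨fun x hx => ?_, fun z hz => ?_⟩
    · rw [Nat.le_zero.1 hx, h00]; simp [hST]
    · rw [T.childSum_zero_of_le (by omega) (by omega)]
      simp only [St.setV_a, St.tick_a, hNX]
      split_ifs with h
      · rw [Nat.le_zero.1 h, h00, hw, T.wt_zero]
      · rfl
  · intro i s' _ hF
    simp [hF.v .nn rfl, hN]
  · rintro n s' hn ⟨hI1, hI2⟩ hxi hF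
    have hf : s'.a .F = s.a .F := hF.a .F rfl
    have hwt : s'.a .WT = s.a .WT := hF.a .WT rfl
    have hsz : s'.a .SZ = s.a .SZ := hF.a .SZ rfl
    have hxN : n + 1 < N := by omega
    have hfl := T.failLink_lt hxN (by omega)
    have e1 : s'.a .NX (failLink N str (n + 1)) = start N str D.length (uNode D N str) (n + 1) := by
      rw [hI2 _ (by omega), if_pos (by omega), T.start_eq_childSum hxN (by omega)]
    have e2 := T.start_le hU hxN
    have e3 := T.wt_le_sz hU hxN
    simp only [← hw] at e3
    simp [wp, Algo.inc, hxi, hf, hF0 _ hxN, hwt, hsz, hWT, hSZ _ hxN, e1]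
    refine ⟨by omega, by omega, by omega, by omega, by omega, by omega, by omega,
      by omega, by omega, by omega, ?_, ?_⟩
    · intro x hx
      rw [Function.update_apply]
      split_ifs with h
      · rw [h]
      · exact hI1 x (by omega)
    · intro z hz
      rw [childSum_range_succ]
      by_cases hzx : z = n + 1
      · subst hzx
        rw [Function.update_self, if_pos le_rfl, T.childSum_zero_of_le (by omega) (by omega),
          if_neg (by omega), add_zero, mul_zero, add_zero]
      · rw [Function.update_of_ne hzx]
        by_cases hzf : z = failLink N str (n + 1)
        · subst hzf
          rw [Function.update_self, if_pos (by omega), if_pos ⟨by omega, rfl⟩,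
            T.start_eq_childSum hxN (by omega)]
          ring
        · rw [Function.update_of_ne hzf, hI2 z hz, if_neg (c := _ ∧ _) (fun h => hzf h.2.symm),
            add_zero]
          congr 1
          split_ifs <;> omega
  · rintro s' ⟨hI1, hI2⟩ hF ht
    refine ⟨fun x hx => hI1 x (by omega), ?_⟩
    simp at ht ⊢; omega

/-- The array `oi` lists the operations of the patterns below `n`. -/
def OpTable (n : ℕ) (a b oi : ℕ → ℕ) : Prop :=
  ∀ k, (oi k = 0 ∧ ∀ i < n, a i ≠ k ∧ b i ≠ k) ∨
    ∃ i < n, (a i = k ∧ oi k = 2 * i + 1) ∨ (b i = k ∧ oi k = 2 * i + 2)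

theorem OpTable.succ {n : ℕ} {a b oi : ℕ → ℕ} (h : OpTable n a b oi) (hab : a n ≠ b n) :
    OpTable (n + 1) a b
      (Function.update (Function.update oi (a n) (2 * n + 1)) (b n) (2 * n + 2)) := by
  intro k
  by_cases hb : k = b n
  · exact Or.inr ⟨n, by omega, Or.inr ⟨hb.symm, by rw [hb, Function.update_self]⟩⟩
  rw [Function.update_of_ne hb]
  by_cases ha : k = a n
  · exact Or.inr ⟨n, by omega, Or.inl ⟨ha.symm, by rw [ha, Function.update_self]⟩⟩
  rw [Function.update_of_ne ha]
  rcases h k with ⟨h1, h2⟩ | ⟨i, h1, h2⟩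
  · refine Or.inl ⟨h1, fun i hi => ?_⟩
    rcases Nat.lt_succ_iff_lt_or_eq.1 hi with h3 | rfl
    · exact h2 i h3
    · exact ⟨Ne.symm ha, Ne.symm hb⟩
  · exact Or.inr ⟨i, by omega, h2⟩

/-- As laminarity is strict, all times of pushes and pops are distinct. So the pattern found in a
cell is the only one with that time. -/
theorem OpTable.timeline {d : ℕ} {a b oi : ℕ → ℕ} (h : OpTable d a b oi)
    (lt : ∀ i < d, a i < b i) (out_lt : ∀ i < d, b i < 2 * d)
    (laminar : ∀ i < d, ∀ j < d, i ≠ j → (a i < a j ∧ b j < b i) ∨ (a j < a i ∧ b i < b j) ∨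
      b i < a j ∨ b j < a i) : Timeline d a b oi := by
  have key : ∀ i < d, ∀ j < d, (i ≠ j → a i ≠ a j ∧ b i ≠ b j) ∧ a i ≠ b j := by
    intro i hi j hj
    have h1 := lt i hi
    have h2 := lt j hj
    by_cases hij : i = j
    · subst hij; exact ⟨fun h => absurd rfl h, by omega⟩
    · have := laminar i hi j hj hij
      exact ⟨fun _ => by omega, by omega⟩
  refine ⟨lt, out_lt, laminar, ?_, ?_, ?_, ?_⟩
  · intro i hi
    rcases h (a i) with ⟨-, h2⟩ | ⟨j, hj, ⟨h1, h2⟩ | ⟨h1, -⟩⟩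
    · exact absurd rfl (h2 i hi).1
    · by_cases hij : i = j
      · rw [h2, hij]
      · exact absurd h1.symm ((key i hi j hj).1 hij).1
    · exact absurd h1.symm (key i hi j hj).2
  · intro i hi
    rcases h (b i) with ⟨-, h2⟩ | ⟨j, hj, ⟨h1, -⟩ | ⟨h1, h2⟩⟩
    · exact absurd rfl (h2 i hi).2
    · exact absurd h1 (key j hj i hi).2
    · by_cases hij : i = j
      · rw [h2, hij]
      · exact absurd h1.symm ((key i hi j hj).1 hij).2
  · intro k _ i e
    rcases h k with ⟨h1, -⟩ | ⟨j, hj, ⟨h1, h2⟩ | ⟨h1, h2⟩⟩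
    · omega
    · obtain rfl : j = i := by omega
      exact ⟨hj, h1⟩
    · omega
  · intro k _ i e
    rcases h k with ⟨h1, -⟩ | ⟨j, hj, ⟨h1, h2⟩ | ⟨h1, h2⟩⟩
    · omega
    · omega
    · obtain rfl : j = i := by omega
      exact ⟨hj, h1⟩

theorem wp_ops (hS : Big D S) (T : TrieOf D N str) {s : St} (hd : s.v .d = D.length)
    (hCU : ∀ i < D.length, s.a .CU (2 * i) = uNode D N str i)
    (hRK : ∀ i < D.length, s.a .RK i = rk (uNode D N str) i)
    (hSZ : ∀ x < N, s.a .SZ x = sz str D.length (uNode D N str) x)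
    (hST : ∀ x < N, s.a .ST x = start N str D.length (uNode D N str) x)
    (hOI : ∀ a, s.a .OI a = 0) :
    wp S Algo.ops (fun s' => Timeline D.length (tIn N str D.length (uNode D N str))
      (tOut N str D.length (uNode D N str)) (s'.a .OI) ∧ s'.t ≤ s.t + 2 + 5 * D.length) s := by
  have hNs := T.bound
  have hS1 := hS.size
  have h2 := two_mul_length_le (D := D)
  have hU : ∀ i < D.length, uNode D N str i < N := fun i _ => T.uLt i
  refine wp_for D.length (fun n s' => OpTable n (tIn N str D.length (uNode D N str))
    (tOut N str D.length (uNode D N str)) (s'.a .OI)) (fun _ => 3) (by omega) ?_ ?_ ?_ ?_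
  · intro k; left; simp [hOI]
  · intro i s' _ hF
    simp [hF.v .d rfl, hd]
  · intro i s' hi hI hxi hF
    have a1 : s'.a .CU = s.a .CU := hF.a .CU rfl
    have a2 : s'.a .RK = s.a .RK := hF.a .RK rfl
    have a3 : s'.a .SZ = s.a .SZ := hF.a .SZ rfl
    have a4 : s'.a .ST = s.a .ST := hF.a .ST rfl
    have l1 := T.tIn_lt_tOut hU hi
    have l2 := T.tOut_lt hU hi
    have hsucc := hI.succ l1.ne
    have l3 := T.uLt i
    have e1 : start N str D.length (uNode D N str) (uNode D N str i) + rk (uNode D N str) i =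
      tIn N str D.length (uNode D N str) i := rfl
    have e2 : start N str D.length (uNode D N str) (uNode D N str i) +
      2 * sz str D.length (uNode D N str) (uNode D N str i) - 1 - rk (uNode D N str) i =
      tOut N str D.length (uNode D N str) i := rfl
    simp [wp, hxi, a1, a2, a3, a4, hCU i hi, hRK i hi, hSZ _ l3, hST _ l3, e1, e2]
    refine ⟨by omega, by omega, by omega, by omega, by omega, by omega, by omega,
      by omega, hsucc⟩
  · intro s' hI hF ht
    refine ⟨hI.timeline (fun i hi => T.tIn_lt_tOut hU hi) (fun i hi => T.tOut_lt hU hi)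
      (fun i hi j hj hij => T.laminar hU hi hj hij), ?_⟩
    simp at ht ⊢; omega

end

/-! ## Events of the persistent stacks -/

theorem mul_add_inj {d g g' v v' : ℕ} (hv : v < d) (hv' : v' < d) (h : g * d + v = g' * d + v') :
    g = g' ∧ v = v' := by
  have h2 := congrArg (· / d) h
  have h3 := congrArg (· % d) h
  simp only [Nat.mul_add_mod_self_right, Nat.mod_eq_of_lt hv, Nat.mod_eq_of_lt hv'] at h3
  rw [mul_comm g, mul_comm g'] at h2
  simp only [Nat.mul_add_div (by omega : 0 < d), Nat.div_eq_of_lt hv, Nat.div_eq_of_lt hv'] at h2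
  omega

theorem mul_add_lt {d g n v : ℕ} (hv : v < d) (hg : g < n) : g * d + v < n * d := by
  have : (g + 1) * d ≤ n * d := Nat.mul_le_mul_right _ hg
  rw [add_mul] at this; omega

/-- The patterns with second subpattern number `v` that allow the gap length number `g`. -/
def selGap (vi : ℕ → ℕ) (adm : ℕ → ℕ → Prop) (g v i : ℕ) : Prop := vi i = v ∧ adm g i

/-- The data of all stacks: a timeline of all patterns, the numbers of their second subpatterns,
and the offsets of the second subpatterns in the arrays of events. -/
structure StackData (d : ℕ) (a b oi vi bb : ℕ → ℕ) : Prop extends Timeline d a b oi where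
  viLt : ∀ i < d, vi i < d
  bb_eq : ∀ v ≤ d, bb v = ∑ j ∈ Finset.range v, cnt oi (fun i => vi i = j) (2 * d)

/-- The stacks of the gap length number `g` up to time `k`. -/
structure Row (d : ℕ) (a oi vi bb : ℕ → ℕ) (adm : ℕ → ℕ → Prop) (g k : ℕ)
    (HD FI LK ET EH : ℕ → ℕ) : Prop where
  hd : ∀ v < d, HD (g * d + v) = ptr (stk oi (selGap vi adm g v) k)
  fi : ∀ v < d, FI (g * d + v) = cnt oi (selGap vi adm g v) k
  lk : ∀ i < d, a i < k → adm g i →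
    LK (g * d + i) = ptr (stk oi (selGap vi adm g (vi i)) (a i))
  ev : ∀ v < d, ∀ l < k, isOp oi (selGap vi adm g v) l →
    ET (g * (2 * d) + bb v + cnt oi (selGap vi adm g v) l) = l ∧
    EH (g * (2 * d) + bb v + cnt oi (selGap vi adm g v) l) =
      ptr (stk oi (selGap vi adm g v) (l + 1))

section

variable {d : ℕ} {a b oi vi bb : ℕ → ℕ} {adm : ℕ → ℕ → Prop} {sel sel' : ℕ → Prop}

theorem cnt_le_cnt (h : ∀ i, sel i → sel' i) (k : ℕ) : cnt oi sel k ≤ cnt oi sel' k := by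
  classical
  refine Finset.card_le_card fun l hl => ?_
  rw [Finset.mem_filter] at hl ⊢
  exact ⟨hl.1, hl.2.1, h _ hl.2.2⟩

theorem cnt_lt_cnt {l k : ℕ} (h : isOp oi sel l) (hl : l < k) : cnt oi sel l < cnt oi sel k := by
  have h1 := cnt_succ (oi := oi) (sel := sel) l
  rw [if_pos h] at h1
  have h2 := cnt_mono (oi := oi) (sel := sel) (show l + 1 ≤ k from hl)
  omega

/-- A time concerns at most one pattern and hence at most one second subpattern. This is why `2 * d`
cells per gap length hold the events of all stacks. -/
theorem sum_cnt_le (n k : ℕ) : ∑ j ∈ Finset.range n, cnt oi (fun i => vi i = j) k ≤ k := by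
  induction k with
  | zero => simp [cnt]
  | succ k ih =>
    simp only [cnt_succ, Finset.sum_add_distrib]
    refine Nat.add_le_add ih ?_
    classical
    rw [← Finset.sum_filter, Finset.sum_const, smul_eq_mul, mul_one, Finset.card_le_one]
    intro x hx y hy
    rw [Finset.mem_filter] at hx hy
    exact hx.2.2.symm.trans hy.2.2

theorem ptr_le {l : List ℕ} (h : ∀ i ∈ l, i < d) : ptr l ≤ d := by
  cases l with
  | nil => simp [ptr]
  | cons i l => exact h i (by simp)

theorem Timeline.op_lt (L : Timeline d a b oi) {k : ℕ} (hk : k < 2 * d) (h : 0 < oi k) :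
    (oi k - 1) / 2 < d := by
  by_cases h1 : oi k % 2 = 1
  · exact (L.of_push k hk _ (by omega)).1
  · exact (L.of_pop k hk _ (by omega)).1

theorem Timeline.ptr_stk_le (L : Timeline d a b oi) {k : ℕ} (hk : k ≤ 2 * d) :
    ptr (stk oi sel k) ≤ d :=
  ptr_le fun i hi => (((L.stk_spec k hk).1 i).1 hi).1

namespace StackData

variable (P : StackData d a b oi vi bb)
include P

theorem bb_succ {v : ℕ} (hv : v < d) :
    bb (v + 1) = bb v + cnt oi (fun i => vi i = v) (2 * d) := by
  rw [P.bb_eq _ hv, P.bb_eq _ hv.le, Finset.sum_range_succ]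

theorem bb_le {v : ℕ} (hv : v ≤ d) : bb v ≤ 2 * d := by
  rw [P.bb_eq _ hv]; exact sum_cnt_le _ _

theorem bb_mono {v v' : ℕ} (h : v ≤ v') (hv : v' ≤ d) : bb v ≤ bb v' := by
  rw [P.bb_eq _ (h.trans hv), P.bb_eq _ hv]
  exact Finset.sum_le_sum_of_subset (Finset.range_mono h)

theorem cnt_selGap_le {v : ℕ} (g : ℕ) (hv : v < d) {k : ℕ} (hk : k ≤ 2 * d) :
    bb v + cnt oi (selGap vi adm g v) k ≤ bb (v + 1) := by
  rw [P.bb_succ hv]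
  exact Nat.add_le_add_left ((cnt_le_cnt (fun _ h => h.1) k).trans (cnt_mono hk)) _

theorem cell_lt {v : ℕ} {g : ℕ} (hv : v < d) {k : ℕ} (hk : k < 2 * d)
    (h : isOp oi (selGap vi adm g v) k) :
    bb v + cnt oi (selGap vi adm g v) k < bb (v + 1) :=
  lt_of_lt_of_le (Nat.add_lt_add_left (cnt_lt_cnt h hk) _) (P.cnt_selGap_le g hv le_rfl)

theorem cell_lt' {v : ℕ} {g : ℕ} (hv : v < d) {k : ℕ} (hk : k < 2 * d)
    (h : isOp oi (selGap vi adm g v) k) : bb v + cnt oi (selGap vi adm g v) k < 2 * d :=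
  (P.cell_lt hv hk h).trans_le (P.bb_le hv)

/-- Different events are stored in different cells. -/
theorem cell_ne {v v' g l k : ℕ} (hv : v < d) (hv' : v' < d) (hl : l < k) (hk : k < 2 * d)
    (h : isOp oi (selGap vi adm g v) l) (h' : isOp oi (selGap vi adm g v') k) :
    bb v + cnt oi (selGap vi adm g v) l ≠ bb v' + cnt oi (selGap vi adm g v') k := by
  have h1 := P.cell_lt hv (hl.trans hk) h
  have h2 := P.cell_lt hv' hk h'
  rcases lt_trichotomy v v' with h3 | rfl | h3
  · have := P.bb_mono (show v + 1 ≤ v' from h3) hv'.le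
    omega
  · have := cnt_lt_cnt h hl
    omega
  · have := P.bb_mono (show v' + 1 ≤ v from h3) hv.le
    omega

end StackData

namespace Row

theorem congr (P : StackData d a b oi vi bb) {g k : ℕ} (hk : k ≤ 2 * d)
    {HD FI LK ET EH HD' FI' LK' ET' EH' : ℕ → ℕ} (R : Row d a oi vi bb adm g k HD FI LK ET EH)
    (h1 : ∀ v < d, HD' (g * d + v) = HD (g * d + v)) (h2 : ∀ v < d, FI' (g * d + v) = FI (g * d + v))
    (h3 : ∀ v < d, LK' (g * d + v) = LK (g * d + v))
    (h4 : ∀ x < 2 * d, ET' (g * (2 * d) + x) = ET (g * (2 * d) + x))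
    (h5 : ∀ x < 2 * d, EH' (g * (2 * d) + x) = EH (g * (2 * d) + x)) :
    Row d a oi vi bb adm g k HD' FI' LK' ET' EH' := by
  refine ⟨fun v hv => by rw [h1 v hv, R.hd v hv], fun v hv => by rw [h2 v hv, R.fi v hv],
    fun i hi ha hg => by rw [h3 i hi, R.lk i hi ha hg], fun v hv l hl ho => ?_⟩
  have h := R.ev v hv l hl ho
  have hc := P.cell_lt' hv (by omega) ho
  rw [add_assoc] at h ⊢
  rw [h4 _ hc, h5 _ hc]
  exact h

theorem zero {g : ℕ} {HD FI LK ET EH : ℕ → ℕ} (h1 : ∀ v < d, HD (g * d + v) = 0)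
    (h2 : ∀ v < d, FI (g * d + v) = 0) : Row d a oi vi bb adm g 0 HD FI LK ET EH :=
  ⟨fun v hv => by rw [h1 v hv]; rfl, fun v hv => by rw [h2 v hv]; simp [cnt],
    fun _ _ h => by omega, fun _ _ _ h => by omega⟩

/-- A pattern pushed at time `k` that admits `g` would be an operation of this row, so no new link
is due. -/
theorem idle (L : Timeline d a b oi) {g k : ℕ} {HD FI LK ET EH : ℕ → ℕ}
    (R : Row d a oi vi bb adm g k HD FI LK ET EH)
    (h : ∀ v, ¬ isOp oi (selGap vi adm g v) k) :
    Row d a oi vi bb adm g (k + 1) HD FI LK ET EH := by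
  refine ⟨fun v hv => ?_, fun v hv => ?_, fun i hi ha hg => ?_, fun v hv l hl ho => ?_⟩
  · rw [stk, if_neg (h v), R.hd v hv]
  · rw [cnt_succ, if_neg (h v), R.fi v hv, add_zero]
  · refine R.lk i hi ?_ hg
    by_contra hlt
    have e : a i = k := by omega
    have h1 := L.push i hi
    rw [e] at h1
    refine h (vi i) ⟨by omega, ?_⟩
    rw [h1, show (2 * i + 1 - 1) / 2 = i by omega]
    exact ⟨rfl, hg⟩
  · refine R.ev v hv l ?_ ho
    rcases Nat.lt_succ_iff_lt_or_eq.1 hl with h1 | rfl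
    · exact h1
    · exact absurd ho (h v)

/-- The stack after a pop. -/
theorem pop_eq (P : StackData d a b oi vi bb) {g k : ℕ} (hk : k < 2 * d)
    {HD FI LK ET EH : ℕ → ℕ} (R : Row d a oi vi bb adm g k HD FI LK ET EH) {v : ℕ} (hv : v < d)
    (ho : isOp oi (selGap vi adm g v) k) (h2 : oi k % 2 ≠ 1) :
    0 < HD (g * d + v) ∧ LK (g * d + (HD (g * d + v) - 1)) =
      ptr (stk oi (selGap vi adm g v) (k + 1)) := by
  obtain ⟨hi, hb⟩ := P.of_pop k hk ((oi k - 1) / 2) (by have := ho.1; omega)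
  obtain ⟨hm, -, hl⟩ := P.stk_spec (sel := selGap vi adm g v) k hk.le
  have hai := P.lt _ hi
  have hmem : (oi k - 1) / 2 ∈ stk oi (selGap vi adm g v) k :=
    (hm _).2 ⟨hi, ho.2, by omega, by omega⟩
  obtain ⟨j, l, hjl⟩ := List.exists_cons_of_ne_nil (List.ne_nil_of_mem hmem)
  have hj := (hm j).1 (by rw [hjl]; simp)
  have hll := hl j l (by rw [hjl])
  rw [R.hd v hv, stk, if_pos ho, if_neg h2, hjl]
  refine ⟨by simp [ptr], ?_⟩
  -- The link written when the top pattern was pushed still describes what lies below it, by the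
  -- third claim of `stk_spec`.
  have h3 := R.lk j hj.1 hj.2.2.1 hj.2.1.2
  rw [hj.2.1.1] at h3
  rw [List.tail_cons, hll, ← h3]
  rfl

/-- The operation concerns a single stack of row `g`. The rest of the row is preserved because the
cell of the new event differs from those of all earlier events, and a push writes a link cell that
belongs to the pattern `i` alone. -/
theorem event (P : StackData d a b oi vi bb) {g k : ℕ} (hk : k < 2 * d)
    {HD FI LK ET EH LK' : ℕ → ℕ} (R : Row d a oi vi bb adm g k HD FI LK ET EH) {i v h' c p : ℕ}
    (hi : (oi k - 1) / 2 = i) (hv : vi i = v) (h0 : 0 < oi k) (hg : adm g i)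
    (hc : g * d + v = c) (hp : g * (2 * d) + bb v + FI c = p)
    (hin : oi k % 2 = 1 → LK' = Function.update LK (g * d + i) (HD c) ∧ h' = i + 1)
    (hout : oi k % 2 ≠ 1 → LK' = LK ∧ h' = LK (g * d + (HD c - 1))) :
    Row d a oi vi bb adm g (k + 1) (Function.update HD c h') (Function.update FI c (FI c + 1)) LK'
      (Function.update ET p k) (Function.update EH p h') := by
  have hid : i < d := hi ▸ P.op_lt hk h0
  have hvd : v < d := hv ▸ P.viLt i hid
  have ho : isOp oi (selGap vi adm g v) k := ⟨h0, by rw [hi]; exact ⟨hv, hg⟩⟩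
  have hno : ∀ v', v' ≠ v → ¬ isOp oi (selGap vi adm g v') k := fun v' hne h => by
    have := h.2.1
    rw [hi, hv] at this
    exact hne this.symm
  subst hc
  have hh' : h' = ptr (stk oi (selGap vi adm g v) (k + 1)) := by
    by_cases h2 : oi k % 2 = 1
    · rw [(hin h2).2, stk, if_pos ho, if_pos h2, hi]; rfl
    · rw [(hout h2).2, (R.pop_eq P hk hvd ho h2).2]
  have hcell : ∀ v' < d, v' ≠ v → g * d + v' ≠ g * d + v := fun v' _ h h1 => h (by omega)
  rw [R.fi v hvd] at hp
  refine ⟨fun v' hv' => ?_, fun v' hv' => ?_, fun j hj haj hgj => ?_, fun v' hv' l hl ho' => ?_⟩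
  · by_cases hvv : v' = v
    · subst hvv; rw [Function.update_self, hh']
    · rw [Function.update_of_ne (hcell v' hv' hvv), stk, if_neg (hno v' hvv), R.hd v' hv']
  · by_cases hvv : v' = v
    · subst hvv; rw [Function.update_self, cnt_succ, if_pos ho, R.fi v' hv']
    · rw [Function.update_of_ne (hcell v' hv' hvv), cnt_succ, if_neg (hno v' hvv), R.fi v' hv',
        add_zero]
  · by_cases h2 : oi k % 2 = 1
    · obtain ⟨-, hai⟩ := P.of_push k hk i (by omega)
      rw [(hin h2).1]
      by_cases hji : j = i
      · subst hji
        rw [Function.update_self, hai, hv, R.hd v hvd]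
      · rw [Function.update_of_ne (by omega)]
        refine R.lk j hj ?_ hgj
        have := P.laminar j hj i hid hji
        have := P.lt j hj
        have := P.lt i hid
        omega
    · rw [(hout h2).1]
      refine R.lk j hj ?_ hgj
      by_contra hlt
      have e : a j = k := by omega
      have h1 := P.push j hj
      rw [e] at h1
      omega
  · rcases Nat.lt_succ_iff_lt_or_eq.1 hl with h1 | rfl
    · have hne := P.cell_ne hv' hvd h1 hk ho' ho
      rw [Function.update_of_ne (by omega), Function.update_of_ne (by omega)]
      exact R.ev v' hv' l h1 ho'
    · have hvv : v' = v := by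
        by_contra h3
        exact hno v' h3 ho'
      subst hvv
      rw [hp, Function.update_self, Function.update_self]
      exact ⟨rfl, hh'⟩

end Row

end

section

variable {σ : ℕ} {D : Dictionary σ} {S : ℕ} {a b oi vi bb : ℕ → ℕ}

theorem wp_offsets (hS : Big D S) {s : St} (hd : s.v .d = D.length)
    (L : Timeline D.length a b (s.a .OI)) (hvi : ∀ i < D.length, s.a .VI i < D.length)
    (hCN : ∀ a, s.a .CN a = 0) (hBB : ∀ a, s.a .BB a = 0) :
    wp S Algo.offsets (fun s' => StackData D.length a b (s.a .OI) (s.a .VI) (s'.a .BB) ∧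
      s'.t ≤ s.t + 4 + 11 * D.length) s := by
  have hS1 := hS.size
  have h2 := two_mul_length_le (D := D)
  refine wp_seq (R := fun s' => (∀ v, s'.a .CN v =
      cnt (s.a .OI) (fun i => s.a .VI i = v) (2 * D.length)) ∧ s'.t ≤ s.t + 2 + 8 * D.length)
    (wp_for (2 * D.length) (fun n s' => ∀ v, s'.a .CN v = cnt (s.a .OI) (fun i => s.a .VI i = v) n)
      (fun _ => 2) (by omega) ?_ ?_ ?_ ?_) ?_
  · simp [hCN, cnt]
  · intro i s' _ hF
    simp [hF.v .d rfl, hd]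
  · intro k s' hk hI hxi hF
    have a1 : s'.a .OI = s.a .OI := hF.a .OI rfl
    have a2 : s'.a .VI = s.a .VI := hF.a .VI rfl
    by_cases h0 : 0 < s.a .OI k
    · have l1 := L.op_lt hk h0
      have l2 := hvi _ l1
      have l3 := cnt_le (oi := s.a .OI) (sel := fun i => s.a .VI i = s.a .VI ((s.a .OI k - 1) / 2)) k
      simp [wp, Algo.inc, Test.Holds, hxi, a1, a2, h0, hI]
      refine ⟨by omega, by omega, by omega, by omega, by omega, fun v => ?_⟩
      rw [cnt_succ, Function.update_apply, hI]
      by_cases hv : v = s.a .VI ((s.a .OI k - 1) / 2)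
      · rw [if_pos hv, if_pos ⟨h0, hv.symm⟩, ← hv]
      · rw [if_neg hv, if_neg fun h => hv h.2.symm, add_zero]
    · simp [wp, Test.Holds, hxi, a1, h0]
      refine ⟨by omega, fun v => ?_⟩
      rw [cnt_succ, hI, if_neg fun h => h0 h.1, add_zero]
  · intro s' hI hF ht
    refine ⟨hI, ?_⟩
    simp at ht ⊢; omega
  rintro s1 ⟨hC, ht1⟩ hF1
  refine wp_for D.length (fun n s' => ∀ v, s'.a .BB v = if v ≤ n then ∑ j ∈ Finset.range v,
    cnt (s.a .OI) (fun i => s.a .VI i = j) (2 * D.length) else 0) (fun _ => 1) (by omega) ?_ ?_ ?_ ?_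
  · intro v
    have : s1.a .BB = s.a .BB := hF1.a .BB rfl
    simp only [St.setV_a, St.tick_a, this, hBB]
    split_ifs with h
    · rw [Nat.le_zero.1 h]; rfl
    · rfl
  · intro i s' _ hF
    simp [hF.v .d rfl, hF1.v .d rfl, hd]
  · intro i s' hi hI hxi hF
    have a1 : s'.a .CN = s1.a .CN := hF.a .CN rfl
    have l1 := sum_cnt_le (oi := s.a .OI) (vi := s.a .VI) (i + 1) (2 * D.length)
    rw [Finset.sum_range_succ] at l1
    simp [wp, hxi, a1, hC, hI]
    refine ⟨by omega, by omega, by omega, fun v => ?_⟩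
    rw [Function.update_apply]
    by_cases hv : v = i + 1
    · subst hv
      rw [if_pos rfl, if_pos le_rfl, Finset.sum_range_succ]
    · rw [if_neg hv, hI]
      split_ifs <;> first | rfl | omega
  · intro s' hI hF ht
    refine ⟨⟨L, hvi, fun v hv => ?_⟩, ?_⟩
    · simp only [St.tick_a, hI v, if_pos hv]
    · simp at ht ⊢; omega

/-- Pattern `i` allows the gap length number `g`. -/
def Admits (D : Dictionary σ) (g i : ℕ) : Prop :=
  loF D i ≤ g + alphaStar D ∧ g + alphaStar D ≤ hiF D i

/-- The rows of the events: those before `g` are complete, row `g` has reached time `k`. -/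
def Rows (D : Dictionary σ) (a oi vi bb : ℕ → ℕ) (g k : ℕ) (s : St) : Prop :=
  ∀ g', Row D.length a oi vi bb (Admits D) g' (if g' < g then 2 * D.length else if g' = g then k else 0)
    (s.a .HD) (s.a .FI) (s.a .LK) (s.a .ET) (s.a .EH)

theorem Rows.congr {g k : ℕ} {s s' : St} (h : Rows D a oi vi bb g k s) (h1 : s'.a .HD = s.a .HD)
    (h2 : s'.a .FI = s.a .FI) (h3 : s'.a .LK = s.a .LK) (h4 : s'.a .ET = s.a .ET)
    (h5 : s'.a .EH = s.a .EH) : Rows D a oi vi bb g k s' := by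
  unfold Rows at *
  rwa [h1, h2, h3, h4, h5]

theorem Rows.next {g : ℕ} {s : St} (h : Rows D a oi vi bb g (2 * D.length) s) :
    Rows D a oi vi bb (g + 1) 0 s := by
  intro g'
  convert h g' using 1
  split_ifs <;> first | rfl | omega

theorem wp_event (hS : Big D S) (P : StackData D.length a b oi vi bb) {g k : ℕ}
    (hg : g < betaStar D + 1 - alphaStar D) (hk : k < 2 * D.length) {s : St} {i : ℕ}
    (hi : (oi k - 1) / 2 = i) (h0 : 0 < oi k) (hadm : Admits D g i)
    (hR : Rows D a oi vi bb g k s) (hd : s.v .d = D.length) (hgs : s.v .g = g) (hks : s.v .k = k)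
    (his : s.v .i = i) (hoi : s.a .OI = oi) (hvi : s.a .VI = vi) (hbb : s.a .BB = bb) :
    wp S Algo.event (fun s' => Rows D a oi vi bb g (k + 1) s' ∧ s'.t ≤ s.t + 9) s := by
  have hS1 := hS.size
  have hS2 := hS.gaps
  have h2 := two_mul_length_le (D := D)
  have hid : i < D.length := hi ▸ P.op_lt hk h0
  have hα := alphaStar_le_betaStar (D := D) (List.ne_nil_of_length_pos (by omega))
  have e : betaStar D + 1 - alphaStar D = betaStar D - alphaStar D + 1 := by omega
  have hvd := P.viLt i hid
  have ho : isOp oi (selGap vi (Admits D) g (vi i)) k := ⟨h0, by rw [hi]; exact ⟨rfl, hadm⟩⟩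
  have hrow := hR g
  rw [if_neg (by omega), if_pos rfl] at hrow
  have hfi := hrow.fi _ hvd
  have hcl := P.cell_lt' hvd hk ho
  have hG : ∀ v < D.length, g * D.length + v < S := fun v hv => by
    have := mul_add_lt hv hg
    rw [mul_comm (_ - _)] at this
    rw [e] at this
    omega
  have hG2 : ∀ v < 2 * D.length, g * (2 * D.length) + v < S := fun v hv => by
    have := mul_add_lt hv hg
    rw [mul_comm (_ - _)] at this
    rw [e, mul_assoc] at this
    omega
  have hhd : s.a .HD (g * D.length + vi i) ≤ D.length := by
    rw [hrow.hd _ hvd]; exact P.ptr_stk_le hk.le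
  have hpop := hrow.pop_eq P hk hvd ho
  have hple := P.ptr_stk_le (sel := selGap vi (Admits D) g (vi i)) (k := k + 1) (by omega)
  have key : ∀ s' : St, ∀ LK' h',
      (oi k % 2 = 1 → LK' = Function.update (s.a .LK) (g * D.length + i)
        (s.a .HD (g * D.length + vi i)) ∧ h' = i + 1) →
      (oi k % 2 ≠ 1 → LK' = s.a .LK ∧
        h' = s.a .LK (g * D.length + (s.a .HD (g * D.length + vi i) - 1))) →
      s'.a .HD = Function.update (s.a .HD) (g * D.length + vi i) h' →
      s'.a .FI = Function.update (s.a .FI) (g * D.length + vi i)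
        (s.a .FI (g * D.length + vi i) + 1) →
      s'.a .LK = LK' →
      s'.a .ET = Function.update (s.a .ET) (g * (2 * D.length) + bb (vi i) +
        s.a .FI (g * D.length + vi i)) k →
      s'.a .EH = Function.update (s.a .EH) (g * (2 * D.length) + bb (vi i) +
        s.a .FI (g * D.length + vi i)) h' →
      Rows D a oi vi bb g (k + 1) s' := by
    intro s' LK' h' hin hout e1 e2 e3 e4 e5 g'
    rw [e1, e2, e3, e4, e5]
    by_cases hgg : g' = g
    · subst hgg
      rw [if_neg (by omega), if_pos rfl]
      exact hrow.event P hk hi rfl h0 hadm rfl rfl hin hout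
    · have := hR g'
      rw [if_neg hgg] at this ⊢
      have hne : ∀ v < D.length, ∀ v' < D.length, g' * D.length + v ≠ g * D.length + v' :=
        fun v hv v' hv' h => hgg (mul_add_inj hv hv' h).1
      have hne2 : ∀ x < 2 * D.length, g' * (2 * D.length) + x ≠
          g * (2 * D.length) + bb (vi i) + s.a .FI (g * D.length + vi i) :=
        fun x hx h => hgg (mul_add_inj hx (by rw [hfi]; exact hcl) (h.trans (add_assoc _ _ _))).1
      refine this.congr P (by split_ifs <;> omega) (fun v hv => ?_) (fun v hv => ?_)
        (fun v hv => ?_) (fun x hx => ?_) (fun x hx => ?_)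
      · rw [Function.update_of_ne (hne v hv _ hvd)]
      · rw [Function.update_of_ne (hne v hv _ hvd)]
      · by_cases h1 : oi k % 2 = 1
        · rw [(hin h1).1, Function.update_of_ne (hne v hv _ hid)]
        · rw [(hout h1).1]
      · rw [Function.update_of_ne (hne2 x hx)]
      · rw [Function.update_of_ne (hne2 x hx)]
  have b1 := hG _ hvd
  have b2 := hG _ hid
  have b3 := hG2 _ hcl
  have b4 := cnt_le (oi := oi) (sel := selGap vi (Admits D) g (vi i)) k
  by_cases h1 : oi k % 2 = 1
  · simp [wp, Algo.event, Algo.inc, Test.Holds, hgs, hks, his, hd, hoi, hvi, hbb, h1]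
    refine ⟨by omega, by omega, by omega, by omega, by omega, by omega, by omega, by omega, by omega,
      by omega, by omega, by omega, by omega, by omega, by omega, by omega,
      by omega, by omega, ?_⟩
    refine key _ (Function.update (s.a .LK) (g * D.length + i)
        (s.a .HD (g * D.length + vi i))) (i + 1) (fun _ => ⟨rfl, rfl⟩) (fun h => absurd h1 h)
      ?_ ?_ ?_ ?_ ?_ <;> simp
  · obtain ⟨p1, p2⟩ := hpop h1
    have b5 := hG (s.a .HD (g * D.length + vi i) - 1) (by omega)
    rw [← p2] at hple
    simp [wp, Algo.event, Algo.inc, Test.Holds, hgs, hks, his, hd, hoi, hvi, hbb, h1]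
    refine ⟨by omega, by omega, by omega, by omega, by omega, by omega, by omega, by omega, by omega,
      by omega, by omega, by omega, by omega, by omega, by omega, by omega,
      ?_⟩
    refine key _ (s.a .LK) _ (fun h => absurd h h1) (fun h => ⟨rfl, rfl⟩)
      ?_ ?_ ?_ ?_ ?_ <;> simp

theorem wp_planes (hS : Big D S) (hD : D ≠ []) (P : StackData D.length a b oi vi bb) {s : St}
    (hP : Parsed D s) (hoi : s.a .OI = oi) (hvi : s.a .VI = vi) (hbb : s.a .BB = bb)
    (hHD : ∀ x, s.a .HD x = 0) (hFI : ∀ x, s.a .FI x = 0) :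
    wp S Algo.planes (fun s' => (∀ g < betaStar D + 1 - alphaStar D,
      Row D.length a oi vi bb (Admits D) g (2 * D.length)
        (s'.a .HD) (s'.a .FI) (s'.a .LK) (s'.a .ET) (s'.a .EH)) ∧
      s'.t ≤ s.t + 2 + (betaStar D + 1 - alphaStar D) * (4 + 30 * D.length)) s := by
  have hS1 := hS.size
  have hS2 := hS.ring
  have h2 := two_mul_length_le (D := D)
  have hα := alphaStar_le_betaStar hD
  refine wp_for (betaStar D + 1 - alphaStar D) (fun g s' => Rows D a oi vi bb g 0 s')
    (fun _ => 2 + 30 * D.length) (by omega) ?_ ?_ ?_ ?_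
  · intro g'
    simp only [Nat.not_lt_zero, if_false, ite_self]
    exact Row.zero (by simp [hHD]) (by simp [hFI])
  · intro i s' _ hF
    simp [hF.v .ds rfl, hP.ds]
  · intro g s' hg hI hgs hF
    have hP' := hP.frame hF rfl
    refine wp_for (2 * D.length) (fun k s'' => Rows D a oi vi bb g k s'')
      (fun _ => 13) (by omega) (hI.congr rfl rfl rfl rfl rfl) ?_ ?_ ?_
    · intro k s'' _ hF'
      simp [hF'.v .d rfl, hP'.d]
    · intro k s'' hk hI' hks hF'
      have hP'' := hP'.tick.frame hF' rfl
      have hg'' : s''.v .g = g := by rw [hF'.v .g rfl]; simpa using hgs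
      have o1 : s''.a .OI = oi := by rw [hF'.a .OI rfl, St.tick_a, hF.a .OI rfl, hoi]
      have o2 : s''.a .VI = vi := by rw [hF'.a .VI rfl, St.tick_a, hF.a .VI rfl, hvi]
      have o3 : s''.a .BB = bb := by rw [hF'.a .BB rfl, St.tick_a, hF.a .BB rfl, hbb]
      have idle : (∀ v, ¬ isOp oi (selGap vi (Admits D) g v) k) →
          Rows D a oi vi bb g (k + 1) s'' := fun h g' => by
        have := hI' g'
        by_cases hgg : g' = g
        · subst hgg
          rw [if_neg (by omega), if_pos rfl] at this ⊢
          exact this.idle P.toTimeline h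
        · rwa [if_neg hgg] at this ⊢
      by_cases h0 : 0 < oi k
      · have hid := P.op_lt hk h0
        obtain ⟨i, hi⟩ : ∃ i, (oi k - 1) / 2 = i := ⟨_, rfl⟩
        rw [hi] at hid
        have hlo := hP''.lo i hid
        have hhi := hP''.hi i hid
        simp only [wp, E.ok_zero, E.ok_rd, E.ok_var, E.eval_var, E.eval_rd, E.eval_zero, Test.Holds,
          E.ok_sub, E.ok_div, E.ok_one, E.ok_two, E.eval_sub, E.eval_div, E.eval_one, E.eval_two,
          E.ok_add, E.eval_add, St.tick_v, St.tick_a, hks, o1, hi, true_and, and_true, h0,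
          forall_true_left, not_true_eq_false, false_imp_iff, St.setV_v_self, St.setV_a,
          St.setV_v_ne, ne_eq, reduceCtorEq, not_false_eq_true, hg'', hP''.al, hlo, hhi]
        refine ⟨by omega, by omega, by omega, by omega, fun hc => ?_, fun hc => ⟨by omega,
          fun hc' => ?_, fun hc' => ?_⟩⟩
        · have := idle fun v h => by
            have := h.2.2.1
            rw [hi] at this; omega
          refine ⟨this.congr rfl rfl rfl rfl rfl, by simp⟩
        · have := idle fun v h => by
            have := h.2.2.2
            rw [hi] at this; omega
          refine ⟨this.congr rfl rfl rfl rfl rfl, by simp⟩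
        · refine wp_mono (wp_frame (wp_event hS P hg hk hi h0 ⟨by omega, by omega⟩
            (hI'.congr rfl rfl rfl rfl rfl) (by simpa using hP''.d) (by simpa using hg'')
            (by simpa using hks) (by simp) (by simpa using o1) (by simpa using o2)
            (by simpa using o3))) ?_
          rintro s3 ⟨⟨h3, h4⟩, hF3⟩
          refine ⟨by rw [hF3.v .k rfl]; simpa using hks, h3.congr rfl rfl rfl rfl rfl, ?_⟩
          simp at h4; omega
      · have := idle fun v h => h0 h.1
        simp [wp, Test.Holds, hks, o1, h0]
        exact ⟨by omega, this.congr rfl rfl rfl rfl rfl⟩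
    · intro s'' hI' hF' ht
      refine ⟨by rw [St.tick_v, hF'.v .g rfl]; simpa using hgs, hI'.next.congr rfl rfl rfl rfl rfl, ?_⟩
      simp at ht ⊢; omega
  · intro s' hI hF ht
    refine ⟨fun g hg => ?_, ?_⟩
    · have := hI g
      rwa [if_pos hg] at this
    · simp at ht ⊢
      nlinarith

end

/-! ## The complete data structure -/

section

variable {σ : ℕ} {D : Dictionary σ} {S N : ℕ} {str : ℕ → List (Fin σ)}

/-- The result of the preprocessing. -/
structure Ready (D : Dictionary σ) (N : ℕ) (str : ℕ → List (Fin σ)) (s : St) : Prop where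
  trie : TrieOf D N str
  parsed : Parsed D s
  auto : Auto N str s
  marked : Marked D N str s
  st : ∀ x < N, s.a .ST x = start N str D.length (uNode D N str) x
  stack : StackData D.length (tIn N str D.length (uNode D N str))
    (tOut N str D.length (uNode D N str)) (s.a .OI) (s.a .VI) (s.a .BB)
  rows : ∀ g < betaStar D + 1 - alphaStar D,
    Row D.length (tIn N str D.length (uNode D N str)) (s.a .OI) (s.a .VI) (s.a .BB) (Admits D) g
      (2 * D.length) (s.a .HD) (s.a .FI) (s.a .LK) (s.a .ET) (s.a .EH)

theorem Auto.congr {s s' : St} (h : Auto N str s) (h1 : s'.a .G = s.a .G) (h2 : s'.a .F = s.a .F)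
    (h3 : s'.a .DL = s.a .DL) (h4 : s'.a .ID = s.a .ID) : Auto N str s' := by
  obtain ⟨a, b, c⟩ := h
  exact ⟨by rwa [h1], by rwa [h2], by rwa [h3, h4]⟩

theorem Marked.congr {s s' : St} (h : Marked D N str s) (h1 : s'.a .RK = s.a .RK)
    (h2 : s'.a .WT = s.a .WT) (h3 : s'.a .VI = s.a .VI) (h4 : s'.a .ID = s.a .ID) :
    Marked D N str s' := by
  obtain ⟨a, b, c, d, e, f⟩ := h
  exact ⟨by rwa [h1], by rwa [h2], by rwa [h3], by rwa [h3], by rwa [h3, h4], by rwa [h4]⟩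

theorem Parsed.congr {s s' : St} (h : Parsed D s) (ha : ∀ j, j ≠ .RG → s'.a j = s.a j)
    (h1 : s'.v .d = s.v .d) (h2 : s'.v .al = s.v .al) (h3 : s'.v .rr = s.v .rr)
    (h4 : s'.v .ds = s.v .ds) : Parsed D s' := by
  obtain ⟨a, b, c, d, e, f, g, h, i⟩ := h
  exact ⟨by rwa [ha _ (by decide)], by rwa [h1], by rwa [ha _ (by decide)],
    by rwa [ha _ (by decide)], by rwa [ha _ (by decide)], by rwa [ha _ (by decide)], by rwa [h2],
    by rwa [h3], by rwa [h4]⟩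

theorem Ready.congr {s s' : St} (h : Ready D N str s) (ha : ∀ j, j ≠ .RG → s'.a j = s.a j)
    (h1 : s'.v .d = s.v .d) (h2 : s'.v .al = s.v .al) (h3 : s'.v .rr = s.v .rr)
    (h4 : s'.v .ds = s.v .ds) : Ready D N str s' := by
  obtain ⟨a, b, c, d, e, f, g⟩ := h
  refine ⟨a, b.congr ha h1 h2 h3 h4, c.congr ?_ ?_ ?_ ?_, d.congr ?_ ?_ ?_ ?_, ?_, ?_, ?_⟩
  iterate 8 exact ha _ (by decide)
  · rwa [ha _ (by decide)]
  · rwa [ha .OI (by decide), ha .VI (by decide), ha .BB (by decide)]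
  · rwa [ha .OI (by decide), ha .VI (by decide), ha .BB (by decide), ha .HD (by decide),
      ha .FI (by decide), ha .LK (by decide), ha .ET (by decide), ha .EH (by decide)]

/-- An array that a phase expects to be `0` is untouched by the phases before it, so the initial
memory replaces initialization. Only the automaton brings in the factor `σ`, and only the stacks the
product of `d` and the number of gap lengths. -/
theorem wp_build (hS : Big D S) (hD : D ≠ []) {s : St} (hi : ∀ a, s.a .inp a = inF D a)
    (hd : s.v .d = D.length) (h0 : ∀ j, j ≠ .inp → ∀ a, s.a j a = 0) :
    wp S (Algo.build σ) (fun s' => (∃ N str, Ready D N str s') ∧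
      s'.t ≤ s.t + (300 + 20 * σ) * (size D + D.length * (betaStar D - alphaStar D))) s := by
  have h2 := two_mul_length_le (D := D)
  have hα := alphaStar_le_betaStar hD
  have hd1 : 0 < D.length := List.length_pos_iff.2 hD
  refine wp_seq (wp_parse hS hD hi hd) ?_
  rintro s1 ⟨hP, t1⟩ F1
  refine wp_seq (wp_trie hS hP (fun a => by rw [F1.a .G rfl, h0 _ (by decide)])
    (fun a => by rw [F1.a .CU rfl, h0 _ (by decide)])) ?_
  rintro s2 ⟨⟨str, hB⟩, t2⟩ F2
  have hP2 := hP.frame F2 rfl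
  have T := hB.trieOf
  have z2 : ∀ j, (Algo.parse.ma j || (Algo.trie σ).ma j) = false → j ≠ .inp →
      ∀ a, s2.a j a = 0 := fun j hj hj' a => by
    rw [Bool.or_eq_false_iff] at hj
    rw [F2.a j hj.2, F1.a j hj.1, h0 j hj']
  refine wp_seq (wp_mark hS hP2 hB (z2 _ rfl (by decide)) (z2 _ rfl (by decide))) ?_
  obtain ⟨N, hN⟩ : ∃ N, s2.v .nn = N := ⟨_, rfl⟩
  rw [hN] at T ⊢
  have hcu := fun i (hi : i < D.length) => hB.cu_even hi
  have htab := hB.tab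
  rw [hN] at hcu htab
  rintro s3 ⟨hM, t3⟩ F3
  refine wp_seq (wp_automaton hS T (by rw [F3.v .nn rfl, hN]) (by rwa [F3.a .G rfl])
    (by rw [F3.a .F rfl]; exact z2 _ rfl (by decide) _)
    (by rw [F3.a .DL rfl]; exact z2 _ rfl (by decide))) ?_
  rintro s4 ⟨hA, t4⟩ F4
  have wt4 : ∀ x, s4.a .WT x = wt D.length (uNode D N str) x := by
    rw [F4.a .WT rfl]; exact hM.wt
  have nn4 : s4.v .nn = N := by rw [F4.v .nn rfl, F3.v .nn rfl, hN]
  refine wp_seq (wp_sizes hS T nn4 hA.fail wt4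
    (by rw [F4.a .SZ rfl, F3.a .SZ rfl]; exact z2 _ rfl (by decide))) ?_
  rintro s5 ⟨sz5, t5⟩ F5
  refine wp_seq (wp_starts hS T (by rw [F5.v .nn rfl, nn4]) (by rw [F5.a .F rfl]; exact hA.fail)
    (by rw [F5.a .WT rfl]; exact wt4) sz5
    (by rw [F5.a .ST rfl, F4.a .ST rfl, F3.a .ST rfl]; exact z2 _ rfl (by decide))
    (by rw [F5.a .NX rfl, F4.a .NX rfl, F3.a .NX rfl]; exact z2 _ rfl (by decide))) ?_
  rintro s6 ⟨st6, t6⟩ F6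
  refine wp_seq (wp_ops hS T
    (by rw [F6.v .d rfl, F5.v .d rfl, F4.v .d rfl, F3.v .d rfl]; exact hP2.d)
    (by rw [F6.a .CU rfl, F5.a .CU rfl, F4.a .CU rfl, F3.a .CU rfl]; exact hcu)
    (by rw [F6.a .RK rfl, F5.a .RK rfl, F4.a .RK rfl]; exact hM.rk)
    (by rw [F6.a .SZ rfl]; exact sz5) st6
    (by rw [F6.a .OI rfl, F5.a .OI rfl, F4.a .OI rfl, F3.a .OI rfl]; exact z2 _ rfl (by decide))) ?_
  rintro s7 ⟨L, t7⟩ F7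
  have hP7 := ((((hP2.frame F3 rfl).frame F4 rfl).frame F5 rfl).frame F6 rfl).frame F7 rfl
  refine wp_seq (wp_offsets hS hP7.d L
    (by rw [F7.a .VI rfl, F6.a .VI rfl, F5.a .VI rfl, F4.a .VI rfl]; exact hM.viLt)
    (by rw [F7.a .CN rfl, F6.a .CN rfl, F5.a .CN rfl, F4.a .CN rfl, F3.a .CN rfl]
        exact z2 _ rfl (by decide))
    (by rw [F7.a .BB rfl, F6.a .BB rfl, F5.a .BB rfl, F4.a .BB rfl, F3.a .BB rfl]
        exact z2 _ rfl (by decide))) ?_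
  rintro s8 ⟨P, t8⟩ F8
  have hP8 := hP7.frame F8 rfl
  rw [← F8.a .OI rfl, ← F8.a .VI rfl] at P
  refine wp_mono (wp_frame (wp_planes hS hD P hP8 rfl rfl rfl
    (by rw [F8.a .HD rfl, F7.a .HD rfl, F6.a .HD rfl, F5.a .HD rfl, F4.a .HD rfl, F3.a .HD rfl]
        exact z2 _ rfl (by decide))
    (by rw [F8.a .FI rfl, F7.a .FI rfl, F6.a .FI rfl, F5.a .FI rfl, F4.a .FI rfl, F3.a .FI rfl]
        exact z2 _ rfl (by decide)))) ?_
  rintro s9 ⟨⟨hR, t9⟩, F9⟩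
  refine ⟨⟨N, str, T, hP8.frame F9 rfl, ?_, ?_, ?_, ?_, ?_⟩, ?_⟩
  · refine hA.congr ?_ ?_ ?_ ?_
    · rw [F9.a .G rfl, F8.a .G rfl, F7.a .G rfl, F6.a .G rfl, F5.a .G rfl]
    · rw [F9.a .F rfl, F8.a .F rfl, F7.a .F rfl, F6.a .F rfl, F5.a .F rfl]
    · rw [F9.a .DL rfl, F8.a .DL rfl, F7.a .DL rfl, F6.a .DL rfl, F5.a .DL rfl]
    · rw [F9.a .ID rfl, F8.a .ID rfl, F7.a .ID rfl, F6.a .ID rfl, F5.a .ID rfl]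
  · refine hM.congr ?_ ?_ ?_ ?_
    · rw [F9.a .RK rfl, F8.a .RK rfl, F7.a .RK rfl, F6.a .RK rfl, F5.a .RK rfl, F4.a .RK rfl]
    · rw [F9.a .WT rfl, F8.a .WT rfl, F7.a .WT rfl, F6.a .WT rfl, F5.a .WT rfl, F4.a .WT rfl]
    · rw [F9.a .VI rfl, F8.a .VI rfl, F7.a .VI rfl, F6.a .VI rfl, F5.a .VI rfl, F4.a .VI rfl]
    · rw [F9.a .ID rfl, F8.a .ID rfl, F7.a .ID rfl, F6.a .ID rfl, F5.a .ID rfl, F4.a .ID rfl]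
  · rw [F9.a .ST rfl, F8.a .ST rfl, F7.a .ST rfl]; exact st6
  · rw [F9.a .OI rfl, F9.a .VI rfl, F9.a .BB rfl]; exact P
  · rw [F9.a .OI rfl, F9.a .VI rfl, F9.a .BB rfl]; exact hR
  · have hb := T.bound
    have e : betaStar D + 1 - alphaStar D = betaStar D - alphaStar D + 1 := by omega
    rw [e] at t9
    have e2 : N * (7 * σ + 7) ≤ (1 + size D) * (7 * σ + 7) := Nat.mul_le_mul_right _ hb
    have e3 : betaStar D - alphaStar D ≤ D.length * (betaStar D - alphaStar D) :=
      Nat.le_mul_of_pos_left _ hd1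
    have e4 : 1 + size D ≤ 2 * size D := by omega
    have e5 : (1 + size D) * (7 * σ + 7) ≤ 2 * size D * (7 * σ + 7) := Nat.mul_le_mul_right _ e4
    have e6 : s9.t ≤ s.t + 200 * size D + 2 * size D * (7 * σ + 7) +
        (betaStar D - alphaStar D + 1) * (4 + 30 * D.length) := by omega
    refine e6.trans ?_
    nlinarith [Nat.zero_le (σ * (D.length * (betaStar D - alphaStar D))), Nat.zero_le (σ * size D)]

/-! ## The chain of second subpatterns that end at the current position -/

/-- The marked nodes on the path of failure links from `x`. -/
noncomputable def links (N : ℕ) (str : ℕ → List (Fin σ)) (m : ℕ → ℕ) (x : ℕ) : List ℕ :=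
  (if m x = 0 then [] else [x]) ++
    if _h : failLink N str x < x then links N str m (failLink N str x) else []
termination_by x

/-- This matches the path of failure links, on which the proofs are done, with the shortcuts that
the program follows. -/
theorem links_eq (T : IsTrie N str) {m : ℕ → ℕ} (h0 : m 0 = 0) {x : ℕ} (hx : x < N) :
    links N str m x = if dictLink N str m x = 0 then [] else
      dictLink N str m x :: links N str m (failLink N str (dictLink N str m x)) := by
  induction x using Nat.strong_induction_on with
  | _ x ih =>
    rw [links, dictLink]
    by_cases hm : m x = 0
    · simp only [hm, if_true, List.nil_append]
      by_cases h : failLink N str x < x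
      · rw [dif_pos h, dif_pos h, ih _ h (T.failLink_lt' x)]
      · rw [dif_neg h, dif_neg h, if_pos rfl]
    · have hx0 : x ≠ 0 := fun h => hm (h ▸ h0)
      simp only [hm, if_false, hx0]
      rw [dif_pos (T.failLink_lt hx hx0)]
      rfl

theorem mem_links (T : IsTrie N str) {m : ℕ → ℕ} (h0 : m 0 = 0) {x : ℕ} (hx : x < N) (y : ℕ) :
    y ∈ links N str m x ↔ y < N ∧ m y ≠ 0 ∧ str y <:+ str x := by
  induction x using Nat.strong_induction_on with
  | _ x ih =>
    rw [links, List.mem_append]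
    by_cases hx0 : x = 0
    · subst hx0
      simp only [h0, if_true, T.failLink_zero, lt_irrefl, dif_neg, not_false_eq_true,
        List.not_mem_nil, or_self, false_iff, not_and, T.zero, List.suffix_nil]
      intro hy hm h
      exact hm (T.inj y hy 0 T.pos (by rw [h, T.zero]) ▸ h0)
    · rw [dif_pos (T.failLink_lt hx hx0), ih _ (T.failLink_lt hx hx0) (T.failLink_lt' x)]
      constructor
      · rintro (h | ⟨h1, h2, h3⟩)
        · by_cases hm : m x = 0
          · simp [hm] at h
          · simp only [hm, if_false, List.mem_singleton] at h
            exact ⟨h ▸ hx, h ▸ hm, by rw [h]⟩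
        · exact ⟨h1, h2, h3.trans (T.suffix_failLink x hx)⟩
      · rintro ⟨h1, h2, h3⟩
        rcases (T.suffix_iff_failLink h1 hx hx0).1 h3 with h | h
        · left; subst h; simp [h2]
        · exact Or.inr ⟨h1, h2, h⟩

theorem links_pairwise (T : IsTrie N str) {m : ℕ → ℕ} (h0 : m 0 = 0) {x : ℕ} (hx : x < N) :
    (links N str m x).Pairwise fun y z => str z <:+ str y ∧ str z ≠ str y := by
  induction x using Nat.strong_induction_on with
  | _ x ih =>
    rw [links]
    by_cases hx0 : x = 0
    · subst hx0; simp [h0, T.failLink_zero]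
    · have hf := T.failLink_lt hx hx0
      rw [dif_pos hf, List.pairwise_append]
      refine ⟨by split_ifs <;> simp, ih _ hf (T.failLink_lt' x), fun y hy z hz => ?_⟩
      have hyx : y = x := by
        split_ifs at hy
        · simp at hy
        · simpa using hy
      subst hyx
      have hz' := (mem_links T h0 (T.failLink_lt' y) z).1 hz
      refine ⟨hz'.2.2.trans (T.suffix_failLink y hx), fun h => ?_⟩
      have h1 := hz'.2.2.length_le
      have h2 := T.length_failLink_lt hx hx0
      rw [h] at h1; omega

end

/-! ## Queries -/

section

variable {σ : ℕ} {D : Dictionary σ} {S N : ℕ} {str : ℕ → List (Fin σ)}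

/-- The time at which the patterns are active whose first subpattern ends at node `x`. -/
noncomputable def nodeTime (D : Dictionary σ) (N : ℕ) (str : ℕ → List (Fin σ)) (x : ℕ) : ℕ :=
  start N str D.length (uNode D N str) x + wt D.length (uNode D N str) x

theorem TrieOf.nodeTime_le (T : TrieOf D N str) {x : ℕ} (hx : x < N) :
    nodeTime D N str x ≤ 2 * D.length := by
  have h1 := T.start_le (d := D.length) (U := uNode D N str) (fun i _ => T.uLt i) hx
  have h2 := T.wt_le_sz (d := D.length) (U := uNode D N str) (fun i _ => T.uLt i) hx
  unfold nodeTime; omega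

/-- The number of steps of a binary search. -/
def searchSteps (D : Dictionary σ) : ℕ := Nat.log 2 (2 * D.length) + 1

section row

variable {a b oi vi bb : ℕ → ℕ} {g v τ : ℕ} {HD FI LK ET EH : ℕ → ℕ}

/-- Event number `e` of a stack is its operation with exactly `e` predecessors. The comparison with
`τ` is therefore monotone in `e`, and it changes at the value `cnt τ` that the binary search is to
find. -/
theorem Row.lt_iff (R : Row D.length a oi vi bb (Admits D) g (2 * D.length) HD FI LK ET EH)
    (hv : v < D.length) {e : ℕ} (he : e < cnt oi (selGap vi (Admits D) g v) (2 * D.length)) :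
    ET (g * (2 * D.length) + bb v + e) < τ ↔ e < cnt oi (selGap vi (Admits D) g v) τ := by
  obtain ⟨l, hl, ho, rfl⟩ := exists_op he
  rw [(R.ev v hv l hl ho).1]
  constructor
  · exact fun h => cnt_lt_cnt ho h
  · intro h
    by_contra h1
    have := cnt_mono (oi := oi) (sel := selGap vi (Admits D) g v) (not_lt.1 h1)
    omega

/-- The last event before `τ` recorded the head of the stack, and the stack has not changed since.
-/
theorem Row.head (R : Row D.length a oi vi bb (Admits D) g (2 * D.length) HD FI LK ET EH)
    (hv : v < D.length) (hτ : τ ≤ 2 * D.length)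
    (h : 0 < cnt oi (selGap vi (Admits D) g v) τ) :
    EH (g * (2 * D.length) + bb v + cnt oi (selGap vi (Admits D) g v) τ - 1) =
      ptr (stk oi (selGap vi (Admits D) g v) τ) := by
  obtain ⟨l, hl, ho, e⟩ := exists_op (show cnt oi (selGap vi (Admits D) g v) τ - 1 <
    cnt oi (selGap vi (Admits D) g v) τ by omega)
  have h1 := (R.ev v hv l (by omega) ho).2
  rw [Nat.add_sub_assoc h, ← e, h1]
  congr 1
  refine stk_eq_of_cnt_eq hl ?_
  rw [cnt_succ, if_pos ho]; omega

theorem wp_search (hS : Big D S)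
    (R : Row D.length a oi vi bb (Admits D) g (2 * D.length) HD FI LK ET EH)
    (hv : v < D.length) (hτ : τ ≤ 2 * D.length)
    (hp : g * (2 * D.length) + bb v + cnt oi (selGap vi (Admits D) g v) (2 * D.length) ≤ S)
    {s : St} (het : s.a .ET = ET) (hb : s.v .b = g * (2 * D.length) + bb v) (htau : s.v .tau = τ)
    (hlo : s.v .lo = 0) (hhi : s.v .hi = cnt oi (selGap vi (Admits D) g v) (2 * D.length)) :
    wp S Algo.search (fun s' => s'.v .lo = cnt oi (selGap vi (Admits D) g v) τ ∧
      s'.t ≤ s.t + 1 + 4 * searchSteps D) s := by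
  have hS1 := hS.size
  have h2 := two_mul_length_le (D := D)
  set n := cnt oi (selGap vi (Admits D) g v) (2 * D.length) with hn
  set c := cnt oi (selGap vi (Admits D) g v) τ with hc
  have hcn : c ≤ n := cnt_mono hτ
  have hn2 : n ≤ 2 * D.length := cnt_le _
  -- `r` bounds the number of rounds left: the length of the interval is below `2 ^ r`, every round
  -- halves it, and a round takes four steps.
  refine ⟨fun s' => s'.v .lo ≤ c ∧ c ≤ s'.v .hi ∧ s'.v .hi ≤ n ∧ s'.a .ET = ET ∧
    s'.v .b = g * (2 * D.length) + bb v ∧ s'.v .tau = τ ∧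
    ∃ r, s'.v .hi - s'.v .lo < 2 ^ r ∧ s'.t + 4 * r ≤ s.t + 4 * searchSteps D,
    fun s' => s'.v .hi - s'.v .lo, ⟨by omega, by omega, by omega, het, hb, htau, searchSteps D, ?_,
      le_rfl⟩, ?_⟩
  · rw [hlo, hhi]
    have := Nat.lt_pow_succ_log_self (b := 2) (by omega) (2 * D.length)
    unfold searchSteps
    omega
  · rintro s' ⟨i1, i2, i3, i4, i5, i6, r, i7, i8⟩
    refine ⟨by simp, by simp, fun hlt => ?_, fun hlt => ⟨?_, ?_⟩⟩
    · simp only [Test.Holds, E.eval_var] at hlt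
      obtain ⟨mid, hmid⟩ : ∃ mid, (s'.v .lo + s'.v .hi) / 2 = mid := ⟨_, rfl⟩
      obtain ⟨r, rfl⟩ : ∃ r', r = r' + 1 := by
        cases r with
        | zero => simp at i7; omega
        | succ r => exact ⟨r, rfl⟩
      have hiff := R.lt_iff (τ := τ) hv (e := mid) (by omega)
      rw [← hc] at hiff
      rw [pow_succ] at i7
      simp only [wp, E.ok_var, E.ok_add, E.ok_div, E.ok_two, E.ok_rd, E.ok_one, E.eval_var,
        E.eval_add, E.eval_div, E.eval_two, E.eval_rd, E.eval_one, St.tick_v, St.tick_a,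
        St.setV_v_self, St.setV_a, St.setV_v_ne, ne_eq, reduceCtorEq, not_false_eq_true, hmid,
        Test.Holds, i4, i5, i6, true_and, and_true, hiff, St.tick_t, St.setV_t]
      refine ⟨by omega, by omega, fun hm => ⟨by omega, ⟨by omega, by omega, by omega, r, by omega,
        by omega⟩, by omega⟩, fun hm => ⟨by omega, ⟨by omega, by omega, by omega, r, by omega,
        by omega⟩, by omega⟩⟩
    · simp only [Test.Holds, E.eval_var] at hlt
      simp only [St.tick_v]; omega
    · simp only [St.tick_t]; omega

theorem wp_reportList (hS : Big D S) (P : StackData D.length a b oi vi bb)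
    (hg : g < betaStar D + 1 - alphaStar D)
    (R : Row D.length a oi vi bb (Admits D) g (2 * D.length) HD FI LK ET EH)
    (hτ : τ ≤ 2 * D.length) {s : St} (hlk : s.a .LK = LK)
    (hgs : s.v .g = g) (hds : s.v .d = D.length) (hal : s.v .al = alphaStar D)
    (hhd : s.v .hd = ptr (stk oi (selGap vi (Admits D) g v) τ)) :
    wp S Algo.reportList (fun s' => s'.out = s.out ++
      (stk oi (selGap vi (Admits D) g v) τ).map (fun i => (i, g + alphaStar D)) ∧
      s'.t ≤ s.t + 1 + 3 * (stk oi (selGap vi (Admits D) g v) τ).length) s := by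
  have hS1 := hS.size
  have hS2 := hS.gaps
  have h2 := two_mul_length_le (D := D)
  obtain ⟨hm, -, hl⟩ := P.stk_spec (sel := selGap vi (Admits D) g v) τ hτ
  set st := stk oi (selGap vi (Admits D) g v) τ with hst
  -- The stack is split into the reported part and the rest. The elapsed time is at most `3 *
  -- dn.length`, so it can serve as the measure.
  refine ⟨fun s' => ∃ dn rest, dn ++ rest = st ∧ s'.v .hd = ptr rest ∧
    s'.out = s.out ++ dn.map (fun i => (i, g + alphaStar D)) ∧ s'.t ≤ s.t + 3 * dn.length ∧
    s'.a .LK = LK ∧ s'.v .g = g ∧ s'.v .d = D.length ∧ s'.v .al = alphaStar D,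
    fun s' => s.t + 3 * st.length + 1 - s'.t,
    ⟨[], st, rfl, hhd, by simp, by simp, hlk, hgs, hds, hal⟩, ?_⟩
  rintro s' ⟨dn, rest, e1, e2, e3, e4, e5, e6, e7, e8⟩
  refine ⟨by simp, by simp, fun hlt => ?_, fun hlt => ?_⟩
  · simp only [Test.Holds, E.eval_var, E.eval_zero, e2] at hlt
    cases rest with
    | nil => simp [ptr] at hlt
    | cons i l =>
      have hi := (hm i).1 (by rw [← e1]; simp)
      have hll := hl i l ⟨dn, e1⟩
      have hd1 : 0 < D.length := by omega
      have hα := alphaStar_le_betaStar (D := D) (List.ne_nil_of_length_pos hd1)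
      have e : betaStar D + 1 - alphaStar D = betaStar D - alphaStar D + 1 := by omega
      have hcell : g * D.length + i < S := by
        have := mul_add_lt hi.1 hg
        rw [mul_comm (_ - _), e] at this
        omega
      have hLK : LK (g * D.length + i) = ptr l := by
        rw [R.lk i hi.1 (by have := hi.2.2.1; omega) hi.2.1.2, hi.2.1.1, ← hll]
      have hle : ptr l ≤ D.length := ptr_le fun j hj => ((hm j).1 (by rw [← e1]; simp [hj])).1
      have hlen := congrArg List.length e1
      simp only [List.length_append, List.length_cons] at hlen
      have hptr : ptr (i :: l) = i + 1 := rfl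
      simp [wp, e2, hptr, e5, e6, e7, e8, hLK]
      refine ⟨hcell, by omega, ⟨dn ++ [i], l, by simpa using e1, rfl, by simp [e3], ?_⟩, by omega⟩
      simp; omega
  · simp only [Test.Holds, E.eval_var, E.eval_zero, e2] at hlt
    cases rest with
    | nil =>
      rw [List.append_nil] at e1
      subst e1
      exact ⟨e3, by simp; omega⟩
    | cons i l => simp [ptr] at hlt

end row

/-- The patterns found for the second subpattern number `v` and the gap length number `g`. -/
noncomputable def hits (D : Dictionary σ) (N : ℕ) (str : ℕ → List (Fin σ)) (oi vi : ℕ → ℕ)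
    (W : List (Fin σ)) (v g : ℕ) : List (ℕ × ℕ) :=
  (stk oi (selGap vi (Admits D) g v) (nodeTime D N str
    (state N str (W.take (W.length - ((sndF D v).length + (g + alphaStar D))))))).map
      fun i => (i, g + alphaStar D)

/-- The ring buffer holds the states of the last prefixes of `W`. -/
structure Ring (D : Dictionary σ) (N : ℕ) (str : ℕ → List (Fin σ)) (W : List (Fin σ)) (s : St) :
    Prop where
  lt : s.v .cur < betaStar D + maxSnd D + 1
  get : ∀ j < betaStar D + maxSnd D + 1,
    s.a .RG ((s.v .cur + (betaStar D + maxSnd D + 1) - j) % (betaStar D + maxSnd D + 1)) =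
      state N str (W.take (W.length - j))

theorem Ring.congr {W : List (Fin σ)} {s s' : St} (h : Ring D N str W s)
    (h1 : s'.v .cur = s.v .cur) (h2 : s'.a .RG = s.a .RG) : Ring D N str W s' := by
  obtain ⟨a, b⟩ := h
  exact ⟨by rwa [h1], by rwa [h1, h2]⟩

theorem wp_reportGap (hS : Big D S) {s : St} (hR : Ready D N str s) {W : List (Fin σ)}
    (hW : Ring D N str W s) {v g : ℕ} (hv : v < D.length) (hg : g < betaStar D + 1 - alphaStar D)
    (hvs : s.v .vid = v) (hgs : s.v .g = g) :
    wp S Algo.reportGap (fun s' => s'.out = s.out ++ hits D N str (s.a .OI) (s.a .VI) W v g ∧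
      s'.t ≤ s.t + 9 + 4 * searchSteps D +
        3 * (hits D N str (s.a .OI) (s.a .VI) W v g).length) s := by
  have hS1 := hS.size
  have hS2 := hS.gaps
  have hS3 := hS.ring
  have h2 := two_mul_length_le (D := D)
  have hD : D ≠ [] := List.ne_nil_of_length_pos (by omega)
  have hM := maxSnd_le_size hD
  have hα := alphaStar_le_betaStar hD
  have e : betaStar D + 1 - alphaStar D = betaStar D - alphaStar D + 1 := by omega
  have hln := hR.parsed.ln (2 * v + 1) (by omega)
  rw [subF_odd] at hln
  have hmx := le_maxSnd hv
  have hrow := hR.rows g hg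
  have P := hR.stack
  obtain ⟨x, hx⟩ : ∃ x, state N str
    (W.take (W.length - ((sndF D v).length + (g + alphaStar D)))) = x := ⟨_, rfl⟩
  have hxN : x < N := hx ▸ hR.trie.state_lt _
  have hbd := hR.trie.bound
  -- The distance back is at most `M + β*`, so the state is still in the ring.
  have hget := hW.get ((sndF D v).length + (g + alphaStar D)) (by omega)
  rw [hx] at hget
  have hmod := Nat.mod_lt (s.v .cur + (betaStar D + maxSnd D + 1) -
    ((sndF D v).length + (g + alphaStar D))) (by omega : betaStar D + maxSnd D + 1 > 0)
  have hτ := hR.trie.nodeTime_le hxN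
  have hτe : s.a .ST x + s.a .WT x = nodeTime D N str x := by
    rw [hR.st x hxN, hR.marked.wt]; rfl
  have hcell : g * D.length + v < S := by
    have := mul_add_lt hv hg
    rw [mul_comm (_ - _), e] at this
    omega
  have hbb := P.cnt_selGap_le (adm := Admits D) g hv le_rfl
  have hbb2 := P.bb_le (show v + 1 ≤ D.length from hv)
  have hp : g * (2 * D.length) + s.a .BB v +
      cnt (s.a .OI) (selGap (s.a .VI) (Admits D) g v) (2 * D.length) ≤ S := by
    have : (g + 1) * (2 * D.length) ≤ (betaStar D - alphaStar D + 1) * (2 * D.length) :=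
      Nat.mul_le_mul_right _ (by omega)
    have h3 : (betaStar D - alphaStar D + 1) * (2 * D.length) =
      2 * (D.length * (betaStar D - alphaStar D + 1)) := by ring
    rw [add_mul] at this
    omega
  have hcn := cnt_le (oi := s.a .OI) (sel := selGap (s.a .VI) (Admits D) g v) (2 * D.length)
  unfold hits
  rw [hx, List.length_map]
  obtain ⟨τ, hτd⟩ : ∃ τ, nodeTime D N str x = τ := ⟨_, rfl⟩
  rw [hτd] at hτ hτe ⊢
  have hwt := wt_le D.length (uNode D N str) x
  rw [← hR.marked.wt] at hwt
  simp only [Algo.reportGap]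
  simp only [wp.eq_5, wp.eq_1, E.ok_var, E.ok_add, E.ok_sub, E.ok_mul, E.ok_mod, E.ok_rd, E.ok_one,
    E.ok_two, E.ok_zero,
    E.eval_var, E.eval_add, E.eval_sub, E.eval_mul, E.eval_mod, E.eval_rd, E.eval_one, E.eval_two,
    E.eval_zero, St.tick_v, St.tick_a, St.setV_v_self, St.setV_a, St.setV_v_ne, ne_eq, reduceCtorEq,
    not_false_eq_true, hvs, hgs, hln, hR.parsed.al, hR.parsed.rr, hR.parsed.d, hget, true_and,
    and_true, hτe]
  refine ⟨⟨by omega, by omega⟩, by omega, by omega, by omega, by omega, by omega, by omega,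
    by omega, by rw [hrow.fi v hv]; omega, ?_⟩
  refine wp_mono (wp_frame (wp_search hS hrow hv hτ hp (by simp) (by simp) (by simp) (by simp)
    (by simp [hrow.fi v hv]))) ?_
  rintro s1 ⟨⟨hlo, ht1⟩, F1⟩
  have eo : s1.out = s.out := by rw [F1.out rfl]; simp
  have et : s1.t ≤ s.t + 6 + 4 * searchSteps D := by simp at ht1; omega
  obtain ⟨st, hst⟩ : ∃ st, stk (s.a .OI) (selGap (s.a .VI) (Admits D) g v) τ = st := ⟨_, rfl⟩
  have hcτ := cnt_mono (oi := s.a .OI) (sel := selGap (s.a .VI) (Admits D) g v) hτ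
  refine ⟨by simp, by simp, fun hlt => ?_, fun hlt => ?_⟩
  · simp only [Test.Holds, E.eval_var, E.eval_zero, hlo] at hlt
    have hhead := hrow.head hv hτ hlt
    have hple := P.ptr_stk_le (sel := selGap (s.a .VI) (Admits D) g v) hτ
    have b1 : s1.v .b = g * (2 * D.length) + s.a .BB v := by rw [F1.v .b rfl]; simp
    have b2 : s1.a .EH = s.a .EH := by rw [F1.a .EH rfl]; simp
    simp only [wp.eq_5, wp.eq_1, E.ok_var, E.ok_add, E.ok_sub, E.ok_rd, E.ok_one, E.eval_var,
      E.eval_add, E.eval_sub, E.eval_rd, E.eval_one, St.tick_v, St.tick_a, b1, b2, hlo, hhead,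
      true_and, and_true]
    refine ⟨by omega, by omega, ?_⟩
    refine wp_mono (wp_reportList hS P hg hrow hτ (v := v) ?_ ?_ ?_ ?_ ?_) ?_
    · simp [F1.a .LK rfl]
    · simp [F1.v .g rfl, hgs]
    · simp [F1.v .d rfl, hR.parsed.d]
    · simp [F1.v .al rfl, hR.parsed.al]
    · simp
    · rintro s2 ⟨h3, h4⟩
      refine ⟨by rw [h3]; simp [eo], ?_⟩
      simp at h4; omega
  · simp only [Test.Holds, E.eval_var, E.eval_zero, hlo] at hlt
    -- Without an event before `τ` the stack is still the initial one.
    have hnil : stk (s.a .OI) (selGap (s.a .VI) (Admits D) g v) τ = [] := by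
      rw [← stk_eq_of_cnt_eq (Nat.zero_le τ)]
      · rfl
      · rw [Nat.le_zero.1 (not_lt.1 hlt)]; simp [cnt]
    rw [hnil]
    exact ⟨by simp [eo], by simp; omega⟩

/-- The pairs reported after reading `W`. -/
noncomputable def answer (D : Dictionary σ) (N : ℕ) (str : ℕ → List (Fin σ)) (oi vi id : ℕ → ℕ)
    (W : List (Fin σ)) (l : List ℕ) : List (ℕ × ℕ) :=
  l.flatMap fun y => (List.range (betaStar D + 1 - alphaStar D)).flatMap
    (hits D N str oi vi W (id y - 1))

theorem dictLink_le (m : ℕ → ℕ) (x : ℕ) : dictLink N str m x ≤ x := by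
  induction x using Nat.strong_induction_on with
  | _ x ih =>
    rw [dictLink]; split_ifs with h1 h2
    · exact (ih _ h2).trans h2.le
    · omega
    · exact le_rfl

theorem dictLink_mark {m : ℕ → ℕ} {x : ℕ} (h : dictLink N str m x ≠ 0) :
    m (dictLink N str m x) ≠ 0 := by
  induction x using Nat.strong_induction_on with
  | _ x ih =>
    rw [dictLink] at h ⊢; split_ifs at h ⊢ with h1 h2
    · exact ih _ h2 h
    · exact absurd rfl h
    · exact h1

theorem Marked.id_zero (T : TrieOf D N str) {s : St} (h : Marked D N str s) : s.a .ID 0 = 0 :=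
  h.idZ 0 fun _ hi => T.vNe hi

theorem Marked.exists_of_id {s : St} (h : Marked D N str s) {x : ℕ} (hx : s.a .ID x ≠ 0) :
    ∃ i < D.length, vNode D N str i = x ∧ s.a .ID x - 1 = s.a .VI i := by
  by_contra hc
  push Not at hc
  refine hx (h.idZ x fun i hi e => hc i hi e ?_)
  rw [← e, h.idV i hi]; rfl

theorem sum_length_flatMap_range {α : Type*} (f : ℕ → List α) (n : ℕ) :
    ∑ g ∈ Finset.range n, (f g).length = ((List.range n).flatMap f).length := by
  induction n with
  | zero => rfl
  | succ n ih =>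
    rw [Finset.sum_range_succ, ih, List.range_succ, List.flatMap_append, List.length_append,
      List.flatMap_singleton]

/-- The cost of one element of the chain of second subpatterns, without the reports. -/
noncomputable def linkCost (D : Dictionary σ) : ℕ :=
  5 + (betaStar D + 1 - alphaStar D) * (11 + 4 * searchSteps D)

theorem wp_reportNode (hS : Big D S) {s : St} (hR : Ready D N str s) {W : List (Fin σ)}
    (hW : Ring D N str W s) {x : ℕ} (hxs : s.v .x = x) (hx : x < N) (hm : s.a .ID x ≠ 0) :
    wp S (.asg .vid (E.rd .ID Var.x - 1);;.for .g Var.ds Algo.reportGap;;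
        .asg .x (E.rd .DL (E.rd .F Var.x)))
      (fun s' => s'.v .x = dictLink N str (s.a .ID) (failLink N str x) ∧
        s'.out = s.out ++ answer D N str (s.a .OI) (s.a .VI) (s.a .ID) W [x] ∧
        s'.t + 1 ≤ s.t + linkCost D +
          3 * (answer D N str (s.a .OI) (s.a .VI) (s.a .ID) W [x]).length) s := by
  have hS1 := hS.size
  have hS3 := hS.ring
  have hbd := hR.trie.bound
  have h2 := two_mul_length_le (D := D)
  obtain ⟨i, hi, -, hid⟩ := hR.marked.exists_of_id hm
  have hv := hR.marked.viLt i hi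
  rw [← hid] at hv
  obtain ⟨v, hve⟩ : ∃ v, s.a .ID x - 1 = v := ⟨_, rfl⟩
  have hans : answer D N str (s.a .OI) (s.a .VI) (s.a .ID) W [x] =
      (List.range (betaStar D + 1 - alphaStar D)).flatMap
        (hits D N str (s.a .OI) (s.a .VI) W v) := by
    simp [answer, hve]
  rw [hans]
  rw [hve] at hv
  refine ⟨by simp [hxs]; omega, by simp [hxs, hve]; omega, ?_⟩
  simp only [E.eval_sub, E.eval_rd, E.eval_var, E.eval_one, hxs, hve]
  set s0 := s.tick.setV .vid v with hs0
  have hR0 : Ready D N str s0 := hR.congr (fun _ _ => rfl) rfl rfl rfl rfl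
  have hW0 : Ring D N str W s0 := hW.congr rfl rfl
  refine wp_seq (R := fun s' => s'.out = s.out ++
      (List.range (betaStar D + 1 - alphaStar D)).flatMap
        (hits D N str (s.a .OI) (s.a .VI) W v) ∧
      s'.t + 2 ≤ s.t + linkCost D + 3 * ((List.range (betaStar D + 1 - alphaStar D)).flatMap
        (hits D N str (s.a .OI) (s.a .VI) W v)).length)
    (wp_for (betaStar D + 1 - alphaStar D) (fun g s' => s'.out = s.out ++
      (List.range g).flatMap (hits D N str (s.a .OI) (s.a .VI) W v))
      (fun g => 9 + 4 * searchSteps D + 3 * (hits D N str (s.a .OI) (s.a .VI) W v g).length)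
      (by omega) (by simp [hs0]) ?_ ?_ ?_) ?_
  · intro g s' _ hF
    simp [hF.v .ds rfl, hR0.parsed.ds]
  · intro g s' hg hI hgs hF
    have hR' : Ready D N str s' := hR0.congr (fun j _ => hF.a j (by cases j <;> rfl))
      (hF.v _ rfl) (hF.v _ rfl) (hF.v _ rfl) (hF.v _ rfl)
    have hW' : Ring D N str W s' := hW0.congr (hF.v _ rfl) (hF.a _ rfl)
    have hv' : s'.v .vid = v := by rw [hF.v .vid rfl]; simp [hs0]
    have a1 : s'.a .OI = s.a .OI := hF.a .OI rfl
    have a2 : s'.a .VI = s.a .VI := hF.a .VI rfl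
    refine wp_mono (wp_frame (wp_reportGap hS (s := s'.tick) (hR'.congr (fun _ _ => rfl) rfl rfl rfl rfl)
      (hW'.congr rfl rfl) hv hg hv' hgs)) ?_
    rintro s2 ⟨⟨h3, h4⟩, hF2⟩
    simp only [St.tick_a, a1, a2, St.tick_out, hI] at h3 h4
    refine ⟨by rw [hF2.v .g rfl]; exact hgs, ?_, ?_⟩
    · simp [h3, List.range_succ]
    · simp at h4; omega
  · intro s' hI hF ht
    refine ⟨hI, ?_⟩
    simp only [Finset.sum_add_distrib, Finset.sum_const, Finset.card_range, smul_eq_mul,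
      ← Finset.mul_sum] at ht
    have hsum := sum_length_flatMap_range (hits D N str (s.a .OI) (s.a .VI) W v)
      (betaStar D + 1 - alphaStar D)
    rw [hsum] at ht
    unfold linkCost
    simp [hs0, -List.length_flatMap] at ht ⊢
    nlinarith
  · rintro s1 ⟨ho, ht⟩ hF
    have a1 : s1.a .DL = s.a .DL := hF.a .DL rfl
    have a2 : s1.a .F = s.a .F := hF.a .F rfl
    have a3 : s1.v .x = x := by rw [hF.v .x rfl]; simpa [hs0] using hxs
    have hfl := hR.trie.failLink_lt' x
    have hdl := dictLink_lt hR.trie.toIsTrie (s.a .ID) hfl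
    refine ⟨by simp [a2, a3, hR.auto.fail x hx]; omega, ?_, ?_⟩
    · simp [a1, a2, a3, hR.auto.fail x hx, hR.auto.link _ hfl]; omega
    · simp [a1, a2, a3, hR.auto.fail x hx, hR.auto.link _ hfl, ho, -List.length_flatMap]; omega

/-- When the position advances, offset `j + 1` denotes the cell that had offset `j`. The only
overwritten cell is the one that held the oldest state. -/
theorem Ring.push {W : List (Fin σ)} {s s' : St} (h : Ring D N str W s) {c : Fin σ}
    (h1 : s'.v .cur = (s.v .cur + 1) % (betaStar D + maxSnd D + 1))
    (h2 : s'.a .RG = Function.update (s.a .RG) (s'.v .cur) (state N str (W ++ [c]))) :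
    Ring D N str (W ++ [c]) s' := by
  obtain ⟨R, hR⟩ : ∃ R, betaStar D + maxSnd D + 1 = R := ⟨_, rfl⟩
  obtain ⟨hlt, hget⟩ := h
  have hpos : 0 < R := by omega
  rw [hR] at h1 hlt hget
  have hlt' : s'.v .cur < R := by rw [h1]; exact Nat.mod_lt _ hpos
  refine ⟨by rwa [hR], ?_⟩
  rw [hR]
  intro j hj
  rw [h2]
  cases j with
  | zero =>
    rw [Nat.sub_zero, Nat.add_mod_right, Nat.mod_eq_of_lt hlt', Function.update_self,
      List.take_of_length_le (by simp)]
  | succ j =>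
    have e1 : (s'.v .cur + R - (j + 1)) % R = (s.v .cur + R - j) % R := by
      rw [h1]
      rcases Nat.lt_or_eq_of_le (show s.v .cur + 1 ≤ R from hlt) with h | h
      · rw [Nat.mod_eq_of_lt h]; congr 1; omega
      · rw [h, Nat.mod_self, show s.v .cur + R - j = (0 + R - (j + 1)) + R by omega,
          Nat.add_mod_right]
    have e2 : (s'.v .cur + R - (j + 1)) % R ≠ s'.v .cur := by
      intro h
      rcases Nat.lt_or_ge (s'.v .cur) (j + 1) with h3 | h3
      · rw [Nat.mod_eq_of_lt (by omega)] at h; omega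
      · rw [show s'.v .cur + R - (j + 1) = (s'.v .cur - (j + 1)) + R by omega, Nat.add_mod_right,
          Nat.mod_eq_of_lt (by omega)] at h
        omega
    rw [Function.update_of_ne e2, e1, hget j (by omega)]
    congr 1
    rw [List.length_append, List.length_singleton, show W.length + 1 - (j + 1) = W.length - j by omega,
      List.take_append_of_le_length (by omega)]

theorem wp_query (hS : Big D S) (hD : D ≠ []) {s : St} (hR : Ready D N str s) {W : List (Fin σ)}
    (hW : Ring D N str W s) (hq : s.v .q = state N str W) {c : Fin σ} (hc : s.v .ch = c) :
    wp S (Algo.query σ) (fun s' => Ready D N str s' ∧ Ring D N str (W ++ [c]) s' ∧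
      s'.v .q = state N str (W ++ [c]) ∧
      ∃ l, l = links N str (s.a .ID) (state N str (W ++ [c])) ∧
      s'.out = s.out ++ answer D N str (s.a .OI) (s.a .VI) (s.a .ID) (W ++ [c]) l ∧
      s'.t ≤ s.t + 5 + l.length * linkCost D +
        3 * (answer D N str (s.a .OI) (s.a .VI) (s.a .ID) (W ++ [c]) l).length) s := by
  have hS1 := hS.size
  have hS2 := hS.alph
  have hS3 := hS.ring
  have hbd := hR.trie.bound
  have h2 := two_mul_length_le (D := D)
  have T := hR.trie
  have hqN := T.state_lt W
  have hq'N := T.state_lt (W ++ [c])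
  have hgo := hR.auto.goto _ hqN c
  rw [← T.state_append] at hgo
  obtain ⟨q', hq'⟩ : ∃ q', state N str (W ++ [c]) = q' := ⟨_, rfl⟩
  have hid0 := hR.marked.id_zero T
  have hcell : state N str W * σ + c < S := by
    have h1 := cell_lt c hqN
    have h2 : N * σ ≤ (1 + size D) * σ := Nat.mul_le_mul_right _ hbd
    nlinarith
  obtain ⟨cu, hcu⟩ : ∃ cu, (s.v .cur + 1) % (betaStar D + maxSnd D + 1) = cu := ⟨_, rfl⟩
  have hculd : cu < betaStar D + maxSnd D + 1 := hcu ▸ Nat.mod_lt _ (by omega)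
  have hcuS : betaStar D + maxSnd D + 1 < S := by
    have := maxSnd_le_size hD
    omega
  set s0 := ((((s.tick.setV .q q').tick.setV .cur cu).tick.setA .RG cu q').tick.setV .x
    (dictLink N str (s.a .ID) q')) with hs0
  have hR0 : Ready D N str s0 := hR.congr (fun j hj => by simp [hs0, hj]) rfl rfl rfl rfl
  have hW0 : Ring D N str (W ++ [c]) s0 := hW.push (by simp [hs0, hcu]) (by simp [hs0, hq'])
  rw [hq'] at hgo hq'N ⊢
  have hdl := hR.auto.link q' hq'N
  have hdlN := dictLink_lt T.toIsTrie (s.a .ID) hq'N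
  simp only [Algo.query]
  simp only [wp.eq_5, wp.eq_1, wp.eq_2, E.ok_var, E.ok_add, E.ok_mul, E.ok_mod, E.ok_rd, E.ok_one,
    E.ok_num, E.eval_num,
    E.eval_var, E.eval_add, E.eval_mul, E.eval_mod, E.eval_rd, E.eval_one,
    St.tick_v, St.tick_a, St.setV_v_self, St.setV_a, St.setV_v_ne, ne_eq, reduceCtorEq,
    not_false_eq_true, hq, hc, hgo, hR.parsed.rr, hcu, true_and,
    and_true, St.setA_v, St.setA_a_ne, hdl]
  refine ⟨hcell, by omega, by omega, by omega, by omega, by omega, by omega, ?_⟩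
  set F := answer D N str (s.a .OI) (s.a .VI) (s.a .ID) (W ++ [c]) with hFd
  -- In the invariant, the pairs reported so far followed by those of the remaining links make up
  -- the whole answer, and time spent plus time still due is bounded in the same way.
  refine ⟨fun s' => Ready D N str s' ∧ Ring D N str (W ++ [c]) s' ∧ s'.v .q = q' ∧
    s'.a .OI = s.a .OI ∧ s'.a .VI = s.a .VI ∧ s'.a .ID = s.a .ID ∧
    ∃ z < N, s'.v .x = dictLink N str (s.a .ID) z ∧
      s'.out ++ F (links N str (s.a .ID) z) = s.out ++ F (links N str (s.a .ID) q') ∧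
      s'.t + (links N str (s.a .ID) z).length * linkCost D +
        3 * (F (links N str (s.a .ID) z)).length ≤ s.t + 4 +
          (links N str (s.a .ID) q').length * linkCost D +
            3 * (F (links N str (s.a .ID) q')).length, fun s' => s'.v .x, ?_, ?_⟩
  · exact ⟨hR0, hW0, by simp, rfl, rfl, rfl, q', hq'N, by simp, rfl, by simp⟩
  · rintro s' ⟨r1, r2, r3, r4, r5, r6, z, hz, r7, r8, r9⟩
    have hlk := links_eq T.toIsTrie hid0 hz
    refine ⟨by simp, by simp, fun hlt => ?_, fun hlt => ?_⟩
    · simp only [Test.Holds, E.eval_var, E.eval_zero, r7] at hlt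
      rw [if_neg hlt.ne'] at hlk
      have hxN := dictLink_lt T.toIsTrie (s.a .ID) hz
      have hmk := dictLink_mark hlt.ne'
      set x := dictLink N str (s.a .ID) z with hx
      rw [hlk] at r8 r9
      have happ : F (x :: links N str (s.a .ID) (failLink N str x)) =
          F [x] ++ F (links N str (s.a .ID) (failLink N str x)) := by
        simp [hFd, answer]
      rw [happ] at r8 r9
      simp only [List.length_cons, List.length_append, add_mul] at r9
      refine wp_mono (wp_frame (wp_reportNode hS (s := s'.tick)
        (r1.congr (fun _ _ => rfl) rfl rfl rfl rfl) (r2.congr rfl rfl) r7 hxN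
        (by simpa [r6] using hmk))) ?_
      rintro s2 ⟨⟨u1, u2, u3⟩, hF2⟩
      simp only [St.tick_a, r4, r5, r6, St.tick_out, St.tick_t, ← hFd] at u1 u2 u3
      refine ⟨⟨r1.congr (fun j _ => hF2.a j (by cases j <;> rfl)) (hF2.v _ rfl) (hF2.v _ rfl)
        (hF2.v _ rfl) (hF2.v _ rfl), r2.congr (hF2.v _ rfl) (hF2.a _ rfl), ?_, ?_, ?_, ?_,
        failLink N str x, T.failLink_lt' x, u1, ?_, by omega⟩, ?_⟩
      · rw [hF2.v .q rfl]; exact r3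
      · rw [hF2.a .OI rfl]; exact r4
      · rw [hF2.a .VI rfl]; exact r5
      · rw [hF2.a .ID rfl]; exact r6
      · rw [u2, List.append_assoc, r8]
      · show s2.v .x < s'.v .x
        rw [u1, r7]
        exact (dictLink_le _ _).trans_lt (T.failLink_lt hxN hlt.ne')
    · simp only [Test.Holds, E.eval_var, E.eval_zero, r7] at hlt
      rw [if_pos (by omega)] at hlk
      rw [hlk] at r8 r9
      refine ⟨r1.congr (fun _ _ => rfl) rfl rfl rfl rfl, r2.congr rfl rfl, r3, _, rfl, ?_, ?_⟩
      · simpa [hFd, answer] using r8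
      · simp at r9 ⊢; omega

end

/-! ## Correctness of the answers -/

section

variable {σ : ℕ} {D : Dictionary σ} {N : ℕ} {str : ℕ → List (Fin σ)}

/-- The subtraction is truncated: if `W` is too short, the prefix is empty, and `u ≠ []` excludes a
false match. -/
theorem gap_suffix_iff {α : Type*} {u v W : List α} (hu : u ≠ []) (g : ℕ) :
    (∃ y : List α, y.length = g ∧ u ++ y ++ v <:+ W) ↔
      v <:+ W ∧ u <:+ W.take (W.length - (v.length + g)) := by
  constructor
  · rintro ⟨y, rfl, z, rfl⟩
    refine ⟨⟨z ++ (u ++ y), by simp⟩, z, ?_⟩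
    have e : (z ++ (u ++ y ++ v)).length - (v.length + y.length) = (z ++ u).length := by
      simp only [List.length_append]; omega
    rw [e, show z ++ (u ++ y ++ v) = (z ++ u) ++ (y ++ v) by simp, List.take_left]
  · rintro ⟨⟨z, rfl⟩, w, hw⟩
    have hlen := congrArg List.length hw
    have hpos := List.length_pos_iff.2 hu
    simp only [List.length_append, List.length_take] at hlen
    have hg : g ≤ z.length := by omega
    rw [List.length_append, show z.length + v.length - (v.length + g) = z.length - g by omega,
      List.take_append_of_le_length (by omega)] at hw
    refine ⟨z.drop (z.length - g), by simp; omega, w, ?_⟩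
    conv_rhs => rw [← List.take_append_drop (z.length - g) z, ← hw]
    simp

theorem mem_occurrences {W : List (Fin σ)} (i γ : ℕ) : (i, γ) ∈ occurrences D W ↔
    i < D.length ∧ loF D i ≤ γ ∧ γ ≤ hiF D i ∧ sndF D i <:+ W ∧
      fstF D i <:+ W.take (W.length - ((sndF D i).length + γ)) := by
  unfold occurrences
  by_cases hi : i < D.length
  · have hf := fstF_ne hi
    rw [← gap_suffix_iff hf]
    simp [hi, loF, hiF, sndF, fstF]
  · simp [hi]

variable {s : St} (hR : Ready D N str s) (W : List (Fin σ))
include hR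

/-- By `stk_spec` the stack holds the selected patterns that are alive at the time of the state, and
by `active_iff` these are the ones whose first subpattern is a suffix of the prefix before the gap.
-/
theorem Ready.mem_hits {v g : ℕ} (p : ℕ × ℕ) :
    p ∈ hits D N str (s.a .OI) (s.a .VI) W v g ↔ p.1 < D.length ∧ s.a .VI p.1 = v ∧
      p.2 = g + alphaStar D ∧ loF D p.1 ≤ p.2 ∧ p.2 ≤ hiF D p.1 ∧
      fstF D p.1 <:+ W.take (W.length - ((sndF D v).length + p.2)) := by
  have T := hR.trie
  obtain ⟨i, γ⟩ := p
  simp only [hits, List.mem_map, Prod.mk.injEq]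
  set w := W.take (W.length - ((sndF D v).length + (g + alphaStar D))) with hw
  have hx := T.state_lt w
  have hsp := (hR.stack.stk_spec (sel := selGap (s.a .VI) (Admits D) g v) _ (T.nodeTime_le hx)).1
  have hact : ∀ i < D.length, (tIn N str D.length (uNode D N str) i < nodeTime D N str (state N str w) ∧
      nodeTime D N str (state N str w) ≤ tOut N str D.length (uNode D N str) i) ↔
      fstF D i <:+ w := fun i hi => by
    have h1 := T.active_iff (d := D.length) (U := uNode D N str) (fun i _ => T.uLt i) hi hx
    rw [← T.suffix_iff_state (T.uLt i), T.strU i hi] at h1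
    exact h1
  constructor
  · rintro ⟨j, hj, rfl, rfl⟩
    obtain ⟨h1, ⟨h2, h3⟩, h4⟩ := (hsp j).1 hj
    exact ⟨h1, h2, rfl, h3.1, h3.2, (hact j h1).1 h4⟩
  · rintro ⟨h1, h2, rfl, h3, h4, h5⟩
    exact ⟨i, (hsp i).2 ⟨h1, ⟨h2, h3, h4⟩, (hact i h1).2 h5⟩, rfl, rfl⟩

theorem Ready.vi_eq_iff {x i : ℕ} (hx : s.a .ID x ≠ 0) (hi : i < D.length) :
    s.a .VI i = s.a .ID x - 1 ↔ vNode D N str i = x := by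
  have hM := hR.marked
  constructor
  · intro h
    obtain ⟨j, hj, rfl, e⟩ := hM.exists_of_id hx
    rw [e] at h
    rw [← hM.viSnd i hi, h, hM.viSnd j hj]
  · rintro rfl
    rw [hM.idV i hi]; rfl

theorem Ready.mem_answer (p : ℕ × ℕ) :
    p ∈ answer D N str (s.a .OI) (s.a .VI) (s.a .ID) W (links N str (s.a .ID) (state N str W)) ↔
      p ∈ occurrences D W := by
  have T := hR.trie
  have hM := hR.marked
  obtain ⟨i, γ⟩ := p
  rw [mem_occurrences]
  simp only [answer, List.mem_flatMap, List.mem_range, hR.mem_hits,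
    mem_links T.toIsTrie (hM.id_zero T) (T.state_lt W)]
  have hsnd : ∀ i < D.length, sndF D (s.a .VI i) = sndF D i := fun i hi => by
    rw [← T.strV _ (hM.viLt i hi), ← T.strV i hi, hM.viSnd i hi]
  constructor
  · rintro ⟨x, ⟨hx, hm, hs⟩, g, hg, h1, h2, h3, h4, h5, h6⟩
    rw [← T.suffix_iff_state hx, ← (hR.vi_eq_iff hm h1).1 h2, T.strV i h1] at hs
    rw [← h2, hsnd i h1] at h6
    exact ⟨h1, h4, h5, hs, h6⟩
  · rintro ⟨h1, h2, h3, h4, h5⟩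
    have hm : s.a .ID (vNode D N str i) ≠ 0 := by rw [hM.idV i h1]; omega
    have h6 := alphaStar_le h1
    have h7 := le_betaStar h1
    refine ⟨vNode D N str i, ⟨T.vLt i, hm, ?_⟩, γ - alphaStar D, by omega, h1,
      (hR.vi_eq_iff hm h1).2 rfl, by omega, h2, h3, ?_⟩
    · rw [← T.suffix_iff_state (T.vLt i), T.strV i h1]; exact h4
    · rw [hM.idV i h1, Nat.add_sub_cancel, hsnd i h1]; exact h5

/-- A reported pair determines where it comes from: the pattern gives the node of its second
subpattern, the gap length gives `g`, and a single stack has no repetitions. -/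
theorem Ready.nodup_answer :
    (answer D N str (s.a .OI) (s.a .VI) (s.a .ID) W
      (links N str (s.a .ID) (state N str W))).Nodup := by
  have T := hR.trie
  have h0 := hR.marked.id_zero T
  refine List.nodup_flatMap.2 ⟨fun x hx => List.nodup_flatMap.2 ⟨fun g _ => ?_, ?_⟩, ?_⟩
  · exact (hR.stack.nodup_stk (T.nodeTime_le (T.state_lt _))).map
      fun a b h => (Prod.mk.inj h).1
  · refine List.nodup_range.imp fun {g g'} hne p hp hp' => ?_
    rw [hR.mem_hits] at hp hp'
    omega
  · refine (links_pairwise T.toIsTrie h0 (T.state_lt W)).imp_of_mem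
      fun {x y} hx hy hne p hp hp' => ?_
    rw [mem_links T.toIsTrie h0 (T.state_lt W)] at hx hy
    simp only [List.mem_flatMap, hR.mem_hits] at hp hp'
    obtain ⟨g, -, h1, h2, -⟩ := hp
    obtain ⟨g', -, -, h3, -⟩ := hp'
    have e1 := (hR.vi_eq_iff hx.2.1 h1).1 h2
    have e2 := (hR.vi_eq_iff hy.2.1 h1).1 h3
    exact hne.2 (by rw [← e1, ← e2])

theorem Ready.length_answer :
    (answer D N str (s.a .OI) (s.a .VI) (s.a .ID) W
      (links N str (s.a .ID) (state N str W))).length = (occurrences D W).ncard := by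
  classical
  have e : occurrences D W = ((answer D N str (s.a .OI) (s.a .VI) (s.a .ID) W
      (links N str (s.a .ID) (state N str W))).toFinset : Set (ℕ × ℕ)) := by
    ext p; simp [hR.mem_answer]
  rw [e, Set.ncard_coe_finset, List.toFinset_card_of_nodup (hR.nodup_answer W)]

end

/-! ## Chains of subpatterns -/

section

variable {σ : ℕ} {D : Dictionary σ}

/-- The members of a chain have increasing lengths, so they are distinct among at most `2 d`
subpatterns. This makes the supremum in `lsc` meaningful, since that of an unbounded set would be
`0`, and it yields `lsc ≤ 2 d`. -/
theorem chain_length_le {c : List (List (Fin σ))} (h : ∀ u ∈ c, IsSubpattern D u)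
    (hc : c.IsChain fun u v => u <:+ v ∧ u ≠ v) : c.length ≤ 2 * D.length := by
  classical
  have h1 : c.IsChain fun u v => u.length < v.length := hc.imp fun u v ⟨h, hne⟩ =>
    lt_of_le_of_ne h.length_le fun e => hne (h.eq_of_length e)
  have h2 : (c.map List.length).IsChain (· < ·) := (List.isChain_map _).2 h1
  have h3 : c.Nodup := List.Nodup.of_map _ (h2.pairwise.imp fun h => h.ne)
  have h4 : c ⊆ D.map (·.fst) ++ D.map (·.snd) := fun u hu => by
    obtain ⟨P, hP, rfl | rfl⟩ := h u hu
    · exact List.mem_append_left _ (List.mem_map_of_mem hP)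
    · exact List.mem_append_right _ (List.mem_map_of_mem hP)
  have := (h3.subperm h4).length_le
  simp at this; omega

theorem bddAbove_chains : BddAbove {n | ∃ c : List (List (Fin σ)), c.length = n ∧
    (∀ u ∈ c, IsSubpattern D u) ∧ c.IsChain fun u v => u <:+ v ∧ u ≠ v} :=
  ⟨2 * D.length, by rintro n ⟨c, rfl, h1, h2⟩; exact chain_length_le h1 h2⟩

theorem length_le_lsc {c : List (List (Fin σ))} (h : ∀ u ∈ c, IsSubpattern D u)
    (hc : c.IsChain fun u v => u <:+ v ∧ u ≠ v) : c.length ≤ lsc D :=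
  le_csSup bddAbove_chains ⟨c, rfl, h, hc⟩

theorem lsc_le : lsc D ≤ 2 * D.length :=
  csSup_le ⟨0, [], rfl, by simp, by simp⟩
    (by rintro n ⟨c, rfl, h1, h2⟩; exact chain_length_le h1 h2)

theorem one_le_lsc (hD : D ≠ []) : 1 ≤ lsc D := by
  obtain ⟨P, hP⟩ := List.exists_mem_of_ne_nil D hD
  exact length_le_lsc (c := [P.fst]) (by simpa using ⟨P, hP, Or.inl rfl⟩) (by simp)

/-- The links are second subpatterns listed from the longest to the shortest; reversed, they form a
chain as counted by `lsc`. -/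
theorem Ready.length_links_le {N : ℕ} {str : ℕ → List (Fin σ)} {s : St} (hR : Ready D N str s)
    {x : ℕ} (hx : x < N) : (links N str (s.a .ID) x).length ≤ lsc D := by
  have T := hR.trie
  have h0 := hR.marked.id_zero T
  have h1 := links_pairwise T.toIsTrie h0 hx
  have := length_le_lsc (D := D) (c := ((links N str (s.a .ID) x).map str).reverse) ?_ ?_
  · simpa using this
  · intro u hu
    simp only [List.mem_reverse, List.mem_map, mem_links T.toIsTrie h0 hx] at hu
    obtain ⟨y, ⟨hy, hm, -⟩, rfl⟩ := hu
    obtain ⟨i, hi, rfl, -⟩ := hR.marked.exists_of_id hm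
    refine ⟨D[i], List.getElem_mem hi, Or.inr ?_⟩
    rw [T.strV i hi]; simp [sndF, hi]
  · refine List.Pairwise.isChain ?_
    rw [List.pairwise_reverse, List.pairwise_map]
    exact h1

end

/-! ## The word RAM algorithm -/

section

variable {σ : ℕ} {D : Dictionary σ}

/-- Copy the input to its place in the memory layout of the second phase. -/
def relocate : Prog := Algo.copyInput;;.asg .i 0

def preprocessCmd (σ : ℕ) : Cmd :=
  .seq (relocate.comp 1) (.seq (.op .add baseReg Var.pos.idx baseReg)
    ((Algo.build σ).comp numArr))

def queryCmd (σ : ℕ) : Cmd := (Algo.query σ).comp numArr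

/-- The cost of one step. -/
def stepCost (σ : ℕ) : ℕ :=
  max relocate.cost (max (Algo.build σ).cost (Algo.query σ).cost) + 1

def maxDeg (σ : ℕ) : ℕ :=
  max relocate.deg (max (Algo.build σ).deg (Algo.query σ).deg) + 1

def maxCst (σ : ℕ) : ℕ :=
  max relocate.cst (max (Algo.build σ).cst (Algo.query σ).cst) + numArr

/-- The length of the arrays. -/
noncomputable def arrLen (D : Dictionary σ) : ℕ :=
  100 * ((σ + 1) * (size D + 1)) + 4 * (D.length * (betaStar D - alphaStar D + 1)) + betaStar D

theorem big_of_le {S : ℕ} (h : arrLen D ≤ S) : Big D S := by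
  unfold arrLen at h
  have h1 : size D + 1 ≤ (σ + 1) * (size D + 1) := Nat.le_mul_of_pos_left _ (by omega)
  exact ⟨by omega, by omega, by omega, by omega⟩

/-- A bound on all addresses and constants. -/
noncomputable def addrBound (D : Dictionary σ) : ℕ :=
  (encode D).length + numArr * arrLen D + maxCst σ

theorem two_le_size (hD : D ≠ []) : 2 ≤ size D := by
  have := two_mul_length_le (D := D)
  have := List.length_pos_iff.2 hD
  omega

theorem addrBound_le (hD : D ≠ []) :
    addrBound D ≤ (20000 * (σ + 1) + maxCst σ) * (size D + betaStar D) ^ 2 := by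
  have h2 := two_le_size hD
  have h3 := two_mul_length_le (D := D)
  have hL := encode_length_eq (D := D)
  obtain ⟨n, hn⟩ : ∃ n, size D + betaStar D = n := ⟨_, rfl⟩
  have e1 : D.length * (betaStar D - alphaStar D + 1) ≤ n * n :=
    Nat.mul_le_mul (by omega) (by omega)
  have e2 : (σ + 1) * (size D + 1) ≤ (σ + 1) * (n * n) := Nat.mul_le_mul_left _ (by nlinarith)
  have e3 : n ≤ n * n := by nlinarith
  have e4 : maxCst σ ≤ maxCst σ * (n * n) := Nat.le_mul_of_pos_right _ (by nlinarith)
  have e5 : n * n ≤ (σ + 1) * (n * n) := Nat.le_mul_of_pos_left _ (by omega)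
  have e6 : (20000 * (σ + 1) + maxCst σ) * (n * n) =
      20000 * ((σ + 1) * (n * n)) + maxCst σ * (n * n) := by ring
  unfold addrBound arrLen
  rw [hn, pow_two, e6]
  simp only [numArr]
  omega

/-- The constant factor goes into the exponent: `A ≤ 2 ^ A ≤ n ^ A` because `2 ≤ n`. So a fixed
power of `size D + betaStar D` exceeds all intermediate values. -/
theorem addrBound_pow_lt (hD : D ≠ []) {w C : ℕ}
    (hC : (20000 * (σ + 1) + maxCst σ + 2) * maxDeg σ + 1 ≤ C)
    (hw : (size D + betaStar D) ^ C ≤ 2 ^ w) : addrBound D ^ maxDeg σ < 2 ^ w := by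
  have h2 := two_le_size hD
  obtain ⟨n, hn⟩ : ∃ n, size D + betaStar D = n := ⟨_, rfl⟩
  have h1 := addrBound_le hD
  rw [hn] at h1 hw
  have hn2 : 2 ≤ n := by omega
  set A := 20000 * (σ + 1) + maxCst σ
  have h3 : A ≤ n ^ A := (Nat.lt_two_pow_self).le.trans (Nat.pow_le_pow_left hn2 A)
  have h4 : addrBound D ≤ n ^ (A + 2) := by
    rw [pow_add]; exact h1.trans (Nat.mul_le_mul_right _ h3)
  calc addrBound D ^ maxDeg σ ≤ (n ^ (A + 2)) ^ maxDeg σ := Nat.pow_le_pow_left h4 _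
    _ = n ^ ((A + 2) * maxDeg σ) := by rw [pow_mul]
    _ < n ^ ((A + 2) * maxDeg σ + 1) := Nat.pow_lt_pow_right (by omega) (by omega)
    _ ≤ n ^ C := Nat.pow_le_pow_right (by omega) hC
    _ ≤ 2 ^ w := hw

/-- In the first phase the stride is `1` and the base `0`, so that the only array, `inp`, is the
whole memory. -/
theorem fits_relocate (hD : D ≠ []) {w : ℕ} (hw : addrBound D ^ maxDeg σ < 2 ^ w) :
    Fits 1 0 ((encode D).length + numArr * arrLen D) w (addrBound D) (maxDeg σ) := by
  have hL := encode_length_eq (D := D)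
  have h2 := two_le_size hD
  refine ⟨?_, ?_, ?_, ?_, hw, by simp only [maxDeg]; omega⟩ <;> unfold addrBound <;> omega

theorem fits_main (hD : D ≠ []) {w : ℕ} (hw : addrBound D ^ maxDeg σ < 2 ^ w) :
    Fits numArr (encode D).length (arrLen D) w (addrBound D) (maxDeg σ) := by
  have hL := encode_length_eq (D := D)
  have h2 := two_le_size hD
  refine ⟨?_, ?_, ?_, ?_, hw, by simp only [maxDeg]; omega⟩ <;> unfold addrBound <;>
    simp only [maxCst, numArr] <;> omega

theorem relocate_inLay : relocate.inLay 1 := by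
  unfold relocate Algo.copyInput Prog.for
  trivial

theorem wp_relocate {S : ℕ} (hS : Big D S) {s : St} (hi : ∀ a, s.a .inp a = inF D a)
    (h0 : ∀ y, s.v y = 0) :
    wp S relocate (fun s' => s'.v .pos = (encode D).length ∧ s'.v .d = D.length ∧
      (∀ y, y ≠ .pos → y ≠ .d → s'.v y = 0) ∧
      (∀ a, s'.a .inp a = if a < (encode D).length then inF D a else
        if (a - (encode D).length) % numArr = 0 ∧
          (a - (encode D).length) / numArr < (encode D).length
        then inF D ((a - (encode D).length) / numArr) else 0) ∧
      s'.t ≤ s.t + 20 * size D + 21) s := by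
  refine wp_seq (wp_copyInput hS hi) ?_
  rintro s1 ⟨h1, h2, h3, h4⟩ F
  refine ⟨by simp, by simp, by simpa using h1, by simpa using h2, fun y hy hy' => ?_, h3, ?_⟩
  · by_cases hyi : y = .i
    · subst hyi; simp
    · simp only [ne_eq, hyi, not_false_eq_true, St.setV_v_ne, St.tick_v]
      rw [F.v y (by revert hy hy' hyi; cases y <;> simp <;> rfl), h0]
  · simp; omega

/-- The memory left by the first phase is reread in the layout of the second: address `L + numArr *
i + j` is now cell `i` of the array with number `j`. The copies of the input are at `j = 0`, the
number of `inp`, and all other arrays are still `0`. -/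
theorem exists_relocated (hD : D ≠ []) {w : ℕ} (hw : addrBound D ^ maxDeg σ < 2 ^ w) :
    ∃ c₁ c h, Exec w (relocate.comp 1) (initial D) c₁ ∧
      Exec w (.op .add baseReg Var.pos.idx baseReg) c₁ c ∧
      Rel numArr (encode D).length (arrLen D) (stepCost σ) h c ∧
      (∀ a, h.a .inp a = inF D a) ∧ h.v .d = D.length ∧ (∀ j, j ≠ .inp → ∀ a, h.a j a = 0) ∧
      h.v .q = 0 ∧ h.v .cur = 0 ∧ h.t ≤ 20 * size D + 22 := by
  have hf := fits_relocate hD hw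
  have hL := encode_length_eq (D := D)
  have h2 := two_mul_length_le (D := D)
  obtain ⟨L, hLd⟩ : ∃ L, (encode D).length = L := ⟨_, rfl⟩
  obtain ⟨S, hSd⟩ : ∃ S, arrLen D = S := ⟨_, rfl⟩
  have hS : Big D S := big_of_le hSd.le
  have hS0 : Big D (L + numArr * S) := big_of_le (by rw [hSd]; simp only [numArr]; omega)
  have hS1 := hS.size
  rw [hLd, hSd] at hf ⊢
  rw [hLd] at hL
  have hidx : ∀ j : Arr, j.idx < 1 → j = .inp := fun j hj => Arr.idx_inj (by
    rw [show Arr.inp.idx = 0 from rfl]; omega)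
  have R0 : Rel 1 0 (L + numArr * S) (stepCost σ)
      ⟨fun _ => 0, fun j a => if j = .inp then inF D a else 0, 0, []⟩ (initial D) := by
    refine ⟨fun _ => rfl, rfl, fun j hj i _ => ?_, fun _ => Nat.zero_le _, fun j hj i _ => ?_,
      Nat.zero_le _, ?_, rfl⟩
    · rw [hidx j hj]
      simp [initial, inF, show Arr.inp.idx = 0 from rfl]
    · rw [hidx j hj]; exact hS0.inF_le i
    · show (encode D).length ≤ _
      rw [hLd]; simp only [numArr]; omega
  have hwp := wp_relocate hS0
    (s := ⟨fun _ => 0, fun j a => if j = .inp then inF D a else 0, 0, []⟩) (fun a => by simp)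
    (fun _ => rfl)
  obtain ⟨c1, h1, x1, ⟨p1, p2, p3, p4, p5⟩, R1⟩ := wp_sound hf
    (by unfold addrBound maxCst; omega) relocate_inLay (by unfold maxDeg; omega)
    (by unfold stepCost; omega) R0 hwp
  rw [hLd] at p1 p4
  have hLw : L < 2 ^ w := lt_of_le_of_lt
    ((by have := hf.addr; omega : L ≤ addrBound D).trans (Nat.le_self_pow (by unfold maxDeg; omega) _))
    hw
  refine ⟨c1, _, ⟨h1.v, fun j a => if j = .inp then inF D a else 0, h1.t + 1, h1.out⟩, x1,
    .op .., ?_, fun a => by simp, p2, fun j hj a => if_neg hj, p3 _ (by decide) (by decide),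
    p3 _ (by decide) (by decide), ?_⟩
  · refine ⟨fun x => ?_, ?_, fun j _ i hi => ?_, fun x => ?_, fun j _ i _ => ?_, ?_, ?_, R1.out⟩
    · have := x.idx_lt
      rw [← R1.reg x]
      exact Function.update_of_ne (by omega) _ _
    · simp only [Config.setReg, Config.tick, Function.update_self, BinOp.eval, R1.base, R1.reg, p1,
        add_zero]
      exact Nat.mod_eq_of_lt hLw
    · have hj := j.idx_lt
      have hlt : L + numArr * i + j.idx < L + numArr * S := by
        have : numArr * (i + 1) ≤ numArr * S := Nat.mul_le_mul_left _ hi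
        rw [mul_add] at this; omega
      have hm := R1.mem .inp (by decide) _ hlt
      simp only [zero_add, one_mul, show Arr.inp.idx = 0 from rfl, add_zero] at hm
      simp only [Config.setReg, Config.tick, hm, p4]
      have e1 : L + numArr * i + j.idx - L = numArr * i + j.idx := by omega
      rw [if_neg (by omega), e1, Nat.mul_add_mod, Nat.mod_eq_of_lt hj,
        Nat.mul_add_div (by decide), Nat.div_eq_of_lt hj, add_zero]
      by_cases hji : j = .inp
      · subst hji
        simp only [show Arr.inp.idx = 0 from rfl, true_and, if_true]
        -- Only `L` words were copied; from there on both sides are `0`.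
        split_ifs with h
        · rfl
        · rw [inF_of_le (by omega)]
      · have : j.idx ≠ 0 := fun h => hji (Arr.idx_inj h)
        rw [if_neg (fun h => this h.1), if_neg hji]
    · show h1.v x ≤ S
      by_cases hx : x = .pos
      · rw [hx, p1]; omega
      · by_cases hx' : x = .d
        · rw [hx', p2]; omega
        · rw [p3 x hx hx']; omega
    · show (if j = .inp then inF D i else 0) ≤ S
      split_ifs
      · exact hS.inF_le i
      · omega
    · have := R1.time
      simp only [Config.setReg, Config.tick, mul_add, mul_one]
      unfold stepCost at *
      omega
    · have := R1.space
      simp only [zero_add, one_mul] at this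
      exact this
  · simp at p5 ⊢; omega

/-- The invariant between two characters. -/
def Good (D : Dictionary σ) (N : ℕ) (str : ℕ → List (Fin σ)) (W : List (Fin σ)) (c : Config) : Prop :=
  ∃ h, Rel numArr (encode D).length (arrLen D) (stepCost σ) h c ∧ Ready D N str h ∧
    Ring D N str W h ∧ h.v .q = state N str W

theorem exec_preprocess (hD : D ≠ []) {w : ℕ} (hw : addrBound D ^ maxDeg σ < 2 ^ w) :
    ∃ c, Exec w (preprocessCmd σ) (initial D) c ∧
      c.time ≤ stepCost σ * (400 + 20 * σ) * (size D + D.length * (betaStar D - alphaStar D)) ∧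
      ∃ N str, Good D N str [] c := by
  have h2 := two_le_size hD
  obtain ⟨c1, c2, h, x1, x2, R, hi, hd, h0, hq, hcur, ht⟩ := exists_relocated hD hw
  obtain ⟨c3, h3, x3, ⟨⟨⟨N, str, hR⟩, ht3⟩, F⟩, R3⟩ := wp_sound (fits_main hD hw)
    (p := Algo.build σ) (by unfold addrBound maxCst; omega) (Prog.inLay_numArr _)
    (by unfold maxDeg; omega) (by unfold stepCost; omega) R
    (wp_frame (wp_build (big_of_le le_rfl) hD hi hd h0))
  refine ⟨c3, .seq x1 (.seq x2 x3), ?_, N, str, h3, R3, hR, ⟨?_, fun j _ => ?_⟩, ?_⟩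
  · refine R3.time.trans ?_
    rw [mul_assoc]
    refine Nat.mul_le_mul_left _ ?_
    nlinarith [Nat.zero_le (D.length * (betaStar D - alphaStar D))]
  · rw [F.v .cur rfl, hcur]; omega
  -- The untouched ring contains `0`, the root, and this is the state of the empty prefix.
  · rw [F.a .RG rfl, h0 _ (by decide)]
    simp [hR.trie.state_nil]
  · rw [F.v .q rfl, hq, hR.trie.state_nil]

theorem exec_query (hD : D ≠ []) {w : ℕ} (hw : addrBound D ^ maxDeg σ < 2 ^ w) {N : ℕ}
    {str : ℕ → List (Fin σ)} {W : List (Fin σ)} {c : Config} (hG : Good D N str W c) (x : Fin σ) :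
    ∃ c', Exec w (queryCmd σ) (c.feed x) c' ∧ Good D N str (W ++ [x]) c' ∧ c'.out.Nodup ∧
      (∀ p, p ∈ c'.out ↔ p ∈ occurrences D (W ++ [x])) ∧
      c'.time ≤ stepCost σ * (5 + lsc D * linkCost D + 3 * (occurrences D (W ++ [x])).ncard) ∧
      c'.space ≤ (encode D).length + numArr * arrLen D := by
  obtain ⟨h, R, hR, hW, hq⟩ := hG
  have hS : Big D (arrLen D) := big_of_le le_rfl
  have hσ : σ ≤ arrLen D := by have := hS.alph; nlinarith
  set h' : St := ⟨Function.update h.v .ch x, h.a, 0, []⟩ with hh'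
  -- Register `0`, where the character arrives, is the register of the variable `ch`.
  have R' : Rel numArr (encode D).length (arrLen D) (stepCost σ) h' (c.feed x) := by
    refine ⟨fun y => ?_, ?_, R.mem, fun y => ?_, R.memLe, Nat.zero_le _, R.space, rfl⟩
    · by_cases hy : y = .ch
      · subst hy; rfl
      · have : y.idx ≠ 0 := fun e => hy (Var.idx_inj e)
        simp only [Config.feed, hh', Function.update_of_ne this, Function.update_of_ne hy, R.reg]
    · have : baseReg ≠ 0 := by decide
      simp only [Config.feed, Function.update_of_ne this, R.base]
    · by_cases hy : y = .ch
      · subst hy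
        simp only [hh', Function.update_self]
        omega
      · simp only [hh', Function.update_of_ne hy]
        exact R.regLe y
  obtain ⟨c', h2, x2, ⟨r1, r2, r3, l, hl, ho, ht⟩, R2⟩ := wp_sound (fits_main hD hw)
    (p := Algo.query σ) (by unfold addrBound maxCst; omega) (Prog.inLay_numArr _)
    (by unfold maxDeg; omega) (by unfold stepCost; omega) R'
    (wp_query hS hD (s := h') (hR.congr (fun _ _ => rfl) rfl rfl rfl rfl) (hW.congr rfl rfl) hq
      (c := x) rfl)
  subst hl
  have ho' : c'.out = answer D N str (h.a .OI) (h.a .VI) (h.a .ID) (W ++ [x])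
      (links N str (h.a .ID) (state N str (W ++ [x]))) := R2.out.trans ho
  refine ⟨c', x2, ⟨h2, R2, r1, r2, r3⟩, ?_, ?_, ?_, R2.space⟩
  · rw [ho']; exact hR.nodup_answer _
  · intro p; rw [ho']; exact hR.mem_answer _ p
  · refine R2.time.trans (Nat.mul_le_mul_left _ ?_)
    have h4 := hR.length_answer (W ++ [x])
    have h5 := hR.length_links_le (hR.trie.state_lt (W ++ [x]))
    have h6 := Nat.mul_le_mul_right (linkCost D) h5
    simp only [hh'] at ht
    rw [h4] at ht
    omega

end

/-! ## The bounds -/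

section

variable {σ : ℕ} {D : Dictionary σ}

theorem one_le_log {f : ℝ} (hf : 1 ≤ f) : 1 ≤ Real.log (f + 2) := by
  rw [Real.le_log_iff_exp_le (by linarith)]
  have := Real.exp_one_lt_d9
  linarith

/-- From `√d ≤ f` follows `2 d ≤ (f + 2) ^ 3`, so a search among the `2 d` times is logarithmic in
the bound `f` itself. The factor is `3 / log 2 < 5`, plus one for the last round. -/
theorem searchSteps_le {f : ℝ} (hD : D ≠ []) (hf : 1 ≤ f) (h : √(D.length : ℝ) ≤ f) :
    (searchSteps D : ℝ) ≤ 6 * Real.log (f + 2) := by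
  have hd : (1 : ℝ) ≤ D.length := by exact_mod_cast List.length_pos_iff.2 hD
  have h1 := one_le_log hf
  have h2 : (Nat.log 2 (2 * D.length) : ℝ) ≤ Real.logb 2 (2 * D.length) := by
    have := Real.natLog_le_logb (2 * D.length) 2
    exact_mod_cast this
  have h3 : (D.length : ℝ) ≤ f ^ 2 := (Real.sqrt_le_left (by linarith)).1 h
  have h4 : Real.log (2 * D.length) ≤ 3 * Real.log (f + 2) := by
    rw [show 3 * Real.log (f + 2) = Real.log ((f + 2) ^ 3) by rw [Real.log_pow]; norm_num]
    refine Real.log_le_log (by linarith) ?_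
    have e1 : (f + 2) ^ 3 = (f + 2) * (f + 2) ^ 2 := by ring
    have e2 : f ^ 2 ≤ (f + 2) ^ 2 := by nlinarith
    have e3 : 2 * (f + 2) ^ 2 ≤ (f + 2) * (f + 2) ^ 2 :=
      mul_le_mul_of_nonneg_right (by linarith) (by positivity)
    linarith
  have h5 := Real.log_two_gt_d9
  have h6 : Real.logb 2 (2 * D.length) ≤ 5 * Real.log (f + 2) := by
    rw [Real.logb, div_le_iff₀ (by linarith)]
    nlinarith
  unfold searchSteps
  push_cast
  linarith

/-- Since `lsc ≤ 2 d`, the square of `lsc / 2` is at most `lsc * d`, hence `lsc ≤ 2 √(lsc d)`. As `M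
≥ 1`, the product of `lsc` and the number of gap lengths is then at most twice the square-root term.
The factor `20 * 2 * 6 = 240` of the logarithm leaves room in `300` for the other summands. -/
theorem time_bound (hD : D ≠ []) (op : ℕ) :
    SoftLE 300 1 (5 + lsc D * linkCost D + 3 * op : ℕ)
      (lsc D + √(lsc D * D.length : ℝ) * (betaStar D - alphaStar D + maxSnd D : ℝ) + op) := by
  have hα := alphaStar_le_betaStar hD
  have hd : 1 ≤ D.length := List.length_pos_iff.2 hD
  have hl1 := one_le_lsc hD
  have hl2 := lsc_le (D := D)
  have hM : 1 ≤ maxSnd D :=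
    Nat.le_trans (List.length_pos_iff.2 (sndF_ne hd)) (le_maxSnd hd)
  have e : betaStar D + 1 - alphaStar D = betaStar D - alphaStar D + 1 := by omega
  obtain ⟨Δ, hΔ⟩ : ∃ Δ, betaStar D - alphaStar D = Δ := ⟨_, rfl⟩
  have hΔ' : (betaStar D - alphaStar D : ℝ) = Δ := by rw [← hΔ]; push_cast [hα]; rfl
  have hcost : linkCost D ≤ 20 * searchSteps D * (Δ + 1) := by
    have : 1 ≤ searchSteps D := by unfold searchSteps; omega
    unfold linkCost
    rw [e, hΔ]
    nlinarith [Nat.zero_le (Δ * searchSteps D)]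
  have hcost' : (linkCost D : ℝ) ≤ 20 * searchSteps D * (Δ + 1) := by exact_mod_cast hcost
  rw [hΔ']
  have rl1 : (1 : ℝ) ≤ lsc D := by exact_mod_cast hl1
  have rl2 : (lsc D : ℝ) ≤ 2 * D.length := by exact_mod_cast hl2
  have rM : (1 : ℝ) ≤ maxSnd D := by exact_mod_cast hM
  have rd : (1 : ℝ) ≤ D.length := by exact_mod_cast hd
  have rop : (0 : ℝ) ≤ op := Nat.cast_nonneg _
  have rΔ : (0 : ℝ) ≤ Δ := Nat.cast_nonneg _
  obtain ⟨r, hr⟩ : ∃ r, √(lsc D * D.length : ℝ) = r := ⟨_, rfl⟩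
  have r0 : 0 ≤ r := hr ▸ Real.sqrt_nonneg _
  have r1 : (lsc D : ℝ) ≤ 2 * r := by
    have : √((lsc D : ℝ) / 2 * (lsc D / 2)) ≤ r := by
      rw [← hr]; exact Real.sqrt_le_sqrt (by nlinarith)
    rw [Real.sqrt_mul_self (by linarith)] at this
    linarith
  have r2 : √(D.length : ℝ) ≤ r := by
    rw [← hr]; exact Real.sqrt_le_sqrt (by nlinarith)
  rw [hr]
  obtain ⟨f, hf⟩ : ∃ f, (lsc D : ℝ) + r * (Δ + maxSnd D) + op = f := ⟨_, rfl⟩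
  have q1 : r * (Δ + 1) ≤ r * (Δ + maxSnd D) := mul_le_mul_of_nonneg_left (by linarith) r0
  have q2 : 0 ≤ r * Δ := mul_nonneg r0 rΔ
  have f1 : 1 ≤ f := by nlinarith
  have f2 : √(D.length : ℝ) ≤ f := by nlinarith
  have hlog := one_le_log f1
  have hL := searchSteps_le hD f1 f2
  rw [hf]
  have f3 : (lsc D : ℝ) * (Δ + 1) ≤ 2 * f := by
    have : (lsc D : ℝ) * (Δ + 1) ≤ 2 * r * (Δ + 1) :=
      mul_le_mul_of_nonneg_right r1 (by linarith)
    nlinarith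
  have f4 : (lsc D : ℝ) * linkCost D ≤ 40 * (searchSteps D * f) := by
    calc (lsc D : ℝ) * linkCost D ≤ lsc D * (20 * searchSteps D * (Δ + 1)) :=
          mul_le_mul_of_nonneg_left hcost' (by linarith)
      _ = 20 * searchSteps D * (lsc D * (Δ + 1)) := by ring
      _ ≤ 20 * searchSteps D * (2 * f) := mul_le_mul_of_nonneg_left f3 (by positivity)
      _ = 40 * (searchSteps D * f) := by ring
  have f5 : (searchSteps D : ℝ) * f ≤ 6 * Real.log (f + 2) * f :=
    mul_le_mul_of_nonneg_right hL (by linarith)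
  have f6 : f ≤ f * Real.log (f + 2) := le_mul_of_one_le_right (by linarith) hlog
  have f7 : (op : ℝ) ≤ f := by nlinarith
  unfold SoftLE
  push_cast
  rw [pow_one]
  nlinarith

theorem SoftLE.of_le {C C' k : ℕ} {x y f : ℝ} (h : SoftLE C k x f) (hy : y ≤ C' * x)
    (C'' : ℕ) (hC : C' * C ≤ C'') (hf : 1 ≤ f) : SoftLE C'' k y f := by
  have hlog := one_le_log hf
  unfold SoftLE at *
  have h1 : (0 : ℝ) ≤ f * Real.log (f + 2) ^ k := by positivity
  have h2 : ((C' * C : ℕ) : ℝ) ≤ C'' := by exact_mod_cast hC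
  push_cast at h2
  calc y ≤ C' * x := hy
    _ ≤ C' * (C * f * Real.log (f + 2) ^ k) := mul_le_mul_of_nonneg_left h (by positivity)
    _ = C' * C * (f * Real.log (f + 2) ^ k) := by ring
    _ ≤ C'' * (f * Real.log (f + 2) ^ k) := mul_le_mul_of_nonneg_right h2 h1
    _ = C'' * f * Real.log (f + 2) ^ k := by ring

/-- The ring needs `β*` cells, and `β*` is `α*` plus a difference that is at most `d (β* - α*)`. The
square-root term of the theorem is not needed here. -/
theorem space_le (hD : D ≠ []) : (encode D).length + numArr * arrLen D ≤ (20000 * (σ + 1)) *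
    (size D + D.length * (betaStar D - alphaStar D) + alphaStar D) := by
  have h2 := two_le_size hD
  have h3 := two_mul_length_le (D := D)
  have hL := encode_length_eq (D := D)
  have hα := alphaStar_le_betaStar hD
  have hd : 1 ≤ D.length := List.length_pos_iff.2 hD
  obtain ⟨Δ, hΔ⟩ : ∃ Δ, betaStar D - alphaStar D = Δ := ⟨_, rfl⟩
  have h4 : Δ ≤ D.length * Δ := Nat.le_mul_of_pos_left _ hd
  unfold arrLen
  rw [hΔ]
  have e1 : (σ + 1) * (size D + 1) ≤ 2 * ((σ + 1) * size D) := by nlinarith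
  have e2 : (20000 * (σ + 1)) * (size D + D.length * Δ + alphaStar D) =
    20000 * ((σ + 1) * size D) + 20000 * ((σ + 1) * (D.length * Δ)) +
      20000 * ((σ + 1) * alphaStar D) := by ring
  have e3 : size D ≤ (σ + 1) * size D := Nat.le_mul_of_pos_left _ (by omega)
  have e4 : D.length * Δ ≤ (σ + 1) * (D.length * Δ) := Nat.le_mul_of_pos_left _ (by omega)
  have e5 : alphaStar D ≤ (σ + 1) * alphaStar D := Nat.le_mul_of_pos_left _ (by omega)
  rw [e2, mul_add D.length]
  simp only [numArr]
  omega

theorem space_bound (hD : D ≠ []) :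
    SoftLE (20000 * (σ + 1)) 1 ((encode D).length + numArr * arrLen D : ℕ)
      (size D + D.length * (betaStar D - alphaStar D : ℝ) +
        √(lsc D * D.length : ℝ) * (betaStar D - alphaStar D + maxSnd D : ℝ) + alphaStar D) := by
  have hα := alphaStar_le_betaStar hD
  have h2 := two_le_size hD
  have h := space_le hD
  obtain ⟨Δ, hΔ⟩ : ∃ Δ, betaStar D - alphaStar D = Δ := ⟨_, rfl⟩
  have hΔ' : (betaStar D - alphaStar D : ℝ) = Δ := by rw [← hΔ]; push_cast [hα]; rfl
  rw [hΔ] at h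
  rw [hΔ']
  have hs : (2 : ℝ) ≤ size D := by exact_mod_cast h2
  have hr : 0 ≤ √(lsc D * D.length : ℝ) * (Δ + maxSnd D : ℝ) := by positivity
  have hdΔ : (0 : ℝ) ≤ D.length * Δ := by positivity
  have ha : (0 : ℝ) ≤ alphaStar D := by positivity
  have h' : (((encode D).length + numArr * arrLen D : ℕ) : ℝ) ≤ ((20000 * (σ + 1) : ℕ) : ℝ) *
      (size D + D.length * Δ + alphaStar D) := by exact_mod_cast h
  obtain ⟨f, hf⟩ : ∃ f, (size D + D.length * (Δ : ℝ) + √(lsc D * D.length : ℝ) * (Δ + maxSnd D : ℝ) +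
    alphaStar D) = f := ⟨_, rfl⟩
  rw [hf]
  have hlog := one_le_log (f := f) (by linarith)
  unfold SoftLE
  rw [pow_one]
  have h0 : (0 : ℝ) ≤ ((20000 * (σ + 1) : ℕ) : ℝ) := Nat.cast_nonneg _
  calc (((encode D).length + numArr * arrLen D : ℕ) : ℝ)
      ≤ ((20000 * (σ + 1) : ℕ) : ℝ) * (size D + D.length * Δ + alphaStar D) := h'
    _ ≤ ((20000 * (σ + 1) : ℕ) : ℝ) * f := mul_le_mul_of_nonneg_left (by linarith) h0
    _ ≤ ((20000 * (σ + 1) : ℕ) : ℝ) * f * Real.log (f + 2) :=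
      le_mul_of_one_le_right (mul_nonneg h0 (by linarith)) hlog

theorem prefixOf_succ (T : ℕ → Fin σ) (n : ℕ) : prefixOf T (n + 1) = prefixOf T n ++ [T n] := by
  simp [prefixOf, List.range_succ]

end

end DMOG

/-! ### The main theorem. -/

open DMOG in
theorem theoremt (σ : ℕ) :
    ∃ (preprocess query : Cmd) (C k : ℕ), ∀ D : Dictionary σ, D ≠ [] →
      ∀ w : ℕ, (size D + betaStar D) ^ C ≤ 2 ^ w →
      ∃ s₀ : Config, Exec w preprocess (initial D) s₀ ∧
        s₀.time ≤ C * (size D + D.length * (betaStar D - alphaStar D)) ∧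
        ∀ T : ℕ → Fin σ, ∃ s : ℕ → Config, s 0 = s₀ ∧ ∀ n : ℕ,
          Exec w query ((s n).feed (T n)) (s (n + 1)) ∧
          (s (n + 1)).out.Nodup ∧
          (∀ p : ℕ × ℕ, p ∈ (s (n + 1)).out ↔ p ∈ occurrences D (prefixOf T (n + 1))) ∧
          SoftLE C k (s (n + 1)).time
            (lsc D + √(lsc D * D.length : ℝ) * (betaStar D - alphaStar D + maxSnd D : ℝ) +
              (occurrences D (prefixOf T (n + 1))).ncard) ∧
          SoftLE C k (s (n + 1)).space
            (size D + D.length * (betaStar D - alphaStar D : ℝ) +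
              √(lsc D * D.length : ℝ) * (betaStar D - alphaStar D + maxSnd D : ℝ) +
              alphaStar D) := by
  -- The summands serve, in this order, the exponent for the word length, the preprocessing time,
  -- the time per character and the space.
  obtain ⟨C, hC⟩ : ∃ C, ((20000 * (σ + 1) + maxCst σ + 2) * maxDeg σ + 1) +
    stepCost σ * (400 + 20 * σ) + stepCost σ * 300 + 20000 * (σ + 1) = C := ⟨_, rfl⟩
  refine ⟨preprocessCmd σ, queryCmd σ, C, 1, fun D hD w hw => ?_⟩
  have hw' := addrBound_pow_lt hD (by omega) hw
  obtain ⟨s₀, x₀, ht, N, str, hG⟩ := exec_preprocess hD hw'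
  refine ⟨s₀, x₀, ht.trans (Nat.mul_le_mul_right _ (by omega)), fun T => ?_⟩
  have : Nonempty Config := ⟨s₀⟩
  -- One step needs only the invariant `Good`, so the configurations for an infinite text arise by
  -- recursion from a choice of the next one.
  choose! f hf using fun (n : ℕ) (c : Config) (h : Good D N str (prefixOf T n) c) =>
    exec_query hD hw' h (T n)
  simp only [← prefixOf_succ] at hf
  have hs : ∀ n, Good D N str (prefixOf T n) (Nat.rec s₀ (fun n c => f n c) n) := by
    intro n
    induction n with
    | zero => exact hG
    | succ n ih => exact (hf n _ ih).2.1
  refine ⟨fun n => Nat.rec s₀ (fun n c => f n c) n, rfl, fun n => ?_⟩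
  obtain ⟨h1, -, h2, h3, h4, h5⟩ := hf n _ (hs n)
  have hα : (alphaStar D : ℝ) ≤ betaStar D := by exact_mod_cast alphaStar_le_betaStar hD
  have hr : 0 ≤ √(lsc D * D.length : ℝ) * (betaStar D - alphaStar D + maxSnd D : ℝ) :=
    mul_nonneg (Real.sqrt_nonneg _) (by linarith [Nat.cast_nonneg (α := ℝ) (maxSnd D)])
  refine ⟨h1, h2, h3, (time_bound hD _).of_le (by exact_mod_cast h4) C (by omega) ?_,
    (space_bound hD).of_le (C' := 1) (by rw [Nat.cast_one, one_mul]; exact_mod_cast h5) C (by omega)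
      ?_⟩
  · have h6 : (1 : ℝ) ≤ lsc D := by exact_mod_cast one_le_lsc hD
    linarith [Nat.cast_nonneg (α := ℝ) (occurrences D (prefixOf T (n + 1))).ncard]
  · have h6 : (2 : ℝ) ≤ size D := by exact_mod_cast two_le_size hD
    have h7 : (0 : ℝ) ≤ D.length * (betaStar D - alphaStar D : ℝ) :=
      mul_nonneg (Nat.cast_nonneg _) (by linarith)
    linarith [Nat.cast_nonneg (α := ℝ) (alphaStar D)]
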